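/- Let the cake be $[0,1]$. Each of $n\ge 1$ agents has a value density $f_i:[0,1]\to\mathbb R_{\ge 0}$ that is piecewise constant (constant on each member of some finite partition of $[0,1]$ into intervals) with $\int_0^1 f_i>0$, and values $S\subseteq[0,1]$ at $v_i(S)=\int_S f_i(x)\,dx$. An allocation is a tuple $(A_1,\dots,A_n)$ of finite unions of closed subintervals of $[0,1]$ of positive length, with pairwise intersections of measure zero, such that every part of the cake that some agent values is allocated, i.e. $v_i\bigl([0,1]\setminus\bigcup_j A_j\bigr)=0$ for all $i$ (parts that nobody values may, but need not, be discarded; in particular mechanisms that always allocate the entire cake are included). A (deterministic) mechanism $M$ for $n$ agents maps every tuple of reported densities $(f_1,\dots,f_n)$ to an allocation $(M_1(\boldsymbol f),\dots,M_n(\boldsymbol f))$. It is envy-free if $v_i(M_i(\boldsymbol f))\ge v_i(M_j(\boldsymbol f))$ for all $\boldsymbol f,i,j$, and satisfies the connected pieces constraint if every $M_i(\boldsymbol f)$ is connected. Its incentive ratio is $$\mathrm{IR}(M)=\sup_{f_1,\dots,f_n}\ \sup_{i}\ \sup_{f_i'}\ \frac{v_i(M_i(f_1,\dots,f_i',\dots,f_n))}{v_i(M_i(f_1,\dots,f_i,\dots,f_n))}\in[0,\infty].$$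 Theorem. Envy-free cake cutting mechanisms with the connected pieces constraint have incentive ratio $\Theta(n)$, uniformly over all such mechanisms. Precisely: (1) for every $n\ge1$, every such mechanism $M$ for $n$ agents has $\mathrm{IR}(M)\le n$; (2) there is an absolute constant $c>0$ such that for every $n\ge 1$ every such mechanism $M$ for $n$ agents has $\mathrm{IR}(M)\ge c\,n$; (3) moreover, for every integer $k\ge 1$ there is a profile $\boldsymbol f$ of $8k-3$ densities such that, for every such mechanism $M$ for $8k-3$ agents, there is an agent $i$ with $v_i(M_i(\boldsymbol f))\le 1.1$ who, for every $\varepsilon>0$, has a misreport $f_i'$ with $v_i(M_i(f_1,\dots,f_i',\dots,f_{8k-3}))\ge k-\varepsilon$. -/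

import Mathlib

open MeasureTheory

namespace CakeCutting

/-- `f` is piecewise constant on the cake `[0, 1]`: the cake can be partitioned into finitely many
intervals on each of which `f` is constant. -/
def IsPiecewiseConstant (f : ℝ → ℝ) : Prop :=
  ∃ (m : ℕ) (X : Fin m → Set ℝ),
    (∀ t, (X t).OrdConnected) ∧
    Pairwise (fun s t => Disjoint (X s) (X t)) ∧
    (⋃ t, X t) = Set.Icc 0 1 ∧
    ∀ t, ∃ c : ℝ, ∀ x ∈ X t, f x = c

/-- A value density on the cake `[0, 1]`: nonnegative, piecewise constant, with a positive value for
the entire cake. A function on `[0, 1]` is represented by its extension by zero to `ℝ`. -/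
structure Density where
  toFun : ℝ → ℝ
  nonneg : ∀ x, 0 ≤ toFun x
  eq_zero_outside : ∀ x, x ∉ Set.Icc (0 : ℝ) 1 → toFun x = 0
  piecewiseConstant : IsPiecewiseConstant toFun
  total_pos : 0 < ∫ x in Set.Icc (0 : ℝ) 1, toFun x

/-- The value of a part `S` of the cake under the density `f`. -/
noncomputable def value (f : Density) (S : Set ℝ) : ℝ :=
  ∫ x in S, f.toFun x

/-- One density for each of the `n` agents. -/
abbrev Profile (n : ℕ) : Type := Fin n → Density

/-- A bundle is a union of finitely many closed subintervals of `[0, 1]` of positive length. -/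
def IsBundle (S : Set ℝ) : Prop :=
  ∃ (m : ℕ) (a b : Fin m → ℝ),
    (∀ t, 0 ≤ a t ∧ a t < b t ∧ b t ≤ 1) ∧ S = ⋃ t, Set.Icc (a t) (b t)

/-- `A` is an allocation of the cake among agents with densities `f`. Every part of the cake which
some agent values is allocated: only a part that has value zero for all agents may be discarded.
(Allocations of the entire cake are the special case in which nothing is discarded.) -/
structure IsAllocation {n : ℕ} (f : Profile n) (A : Fin n → Set ℝ) : Prop where
  bundle : ∀ i, IsBundle (A i)
  overlap_null : ∀ i j, i ≠ j → volume (A i ∩ A j) = 0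
  exhaustive : ∀ i, value (f i) (Set.Icc 0 1 \ ⋃ j, A j) = 0

/-- No agent prefers the bundle of another agent to his own. -/
def IsEnvyFreeAllocation {n : ℕ} (f : Profile n) (A : Fin n → Set ℝ) : Prop :=
  ∀ i j, value (f i) (A j) ≤ value (f i) (A i)

/-- A (deterministic) cake cutting mechanism for `n` agents: it maps each tuple of reported
densities to an allocation. -/
structure Mechanism (n : ℕ) where
  alloc : Profile n → Fin n → Set ℝ
  isAllocation : ∀ f, IsAllocation f (alloc f)

/-- The mechanism always outputs an allocation that is envy-free for the reported densities. -/
def Mechanism.EnvyFree {n : ℕ} (M : Mechanism n) : Prop :=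
  ∀ f, IsEnvyFreeAllocation f (M.alloc f)

/-- Connected pieces constraint: each agent always receives a connected piece. -/
def Mechanism.HasConnectedPieces {n : ℕ} (M : Mechanism n) : Prop :=
  ∀ f i, IsPreconnected (M.alloc f i)

/-- Utility, under his true density `f i`, of agent `i` when he reports `g` and all other agents
report truthfully. -/
noncomputable def Mechanism.utilityOfReport {n : ℕ} (M : Mechanism n) (f : Profile n) (i : Fin n)
    (g : Density) : ℝ :=
  value (f i) (M.alloc (Function.update f i g) i)

/-- Utility of agent `i` when all agents report truthfully. -/
noncomputable def Mechanism.truthfulUtility {n : ℕ} (M : Mechanism n) (f : Profile n) (i : Fin n) :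
    ℝ :=
  value (f i) (M.alloc f i)

/-- The incentive ratio of a mechanism for `n` agents: the supremum, over all profiles, agents and
misreports, of the utility from misreporting divided by the utility from truth-telling. It is an
extended nonnegative real, so the supremum always exists; a positive utility divided by zero is
infinite. -/
noncomputable def Mechanism.incentiveRatio {n : ℕ} (M : Mechanism n) : ENNReal :=
  ⨆ (f : Profile n) (i : Fin n) (g : Density),
    ENNReal.ofReal (M.utilityOfReport f i g) / ENNReal.ofReal (M.truthfulUtility f i)

end CakeCutting

/-! ### Proportionality and the upper bound. -/

namespace CakeCutting

/-! Upper bound: an envy-free allocation is proportional, so a truthful agent has at least `1 / n`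
of the cake's value, and no report yields more than all of it.

Lower bound: one profile defeats every mechanism. The cake, rescaled to length `2 * D`, has two
mirror-image sides, each with one liar, `g` guards and `f` fillers; put `N = g + 1`. Measured from
its cake end, a side consists of a line of length `f + 1/8`, a spot for its guards, `N` units of its
liar with a wall between consecutive units, and one home per filler. A liar values a tip close to
his cake end at `21/20` and each unit at `1`. A filler values length on the line, and his home at
`1`. A guard values each cell of his line at `8 * N ^ 2`, his spot at `5 * N ^ 2`, and one wall on
the opposite side at `8 * N ^ 2 + 1`.

If no liar's piece ends on the line of a side, the fillers force the line into unit cells: those at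
home make every stretch on it at most `1`, those on it need at least `1`, and the pieces begin at
the integers. A guard there has just one cell (`Side.guard_of_off`), less than his wall, so no other
agent may hold that wall (`not_wall_of_off`), and the truthful liar opposite gets at most one unit.
Hence under truth-telling some liar has at most `21/20`: a liar at his cake end has at most the tip,
and if neither is there, one of them is confined to a unit (`exists_own_le`).

Let the liar of side `s` instead report two spots flanking his units, worth `1` and `51/50`, and a
little near the opposite cake end. His own line is then in the undisturbed state, so the opposite
liar is confined to one unit or his tip, and must take the tip (`liar_not_tip`). If he takes less
than `1/2` of his line, the cell structure there is shifted. As the guards' head masses grow from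
cell to cell, shifted unit pieces are worth more than a cell; if some guard were away, the pieces
after the tip would have to belong to guards one after another, until all guards are used up
(`Side.guard_of_on`). So all guards are on that line, none holds a wall between the lying agent's
units, and nobody else can separate his two spots. If the opposite liar takes `1/2` or more, the
report values his piece at `21/20`, more than either spot, so again the lying agent must get value
from both spots. Either way he gets all `N` units between them (`lie_units`).

The remainder turns these cumulative values into densities and allocations into tilings, extending
the pieces over worthless gaps. With fillers split evenly, `N` is a fixed fraction of the number of
agents. -/

theorem Density.integrableOn (f : Density) : IntegrableOn f.toFun (Set.Icc 0 1) := by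
  by_contra h
  exact f.total_pos.ne' (integral_undef h)

theorem IsBundle.measurableSet {S : Set ℝ} (h : IsBundle S) : MeasurableSet S := by
  obtain ⟨m, a, b, -, rfl⟩ := h
  exact MeasurableSet.iUnion fun t => measurableSet_Icc

theorem IsBundle.subset {S : Set ℝ} (h : IsBundle S) : S ⊆ Set.Icc 0 1 := by
  obtain ⟨m, a, b, h, rfl⟩ := h
  exact Set.iUnion_subset fun t => Set.Icc_subset_Icc (h t).1 (h t).2.2

theorem value_nonneg (f : Density) (S : Set ℝ) : 0 ≤ value f S :=
  integral_nonneg fun x => f.nonneg x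

theorem value_le_total (f : Density) {S : Set ℝ} (hS : S ⊆ Set.Icc 0 1) :
    value f S ≤ value f (Set.Icc 0 1) :=
  setIntegral_mono_set f.integrableOn (Filter.Eventually.of_forall f.nonneg)
    (Filter.Eventually.of_forall hS)

/-- The pieces of an allocation exhaust the value which each agent has for the cake. -/
theorem IsAllocation.sum_value {n : ℕ} {f : Profile n} {A : Fin n → Set ℝ} (h : IsAllocation f A)
    (i : Fin n) : ∑ j, value (f i) (A j) = value (f i) (Set.Icc 0 1) := by
  have hsub : ⋃ j, A j ⊆ Set.Icc 0 1 := Set.iUnion_subset fun j => (h.bundle j).subset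
  have hmeas : MeasurableSet (⋃ j, A j) := MeasurableSet.iUnion fun j => (h.bundle j).measurableSet
  have hunion : ∫ x in ⋃ j, A j, (f i).toFun x = ∑ j, value (f i) (A j) :=
    (integral_iUnion_ae (fun j => (h.bundle j).measurableSet.nullMeasurableSet)
      (fun j k hjk => h.overlap_null j k hjk) ((f i).integrableOn.mono_set hsub)).trans
      (tsum_fintype _)
  have hdiff := setIntegral_sdiff (μ := volume) hmeas (f i).integrableOn hsub
  have hex := h.exhaustive i
  unfold value at hex ⊢
  unfold value at hunion
  linarith

/-- Envy-free allocations are proportional. -/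
theorem IsEnvyFreeAllocation.total_le {n : ℕ} {f : Profile n} {A : Fin n → Set ℝ}
    (hA : IsAllocation f A) (h : IsEnvyFreeAllocation f A) (i : Fin n) :
    value (f i) (Set.Icc 0 1) ≤ n * value (f i) (A i) := by
  rw [← hA.sum_value i]
  calc ∑ j, value (f i) (A j) ≤ ∑ _j : Fin n, value (f i) (A i) := Finset.sum_le_sum fun j _ => h i j
    _ = n * value (f i) (A i) := by simp

theorem Mechanism.incentiveRatio_le {n : ℕ} (M : Mechanism n) (hM : M.EnvyFree) :
    M.incentiveRatio ≤ (n : ENNReal) := by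
  refine iSup_le fun f => iSup_le fun i => iSup_le fun g => ?_
  have hle := (hM f).total_le (M.isAllocation f) i
  have hub : M.utilityOfReport f i g ≤ n * M.truthfulUtility f i :=
    (value_le_total _ ((M.isAllocation _).bundle i).subset).trans hle
  refine ENNReal.div_le_of_le_mul ?_
  rw [← ENNReal.ofReal_natCast, ← ENNReal.ofReal_mul (Nat.cast_nonneg n)]
  exact ENNReal.ofReal_le_ofReal hub

theorem Mechanism.truthfulUtility_pos {n : ℕ} (M : Mechanism n) (hM : M.EnvyFree) (f : Profile n)
    (i : Fin n) : 0 < M.truthfulUtility f i := by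
  have hle := (hM f).total_le (M.isAllocation f) i
  have htot : 0 < value (f i) (Set.Icc 0 1) := (f i).total_pos
  exact pos_of_mul_pos_right (htot.trans_le hle) (Nat.cast_nonneg n)

/-- One profile with a profitable misreport bounds the incentive ratio from below. -/
theorem Mechanism.le_incentiveRatio {n : ℕ} (M : Mechanism n) (hM : M.EnvyFree) (f : Profile n)
    (i : Fin n) (g : Density) {r : ℝ} (h : r * M.truthfulUtility f i ≤ M.utilityOfReport f i g) :
    ENNReal.ofReal r ≤ M.incentiveRatio := by
  have hpos := M.truthfulUtility_pos hM f i
  refine le_trans ?_ (le_iSup_of_le f (le_iSup_of_le i (le_iSup_of_le g le_rfl)))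
  rw [← ENNReal.ofReal_div_of_pos hpos]
  exact ENNReal.ofReal_le_ofReal ((le_div_iff₀ hpos).2 h)

/-! ### Piecewise linear cumulative functions. -/

/-- Cumulative distribution function of the uniform distribution on `[a, b]`. -/
noncomputable def ramp (a b y : ℝ) : ℝ := max 0 (min 1 ((y - a) / (b - a)))

theorem ramp_nonneg (a b y : ℝ) : 0 ≤ ramp a b y := le_max_left _ _

theorem ramp_le_one (a b y : ℝ) : ramp a b y ≤ 1 := max_le zero_le_one (min_le_left _ _)

theorem ramp_mono {a b : ℝ} (h : a < b) : Monotone (ramp a b) := by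
  intro x y hxy
  unfold ramp
  have : (x - a) / (b - a) ≤ (y - a) / (b - a) := by
    have : 0 < b - a := by linarith
    gcongr
  gcongr

theorem ramp_of_le {a b y : ℝ} (h : a < b) (hy : y ≤ a) : ramp a b y = 0 := by
  have : (y - a) / (b - a) ≤ 0 := div_nonpos_of_nonpos_of_nonneg (by linarith) (by linarith)
  rw [ramp, min_eq_right (by linarith), max_eq_left this]

theorem ramp_of_ge {a b y : ℝ} (h : a < b) (hy : b ≤ y) : ramp a b y = 1 := by
  have : 1 ≤ (y - a) / (b - a) := by rw [le_div_iff₀ (by linarith)]; linarith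
  rw [ramp, min_eq_left this, max_eq_right zero_le_one]

theorem ramp_of_mem {a b y : ℝ} (h : a < b) (h1 : a ≤ y) (h2 : y ≤ b) :
    ramp a b y = (y - a) / (b - a) := by
  have h3 : (y - a) / (b - a) ≤ 1 := by rw [div_le_iff₀ (by linarith)]; linarith
  have h4 : 0 ≤ (y - a) / (b - a) := div_nonneg (by linarith) (by linarith)
  rw [ramp, min_eq_right h3, max_eq_right h4]

/-- Cumulative distribution on `f` unit cells, with mass `p j` uniform on the first half and mass
`q j` uniform on the second half of cell `j`. -/
noncomputable def cells (p q : ℕ → ℝ) (f : ℕ) (y : ℝ) : ℝ :=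
  ∑ j ∈ Finset.range f, (p j * ramp j (j + 1 / 2) y + q j * ramp (j + 1 / 2) (j + 1) y)

theorem cells_mono {p q : ℕ → ℝ} (hp : ∀ j, 0 ≤ p j) (hq : ∀ j, 0 ≤ q j) (f : ℕ) :
    Monotone (cells p q f) := by
  intro x y hxy
  refine Finset.sum_le_sum fun j _ => ?_
  have h1 := ramp_mono (a := (j : ℝ)) (b := j + 1 / 2) (by linarith) hxy
  have h2 := ramp_mono (a := (j : ℝ) + 1 / 2) (b := j + 1) (by linarith) hxy
  have := mul_le_mul_of_nonneg_left h1 (hp j)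
  have := mul_le_mul_of_nonneg_left h2 (hq j)
  linarith

theorem cells_of_ge (p q : ℕ → ℝ) {f : ℕ} {y : ℝ} (hy : (f : ℝ) ≤ y) :
    cells p q f y = ∑ j ∈ Finset.range f, (p j + q j) := by
  refine Finset.sum_congr rfl fun j hj => ?_
  have : ((j + 1 : ℕ) : ℝ) ≤ f := by exact_mod_cast Finset.mem_range.1 hj
  push_cast at this
  rw [ramp_of_ge (by linarith) (by linarith), ramp_of_ge (by linarith) (by linarith)]
  ring

theorem cells_of_le (p q : ℕ → ℝ) {f t : ℕ} {y : ℝ} (ht : t ≤ f) (hy : y ≤ t) :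
    cells p q f y = cells p q t y := by
  unfold cells
  rw [← Finset.sum_range_add_sum_Ico _ ht]
  refine (add_eq_left).2 (Finset.sum_eq_zero fun j hj => ?_)
  have : (t : ℝ) ≤ j := by exact_mod_cast (Finset.mem_Ico.1 hj).1
  rw [ramp_of_le (by linarith) (by linarith), ramp_of_le (by linarith) (by linarith)]
  ring

theorem cells_eq (p q : ℕ → ℝ) {f t : ℕ} {y : ℝ} (ht : t < f) (h1 : (t : ℝ) ≤ y) (h2 : y ≤ t + 1) :
    cells p q f y = ∑ j ∈ Finset.range t, (p j + q j) + p t * ramp t (t + 1 / 2) y +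
      q t * ramp (t + 1 / 2) (t + 1) y := by
  rw [cells_of_le p q (t := t + 1) ht (by push_cast; exact h2), ← cells_of_ge p q h1]
  simp only [cells, Finset.sum_range_succ]
  ring

/-! ### The guards' valuation of their line. -/

/-- The mass on the first half of cell `j` of a guard's line. -/
noncomputable def headMass (N j : ℕ) : ℝ := 4 * N * min ((j : ℝ) + 1) N

/-- Cumulative value of a guard on a line of length `f`. -/
noncomputable def guardLine (f N : ℕ) : ℝ → ℝ :=
  cells (headMass N) (fun j => 8 * N ^ 2 - headMass N j) f

theorem headMass_nonneg (N j : ℕ) : 0 ≤ headMass N j := by unfold headMass; positivity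

/-- The cap is half of a cell's mass `8 * N ^ 2`, so every tail is at least as heavy as its head. -/
theorem headMass_le (N j : ℕ) : headMass N j ≤ 4 * N ^ 2 := by
  unfold headMass
  have : min ((j : ℝ) + 1) N ≤ N := min_le_right _ _
  have hN : (0 : ℝ) ≤ N := Nat.cast_nonneg N
  nlinarith

theorem headMass_of_lt {N j : ℕ} (h : j < N) : headMass N j = 4 * N * (j + 1) := by
  have : (j : ℝ) + 1 ≤ N := by exact_mod_cast h
  rw [headMass, min_eq_left this]

theorem headMass_of_ge {N j : ℕ} (h : N ≤ j + 1) : headMass N j = 4 * N ^ 2 := by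
  have : (N : ℝ) ≤ j + 1 := by exact_mod_cast h
  rw [headMass, min_eq_right this]
  ring

/-- Growing heads are what makes a unit piece off the grid gain value; below the cap the increment
is `4 * N`. -/
theorem headMass_le_succ (N j : ℕ) : headMass N j ≤ headMass N (j + 1) := by
  unfold headMass
  gcongr
  · linarith

theorem tailMass_nonneg (N j : ℕ) : 0 ≤ 8 * (N : ℝ) ^ 2 - headMass N j := by
  nlinarith [headMass_le N j]

theorem guardLine_mono (f N : ℕ) : Monotone (guardLine f N) :=
  cells_mono (headMass_nonneg N) (tailMass_nonneg N) f

theorem guardLine_of_ge {f N : ℕ} {y : ℝ} (hy : (f : ℝ) ≤ y) :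
    guardLine f N y = f * (8 * N ^ 2) := by
  rw [guardLine, cells_of_ge _ _ hy]
  simp

theorem guardLine_eq {f t : ℕ} (N : ℕ) {y : ℝ} (ht : t < f) (h1 : (t : ℝ) ≤ y) (h2 : y ≤ t + 1) :
    guardLine f N y = t * (8 * N ^ 2) + headMass N t * ramp t (t + 1 / 2) y +
      (8 * N ^ 2 - headMass N t) * ramp (t + 1 / 2) (t + 1) y := by
  rw [guardLine, cells_eq _ _ ht h1 h2]
  simp

theorem guardLine_natCast {f t : ℕ} (N : ℕ) (ht : t ≤ f) :
    guardLine f N t = t * (8 * N ^ 2) := by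
  rcases ht.eq_or_lt with rfl | ht
  · exact guardLine_of_ge le_rfl
  · rw [guardLine_eq N ht le_rfl (by linarith), ramp_of_le (by linarith) (by linarith),
      ramp_of_le (by linarith) (by linarith)]
    ring

theorem guardLine_head {f t : ℕ} (N : ℕ) {s : ℝ} (ht : t < f) (h1 : 0 ≤ s) (h2 : s ≤ 1 / 2) :
    guardLine f N (t + s) = t * (8 * N ^ 2) + 2 * headMass N t * s := by
  rw [guardLine_eq N ht (by linarith) (by linarith),
    ramp_of_mem (by linarith) (by linarith) (by linarith),
    ramp_of_le (y := t + s) (by linarith) (by linarith)]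
  have h3 : (t : ℝ) + 1 / 2 - t = 1 / 2 := by ring
  rw [h3]
  ring

theorem guardLine_tail {f t : ℕ} (N : ℕ) {s : ℝ} (ht : t < f) (h1 : 1 / 2 ≤ s) (h2 : s ≤ 1) :
    guardLine f N (t + s) =
      t * (8 * N ^ 2) + headMass N t + (8 * N ^ 2 - headMass N t) * (2 * s - 1) := by
  rw [guardLine_eq N ht (by linarith) (by linarith),
    ramp_of_ge (y := t + s) (by linarith) (by linarith),
    ramp_of_mem (by linarith) (by linarith) (by linarith)]
  have h3 : (t : ℝ) + 1 - (t + 1 / 2) = 1 / 2 := by ring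
  rw [h3]
  ring

theorem guardLine_lt {f t N : ℕ} (hN : 0 < N) {y : ℝ} (ht : t < f) (h2 : y < t + 1) :
    guardLine f N y < (t + 1) * (8 * N ^ 2) := by
  have hN' : (0 : ℝ) < N := by exact_mod_cast hN
  have h3 : guardLine f N y ≤ guardLine f N (t + max (1 / 2) (y - t)) :=
    guardLine_mono f N (by linarith [le_max_right (1 / 2) (y - t)])
  refine h3.trans_lt ?_
  have h4 : max (1 / 2) (y - t) < 1 := max_lt (by norm_num) (by linarith)
  rw [guardLine_tail N ht (le_max_left _ _) h4.le]
  nlinarith [headMass_le N t, sq_pos_of_pos hN']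

/-- Shifting a unit interval off the grid trades the beginning of one cell for the beginning of the
next. Cells have equal mass and later heads are no lighter, so nothing is lost. -/
theorem le_guardLine_add_one {f N : ℕ} {x : ℝ} (h0 : 0 ≤ x) (h1 : x + 1 ≤ f) :
    8 * (N : ℝ) ^ 2 ≤ guardLine f N (x + 1) - guardLine f N x := by
  obtain ⟨t, ht1, ht2⟩ : ∃ t : ℕ, (t : ℝ) ≤ x ∧ x < t + 1 :=
    ⟨⌊x⌋₊, Nat.floor_le h0, Nat.lt_floor_add_one x⟩
  have htf : t + 1 ≤ f := by
    have : (t : ℝ) + 1 ≤ f := by linarith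
    exact_mod_cast this
  rcases htf.eq_or_lt with htf | htf
  · have hx : x = t := by
      rw [← htf] at h1; push_cast at h1; linarith
    subst htf hx
    have h3 := guardLine_natCast (f := t + 1) N (t := t) (by omega)
    have h4 := guardLine_natCast (f := t + 1) N (t := t + 1) le_rfl
    push_cast at h3 h4
    rw [h3, h4]
    linarith
  · have hb := headMass_le_succ N t
    rcases le_total (x - t) (1 / 2) with hs | hs
    · have h3 := guardLine_head (f := f) (t := t) N (s := x - t) (by omega) (by linarith) hs
      have h4 := guardLine_head (f := f) (t := t + 1) N (s := x - t) (by omega) (by linarith) hs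
      have e1 : (t : ℝ) + (x - t) = x := by ring
      have e2 : ((t + 1 : ℕ) : ℝ) + (x - t) = x + 1 := by push_cast; ring
      rw [e1] at h3
      rw [e2] at h4
      push_cast at h4
      rw [h3, h4]
      nlinarith
    · have h3 := guardLine_tail (f := f) (t := t) N (s := x - t) (by omega) hs (by linarith)
      have h4 := guardLine_tail (f := f) (t := t + 1) N (s := x - t) (by omega) hs (by linarith)
      have e1 : (t : ℝ) + (x - t) = x := by ring
      have e2 : ((t + 1 : ℕ) : ℝ) + (x - t) = x + 1 := by push_cast; ring
      rw [e1] at h3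
      rw [e2] at h4
      push_cast at h4
      rw [h3, h4]
      nlinarith

/-- Swapping heads and tails gives a complementary monotone function; the two add up to `16 * N ^ 2`
times length on the line. The masses `1 / 2` below encode length itself. -/
theorem guardLine_sub_le {f N : ℕ} {x y : ℝ} (h0 : 0 ≤ x) (hxy : x ≤ y) :
    guardLine f N y - guardLine f N x ≤ 16 * N ^ 2 * (y - x) := by
  have key : ∀ t : ℕ, t < f → ∀ y : ℝ, (t : ℝ) ≤ y → y ≤ t + 1 →
      cells (fun _ => 1 / 2) (fun _ => 1 / 2) f y = y := by
    intro t ht y h1 h2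
    rw [cells_eq _ _ ht h1 h2]
    rcases le_total y (t + 1 / 2) with h | h
    · rw [ramp_of_mem (by linarith) h1 h, ramp_of_le (by linarith) h]
      have h3 : (t : ℝ) + 1 / 2 - t = 1 / 2 := by ring
      rw [h3]
      simp
      ring
    · rw [ramp_of_ge (by linarith) h, ramp_of_mem (by linarith) h h2]
      have h3 : (t : ℝ) + 1 - (t + 1 / 2) = 1 / 2 := by ring
      rw [h3]
      simp
      ring
  have key2 : ∀ y : ℝ, 0 ≤ y → cells (fun _ => 1 / 2) (fun _ => 1 / 2) f y = min y f := by
    intro y hy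
    rcases le_or_gt (f : ℝ) y with h | h
    · rw [cells_of_ge _ _ h, min_eq_right h]
      simp
      ring
    · rw [min_eq_left h.le]
      have h5 := Nat.floor_le hy
      have h6 := Nat.lt_floor_add_one y
      refine key ⌊y⌋₊ ?_ y h5 h6.le
      have : (⌊y⌋₊ : ℝ) < f := by linarith
      exact_mod_cast this
  have hm := cells_mono (p := fun j => 8 * (N : ℝ) ^ 2 - headMass N j) (q := headMass N)
    (tailMass_nonneg N) (headMass_nonneg N) f hxy
  have hsum : ∀ z : ℝ, cells (fun j => 8 * (N : ℝ) ^ 2 - headMass N j) (headMass N) f z +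
      guardLine f N z = 16 * N ^ 2 * cells (fun _ => 1 / 2) (fun _ => 1 / 2) f z := by
    intro z
    unfold guardLine cells
    rw [← Finset.sum_add_distrib, Finset.mul_sum]
    refine Finset.sum_congr rfl fun j _ => ?_
    ring
  have h1 := hsum x
  have h2 := hsum y
  rw [key2 x h0] at h1
  rw [key2 y (h0.trans hxy)] at h2
  have h3 : min y (f : ℝ) - min x f ≤ y - x := by
    rcases le_total x f with h | h
    · rw [min_eq_left h]; linarith [min_le_left y (f : ℝ)]
    · rw [min_eq_right h, min_eq_right (h.trans hxy)]; linarith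
  have h4 : (0 : ℝ) ≤ 16 * N ^ 2 := by positivity
  nlinarith [mul_le_mul_of_nonneg_left h3 h4]

/-! ### Fillers and guards on a single side. -/

/-- Lengths within `[0, b]` of the pieces of a tiling add up to `b`. -/
theorem sum_length_eq {ι : Type*} [Fintype ι] {lo hi : ι → ℝ} {b : ℝ} (hb : 0 ≤ b)
    (hlt : ∀ j, lo j < hi j) (hnonneg : ∀ j, 0 ≤ lo j)
    (hdisj : ∀ i j, i ≠ j → hi i ≤ lo j ∨ hi j ≤ lo i)
    (hcover : ∀ y, 0 ≤ y → y < b → ∃ j, lo j ≤ y ∧ y < hi j) :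
    ∑ j, (min (hi j) b - min (lo j) b) = b := by
  have hU : ⋃ j, Set.Ico (min (lo j) b) (min (hi j) b) = Set.Ico 0 b := by
    ext y
    simp only [Set.mem_iUnion, Set.mem_Ico, min_le_iff, lt_min_iff]
    constructor
    · rintro ⟨j, h1 | h1, h2, h3⟩
      · exact ⟨(hnonneg j).trans h1, h3⟩
      · exact absurd h3 (not_lt.2 h1)
    · rintro ⟨h1, h2⟩
      obtain ⟨j, h3, h4⟩ := hcover y h1 h2
      exact ⟨j, Or.inl h3, h4, h2⟩
  have hd : Pairwise (Function.onFun Disjoint fun j => Set.Ico (min (lo j) b) (min (hi j) b)) := by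
    intro i j hij
    refine Set.disjoint_left.2 fun y hy hy' => ?_
    simp only [Set.mem_Ico, min_le_iff, lt_min_iff] at hy hy'
    rcases hdisj i j hij with h | h
    · rcases hy'.1 with h1 | h1 <;> linarith [hy.2.1, hy.2.2]
    · rcases hy.1 with h1 | h1 <;> linarith [hy'.2.1, hy'.2.2]
  have hm := measureReal_iUnion_fintype (μ := volume) hd (fun j => measurableSet_Ico)
    (fun j => by simp)
  rw [hU] at hm
  simp only [Real.volume_real_Ico] at hm
  rw [max_eq_left (by linarith), sub_zero] at hm
  refine Eq.trans (Finset.sum_congr rfl fun j _ => (max_eq_left ?_).symm) hm.symm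
  have := min_le_min_right b (hlt j).le
  linarith

/-- One side of the cake: a line `[0, f + 1/8]` starting at the cake end, on which `f` fillers and
`g` guards live, and the homes `[h + i, h + i + 1]` of the fillers. The piece of agent `j` is
`[lo j, hi j]`. -/
structure Side {ι : Type*} (f g : ℕ) (lo hi : ι → ℝ) (fil : Fin f → ι) (gd : Fin g → ι)
    (h : ℝ) : Prop where
  two_mul_lt : 2 * g + 2 ≤ f
  le_h : (f : ℝ) + 3 ≤ h
  lt : ∀ j, lo j < hi j
  nonneg : ∀ j, 0 ≤ lo j
  disj : ∀ i j, i ≠ j → hi i ≤ lo j ∨ hi j ≤ lo i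
  cover : ∀ y, 0 ≤ y → y < h + f → ∃ j, lo j ≤ y ∧ y < hi j
  fil_inj : Function.Injective fil
  fil_ne_gd : ∀ i j, fil i ≠ gd j
  filler_sep : ∀ i, lo (fil i) < f + 1 / 8 → hi (fil i) ≤ h
  filler_envyFree : ∀ (i : Fin f) (j : ι),
    (min (hi j) (f + 1 / 8) - min (lo j) (f + 1 / 8)) +
        (ramp (h + i) (h + i + 1) (hi j) - ramp (h + i) (h + i + 1) (lo j)) ≤
      (min (hi (fil i)) (f + 1 / 8) - min (lo (fil i)) (f + 1 / 8)) +
        (ramp (h + i) (h + i + 1) (hi (fil i)) - ramp (h + i) (h + i + 1) (lo (fil i)))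
  home_owner : ∀ j, h ≤ lo j → hi j < h + f → j ∈ Set.range fil
  guard_envyFree : ∀ i j, hi (gd i) ≤ h →
    (guardLine f (g + 1) (hi j) - guardLine f (g + 1) (lo j)) +
        5 * ((g : ℝ) + 1) ^ 2 * (ramp (f + 1) (f + 2) (hi j) - ramp (f + 1) (f + 2) (lo j)) ≤
      (guardLine f (g + 1) (hi (gd i)) - guardLine f (g + 1) (lo (gd i))) +
        5 * ((g : ℝ) + 1) ^ 2 *
          (ramp (f + 1) (f + 2) (hi (gd i)) - ramp (f + 1) (f + 2) (lo (gd i)))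

namespace Side

variable {ι : Type*} {f g : ℕ} {lo hi : ι → ℝ} {fil : Fin f → ι} {gd : Fin g → ι}
  {h : ℝ}

/-- The number of fillers whose piece does not meet the line. -/
noncomputable def numHome (f : ℕ) (lo : ι → ℝ) (fil : Fin f → ι) : ℕ :=
  (Finset.univ.filter fun i : Fin f => (f : ℝ) + 1 / 8 ≤ lo (fil i)).card

theorem room_nonneg (S : Side f g lo hi fil gd h) (j : ι) (b : ℝ) :
    0 ≤ min (hi j) b - min (lo j) b :=
  sub_nonneg.2 (min_le_min_right b (S.lt j).le)

theorem sum_room [Fintype ι] (S : Side f g lo hi fil gd h) :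
    ∑ j, (min (hi j) ((f : ℝ) + 1 / 8) - min (lo j) (f + 1 / 8)) = f + 1 / 8 := by
  have hh := S.le_h
  have hf : (0 : ℝ) ≤ f := Nat.cast_nonneg f
  exact sum_length_eq (by positivity) S.lt S.nonneg S.disj
    fun y h1 h2 => S.cover y h1 (by linarith)

/-- Two pieces which contain the same point are equal. -/
theorem eq_of_mem (S : Side f g lo hi fil gd h) {i j : ι} {y : ℝ} (h1 : lo i ≤ y) (h2 : y < hi i)
    (h3 : lo j ≤ y) (h4 : y < hi j) : i = j := by
  by_contra hne
  rcases S.disj i j hne with h5 | h5 <;> linarith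

/-- A piece ending inside a home either starts among the homes, and then belongs to a filler off the
line, or it crosses `h`, which only one piece does. Each piece cuts at most one home by its far end.
-/
theorem card_cut_le [Fintype ι] (S : Side f g lo hi fil gd h) :
    (Finset.univ.filter fun i : Fin f => ∃ j, h + i < hi j ∧ hi j < h + i + 1).card ≤
      numHome f lo fil + 1 := by
  classical
  have hf := S.le_h
  set C := Finset.univ.filter fun i : Fin f => ∃ j, h + i < hi j ∧ hi j < h + i + 1 with hC
  have hex : ∀ i : Fin f, ∃ j, i ∈ C → h + i < hi j ∧ hi j < h + i + 1 := by
    intro i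
    by_cases hi' : i ∈ C
    · obtain ⟨j, hj⟩ := (Finset.mem_filter.1 hi').2
      exact ⟨j, fun _ => hj⟩
    · exact ⟨fil i, fun h => absurd h hi'⟩
  choose φ hφ using hex
  have hinj : Set.InjOn φ C := by
    intro i hi1 i' hi2 he
    have h1 := hφ i hi1
    have h2 := hφ i' hi2
    rw [he] at h1
    have h3 : (i : ℝ) < i' + 1 := by linarith
    have h4 : (i' : ℝ) < i + 1 := by linarith
    have h5 : (i : ℕ) < i' + 1 := by exact_mod_cast h3
    have h6 : (i' : ℕ) < i + 1 := by exact_mod_cast h4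
    exact Fin.ext (by omega)
  rw [← Finset.card_image_of_injOn hinj]
  set H := Finset.univ.filter fun i : Fin f => (f : ℝ) + 1 / 8 ≤ lo (fil i) with hH
  set X := Finset.univ.filter fun j : ι => lo j < h ∧ h < hi j with hX
  have hX1 : X.card ≤ 1 := by
    refine Finset.card_le_one.2 fun a ha b hb => ?_
    have h1 := (Finset.mem_filter.1 ha).2
    have h2 := (Finset.mem_filter.1 hb).2
    exact S.eq_of_mem h1.1.le h1.2 h2.1.le h2.2
  have hsub : C.image φ ⊆ H.image fil ∪ X := by
    intro j hj
    obtain ⟨i, hi1, rfl⟩ := Finset.mem_image.1 hj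
    have h1 := hφ i hi1
    have h0 : (0 : ℝ) ≤ (i : ℕ) := Nat.cast_nonneg _
    have h2 : ((i : ℕ) : ℝ) + 1 ≤ f := by exact_mod_cast i.2
    rcases lt_or_ge (lo (φ i)) h with h3 | h3
    · exact Finset.mem_union_right _ (Finset.mem_filter.2 ⟨Finset.mem_univ _, h3, by linarith⟩)
    · obtain ⟨i', hi'⟩ := S.home_owner (φ i) h3 (by linarith)
      refine Finset.mem_union_left _ (Finset.mem_image.2 ⟨i', ?_, hi'⟩)
      refine Finset.mem_filter.2 ⟨Finset.mem_univ _, ?_⟩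
      rw [hi']
      linarith
  calc (C.image φ).card ≤ (H.image fil ∪ X).card := Finset.card_le_card hsub
    _ ≤ (H.image fil).card + X.card := Finset.card_union_le _ _
    _ ≤ H.card + 1 := Nat.add_le_add Finset.card_image_le hX1

/-- If few fillers are at home, then each filler on the line has at least the value of a home. -/
theorem one_le_room [Fintype ι] (S : Side f g lo hi fil gd h) (hm : 2 * numHome f lo fil + 1 < f) (i : Fin f)
    (hi1 : lo (fil i) < f + 1 / 8) :
    1 ≤ min (hi (fil i)) ((f : ℝ) + 1 / 8) - min (lo (fil i)) (f + 1 / 8) := by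
  classical
  have hf := S.le_h
  have hhome : ∀ i i' : Fin f, lo (fil i) < f + 1 / 8 →
      ramp (h + i') (h + i' + 1) (hi (fil i)) - ramp (h + i') (h + i' + 1) (lo (fil i)) = 0 := by
    intro i i' hi2
    have h1 := S.filler_sep i hi2
    have h2 := S.lt (fil i)
    have h3 : (0 : ℝ) ≤ (i' : ℕ) := Nat.cast_nonneg _
    rw [ramp_of_le (by linarith) (by linarith), ramp_of_le (by linarith) (by linarith), sub_zero]
  -- Fillers off the line and cut homes together number at most `2 * numHome + 1 < f`, so some
  -- filler on the line has an uncut home.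
  obtain ⟨i₀, h1, h2⟩ : ∃ i₀ : Fin f, lo (fil i₀) < f + 1 / 8 ∧
      ¬ ∃ j, h + i₀ < hi j ∧ hi j < h + i₀ + 1 := by
    by_contra hcon
    push Not at hcon
    have hsub : (Finset.univ : Finset (Fin f)) ⊆
        (Finset.univ.filter fun i : Fin f => (f : ℝ) + 1 / 8 ≤ lo (fil i)) ∪
        (Finset.univ.filter fun i : Fin f => ∃ j, h + i < hi j ∧ hi j < h + i + 1) := by
      intro i _
      rcases lt_or_ge (lo (fil i)) (f + 1 / 8) with h3 | h3
      · exact Finset.mem_union_right _ (Finset.mem_filter.2 ⟨Finset.mem_univ _, hcon i h3⟩)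
      · exact Finset.mem_union_left _ (Finset.mem_filter.2 ⟨Finset.mem_univ _, h3⟩)
    have h4 := Finset.card_le_card hsub
    rw [Finset.card_univ, Fintype.card_fin] at h4
    have h5 := h4.trans (Finset.card_union_le _ _)
    have h6 := S.card_cut_le
    unfold numHome at hm h6
    omega
  have h3 : ((i₀ : ℕ) : ℝ) + 1 ≤ f := by exact_mod_cast i₀.2
  have h0 : (0 : ℝ) ≤ (i₀ : ℕ) := Nat.cast_nonneg _
  obtain ⟨j, h4, h5⟩ := S.cover (h + i₀) (by linarith) (by linarith)
  have h6 : h + i₀ + 1 ≤ hi j := by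
    by_contra h7
    exact h2 ⟨j, h5, not_le.1 h7⟩
  have h7 := S.filler_envyFree i₀ j
  rw [hhome i₀ i₀ h1, ramp_of_ge (by linarith) h6, ramp_of_le (by linarith) h4] at h7
  have h8 := S.room_nonneg j (f + 1 / 8)
  -- All fillers on the line measure it by length and get nothing from homes, so the bound for one
  -- transfers to every other.
  have h9 := S.filler_envyFree i (fil i₀)
  rw [hhome i₀ i h1, hhome i i hi1] at h9
  linarith

/-- A filler off the line has at most his home, worth `1`, and would envy any longer stretch of the
line. -/
theorem room_le_one (S : Side f g lo hi fil gd h) (hm : numHome f lo fil ≠ 0) (j : ι) :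
    min (hi j) ((f : ℝ) + 1 / 8) - min (lo j) (f + 1 / 8) ≤ 1 := by
  obtain ⟨i, hi1⟩ := Finset.card_ne_zero.1 hm
  have h1 := (Finset.mem_filter.1 hi1).2
  have h2 := S.filler_envyFree i j
  rw [min_eq_right h1, min_eq_right (h1.trans (S.lt _).le)] at h2
  have h3 := ramp_mono (a := h + i) (b := h + i + 1) (by linarith) (S.lt j).le
  have h4 := ramp_le_one (h + i) (h + i + 1) (hi (fil i))
  have h5 := ramp_nonneg (h + i) (h + i + 1) (lo (fil i))
  linarith

/-- The number of guards whose piece meets the line. -/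
noncomputable def numGuard (f : ℕ) (lo : ι → ℝ) (gd : Fin g → ι) : ℕ :=
  (Finset.univ.filter fun i : Fin g => lo (gd i) < (f : ℝ) + 1 / 8).card

/-- If there are few guards and other agents on the line, then there are few fillers at home. -/
theorem numHome_le [Fintype ι] (S : Side f g lo hi fil gd h) (F : Finset ι)
    (hF : ∀ j, lo j < f + 1 / 8 → j ∉ Set.range fil → j ∉ Set.range gd → j ∈ F)
    (hcard : F.card + numGuard f lo gd ≤ g + 1) : numHome f lo fil ≤ g := by
  classical
  by_cases hm : numHome f lo fil = 0
  · omega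
  have hsum := S.sum_room
  have hle : ∀ j, min (hi j) ((f : ℝ) + 1 / 8) - min (lo j) (f + 1 / 8) ≤
      if lo j < f + 1 / 8 then 1 else 0 := by
    intro j
    split_ifs with h1
    · exact S.room_le_one hm j
    · rw [min_eq_right (not_lt.1 h1), min_eq_right ((not_lt.1 h1).trans (S.lt _).le), sub_self]
  have h1 := Finset.sum_le_sum fun j (_ : j ∈ Finset.univ) => hle j
  rw [hsum, Finset.sum_boole] at h1
  -- The surplus `1 / 8` of the line forces one piece more than there are fillers.
  have h2 : f + 1 ≤ (Finset.univ.filter fun j => lo j < (f : ℝ) + 1 / 8).card := by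
    have : (f : ℝ) < (Finset.univ.filter fun j => lo j < (f : ℝ) + 1 / 8).card := by linarith
    exact_mod_cast this
  have hsub : (Finset.univ.filter fun j => lo j < (f : ℝ) + 1 / 8) ⊆
      ((Finset.univ.filter fun i : Fin f => ¬ (f : ℝ) + 1 / 8 ≤ lo (fil i)).image fil ∪
      (Finset.univ.filter fun i : Fin g => lo (gd i) < (f : ℝ) + 1 / 8).image gd) ∪ F := by
    intro j hj
    have hj := (Finset.mem_filter.1 hj).2
    by_cases h3 : j ∈ Set.range fil
    · obtain ⟨i, rfl⟩ := h3
      refine Finset.mem_union_left _ (Finset.mem_union_left _ (Finset.mem_image_of_mem _ ?_))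
      exact Finset.mem_filter.2 ⟨Finset.mem_univ _, not_le.2 hj⟩
    by_cases h4 : j ∈ Set.range gd
    · obtain ⟨i, rfl⟩ := h4
      refine Finset.mem_union_left _ (Finset.mem_union_right _ (Finset.mem_image_of_mem _ ?_))
      exact Finset.mem_filter.2 ⟨Finset.mem_univ _, hj⟩
    exact Finset.mem_union_right _ (hF j hj h3 h4)
  have h3 := (Finset.card_le_card hsub).trans (Finset.card_union_le _ _)
  have h4 := Finset.card_union_le
    ((Finset.univ.filter fun i : Fin f => ¬ (f : ℝ) + 1 / 8 ≤ lo (fil i)).image fil)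
    ((Finset.univ.filter fun i : Fin g => lo (gd i) < (f : ℝ) + 1 / 8).image gd)
  have h5 := Finset.card_image_le (f := fil)
    (s := Finset.univ.filter fun i : Fin f => ¬ (f : ℝ) + 1 / 8 ≤ lo (fil i))
  have h6 := Finset.card_image_le (f := gd)
    (s := Finset.univ.filter fun i : Fin g => lo (gd i) < (f : ℝ) + 1 / 8)
  have h7 := Finset.card_filter_add_card_filter_not (s := (Finset.univ : Finset (Fin f)))
    (fun i : Fin f => (f : ℝ) + 1 / 8 ≤ lo (fil i))
  rw [Finset.card_univ, Fintype.card_fin] at h7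
  unfold numGuard at hcard
  unfold numHome
  omega

/-- Some piece is worth at least a cell for every guard. -/
theorem exists_filler [Fintype ι] (S : Side f g lo hi fil gd h) (hm : numHome f lo fil ≤ g) :
    ∃ i, lo (fil i) + 1 ≤ f ∧ lo (fil i) + 1 ≤ hi (fil i) := by
  classical
  have hg := S.two_mul_lt
  have h7 := Finset.card_filter_add_card_filter_not (s := (Finset.univ : Finset (Fin f)))
    (fun i : Fin f => (f : ℝ) + 1 / 8 ≤ lo (fil i))
  rw [Finset.card_univ, Fintype.card_fin] at h7
  have h8 : 1 < (Finset.univ.filter fun i : Fin f => ¬ (f : ℝ) + 1 / 8 ≤ lo (fil i)).card := by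
    unfold numHome at hm
    omega
  obtain ⟨a, ha, b, hb, hab⟩ := Finset.one_lt_card.1 h8
  have ha := not_le.1 (Finset.mem_filter.1 ha).2
  have hb := not_le.1 (Finset.mem_filter.1 hb).2
  have ra := S.one_le_room (by omega) a ha
  have rb := S.one_le_room (by omega) b hb
  rw [min_eq_left ha.le] at ra
  rw [min_eq_left hb.le] at rb
  have ma := min_le_left (hi (fil a)) ((f : ℝ) + 1 / 8)
  have mb := min_le_left (hi (fil b)) ((f : ℝ) + 1 / 8)
  have ma' := min_le_right (hi (fil a)) ((f : ℝ) + 1 / 8)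
  have mb' := min_le_right (hi (fil b)) ((f : ℝ) + 1 / 8)
  -- The piece nearer the cake end is chosen: the other one keeps it away from the surplus `1 / 8`,
  -- so its first unit lies within the cells.
  rcases S.disj _ _ (S.fil_inj.ne hab) with h1 | h1
  · exact ⟨a, by linarith, by linarith⟩
  · exact ⟨b, by linarith, by linarith⟩

/-- A guard must not envy a filler whose piece contains a unit stretch of the cells. -/
theorem le_guard_value [Fintype ι] (S : Side f g lo hi fil gd h) (hm : numHome f lo fil ≤ g) (i : Fin g)
    (hi1 : hi (gd i) ≤ h) :
    8 * ((g : ℝ) + 1) ^ 2 ≤ (guardLine f (g + 1) (hi (gd i)) - guardLine f (g + 1) (lo (gd i))) +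
        5 * ((g : ℝ) + 1) ^ 2 *
          (ramp (f + 1) (f + 2) (hi (gd i)) - ramp (f + 1) (f + 2) (lo (gd i))) := by
  obtain ⟨i', h1, h2⟩ := S.exists_filler hm
  refine le_trans ?_ (S.guard_envyFree i (fil i') hi1)
  have h3 := le_guardLine_add_one (N := g + 1) (S.nonneg (fil i')) h1
  have h4 := guardLine_mono f (g + 1) h2
  have h5 := ramp_mono (a := (f : ℝ) + 1) (b := f + 2) (by linarith) (S.lt (fil i')).le
  have h6 : 0 ≤ 5 * ((g : ℝ) + 1) ^ 2 * (ramp (f + 1) (f + 2) (hi (fil i')) -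
    ramp (f + 1) (f + 2) (lo (fil i'))) := mul_nonneg (by positivity) (by linarith)
  push_cast at h3
  linarith

theorem exists_start_eq_hi (S : Side f g lo hi fil gd h) {j : ι} (hj : hi j < h + f) :
    ∃ j', lo j' = hi j := by
  obtain ⟨j', h1, h2⟩ := S.cover (hi j) ((S.nonneg j).trans (S.lt j).le) hj
  have hne : j ≠ j' := by rintro rfl; exact lt_irrefl _ h2
  rcases S.disj j j' hne with h3 | h3
  · exact ⟨j', le_antisymm h1 h3⟩
  · linarith [S.lt j]

theorem exists_start_eq_zero (S : Side f g lo hi fil gd h) : ∃ j, lo j = 0 := by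
  have hh := S.le_h
  have hf : (0 : ℝ) ≤ f := Nat.cast_nonneg f
  obtain ⟨j, h1, -⟩ := S.cover 0 le_rfl (by linarith)
  exact ⟨j, le_antisymm h1 (S.nonneg j)⟩

theorem card_crossing_le_one [Fintype ι] (S : Side f g lo hi fil gd h) {b : ℝ} (F : Finset ι)
    (hF : ∀ j ∈ F, lo j < b ∧ b < hi j) : F.card ≤ 1 :=
  Finset.card_le_one.2 fun x hx y hy =>
    S.eq_of_mem (hF x hx).1.le (hF x hx).2 (hF y hy).1.le (hF y hy).2

/-- If nobody but the fillers and the guards is on the line, apart from one piece that reaches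
beyond it, then few fillers are at home. -/
theorem numHome_le_of_off [Fintype ι] (S : Side f g lo hi fil gd h)
    (hF : ∀ j, j ∉ Set.range fil → j ∉ Set.range gd → (f : ℝ) + 1 / 8 < hi j) :
    numHome f lo fil ≤ g := by
  classical
  refine S.numHome_le (Finset.univ.filter fun j => lo j < (f : ℝ) + 1 / 8 ∧
    j ∉ Set.range fil ∧ j ∉ Set.range gd) (fun j h1 h2 h3 =>
      Finset.mem_filter.2 ⟨Finset.mem_univ _, h1, h2, h3⟩) ?_
  have h1 := S.card_crossing_le_one (b := (f : ℝ) + 1 / 8) (Finset.univ.filter fun j =>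
    lo j < (f : ℝ) + 1 / 8 ∧ j ∉ Set.range fil ∧ j ∉ Set.range gd) (fun j hj => by
      have hj := (Finset.mem_filter.1 hj).2
      exact ⟨hj.1, hF j hj.2.1 hj.2.2⟩)
  have h2 : numGuard f lo gd ≤ g := by
    unfold numGuard
    exact (Finset.card_le_univ _).trans (by simp)
  omega

/-- If all fillers are on the line, there is no space for a guard. -/
theorem room_le_of_numHome_eq_zero [Fintype ι] (S : Side f g lo hi fil gd h) (hm : numHome f lo fil = 0)
    {j : ι} (hj : j ∉ Set.range fil) :
    min (hi j) ((f : ℝ) + 1 / 8) - min (lo j) (f + 1 / 8) ≤ 1 / 8 := by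
  classical
  have hg := S.two_mul_lt
  have hon : ∀ i, lo (fil i) < f + 1 / 8 := by
    intro i
    by_contra hcon
    have : i ∈ Finset.univ.filter fun i : Fin f => (f : ℝ) + 1 / 8 ≤ lo (fil i) :=
      Finset.mem_filter.2 ⟨Finset.mem_univ _, not_lt.1 hcon⟩
    exact (Finset.card_ne_zero.2 ⟨i, this⟩) hm
  have hsum := S.sum_room
  have hsub : insert j (Finset.univ.image fil) ⊆ Finset.univ := Finset.subset_univ _
  have h1 := Finset.sum_le_sum_of_subset_of_nonneg hsub
    (f := fun j => min (hi j) ((f : ℝ) + 1 / 8) - min (lo j) (f + 1 / 8))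
    fun j _ _ => S.room_nonneg j _
  rw [hsum, Finset.sum_insert (by simpa using hj),
    Finset.sum_image (fun a _ b _ hab => S.fil_inj hab)] at h1
  have h2 : ∑ _i : Fin f, (1 : ℝ) ≤
      ∑ i : Fin f, (min (hi (fil i)) ((f : ℝ) + 1 / 8) - min (lo (fil i)) (f + 1 / 8)) :=
    Finset.sum_le_sum fun i _ => S.one_le_room (by omega) i (hon i)
  rw [Finset.sum_const, Finset.card_univ, Fintype.card_fin, nsmul_eq_mul, mul_one] at h2
  linarith

/-- By induction along the line: a piece starting at `t` has length at most `1`, while a filler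
needs length `1` and a guard needs all of cell `t`. So it ends exactly at `t + 1`. -/
theorem exists_start_eq_natCast [Fintype ι] (S : Side f g lo hi fil gd h)
    (hF : ∀ j, j ∉ Set.range fil → j ∉ Set.range gd → (f : ℝ) + 1 / 8 < hi j)
    (hm : numHome f lo fil ≠ 0) : ∀ t : ℕ, t ≤ f → ∃ j, lo j = t := by
  have hg := S.two_mul_lt
  have hh := S.le_h
  have hmg := S.numHome_le_of_off hF
  intro t
  induction t with
  | zero => intro _; simpa using S.exists_start_eq_zero
  | succ t ih =>
    intro ht
    obtain ⟨j, hj⟩ := ih (by omega)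
    have htf : (t : ℝ) + 1 ≤ f := by exact_mod_cast ht
    have h1 := S.room_le_one hm j
    have hlt := S.lt j
    rw [min_eq_left (a := lo j) (by linarith), hj] at h1
    have h2 : hi j ≤ t + 1 := by
      rcases min_choice (hi j) ((f : ℝ) + 1 / 8) with h3 | h3 <;> rw [h3] at h1 <;> linarith
    have h3 : hi j = t + 1 := by
      refine le_antisymm h2 ?_
      by_cases h4 : j ∈ Set.range fil
      · obtain ⟨i, rfl⟩ := h4
        have h5 := S.one_le_room (by omega) i (by linarith)
        rw [min_eq_left (a := lo (fil i)) (by linarith), hj] at h5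
        linarith [min_le_left (hi (fil i)) ((f : ℝ) + 1 / 8)]
      by_cases h5 : j ∈ Set.range gd
      · obtain ⟨i, rfl⟩ := h5
        have h6 := S.le_guard_value hmg i (by linarith)
        rw [hj, guardLine_natCast (g + 1) (by omega),
          ramp_of_le (y := (t : ℝ)) (by linarith) (by linarith),
          ramp_of_le (by linarith) (by linarith)] at h6
        by_contra h7
        have h8 := guardLine_lt (Nat.succ_pos g) (show t < f by omega) (not_le.1 h7)
        push_cast at h6 h8
        nlinarith
      · linarith [hF j h4 h5]
    obtain ⟨j', hj'⟩ := S.exists_start_eq_hi (j := j) (by linarith)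
    exact ⟨j', by rw [hj', h3]; push_cast; rfl⟩

/-- If nobody but the fillers and the guards is on the line, apart from one piece that reaches
beyond it, then the guards on the line get a cell each. -/
theorem guard_of_off [Fintype ι] (S : Side f g lo hi fil gd h)
    (hF : ∀ j, j ∉ Set.range fil → j ∉ Set.range gd → (f : ℝ) + 1 / 8 < hi j) (i : Fin g)
    (hi1 : hi (gd i) ≤ h) :
    hi (gd i) ≤ f ∧ (guardLine f (g + 1) (hi (gd i)) - guardLine f (g + 1) (lo (gd i))) +
        5 * ((g : ℝ) + 1) ^ 2 *
          (ramp (f + 1) (f + 2) (hi (gd i)) - ramp (f + 1) (f + 2) (lo (gd i))) ≤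
      8 * ((g : ℝ) + 1) ^ 2 := by
  have hmg := S.numHome_le_of_off hF
  have hval := S.le_guard_value hmg i hi1
  have hlt := S.lt (gd i)
  have hpos : (0 : ℝ) < ((g : ℝ) + 1) ^ 2 := by positivity
  have hr1 := ramp_le_one ((f : ℝ) + 1) (f + 2) (hi (gd i))
  have hr2 := ramp_nonneg ((f : ℝ) + 1) (f + 2) (lo (gd i))
  by_cases hm : numHome f lo fil = 0
  · exfalso
    have h1 := S.room_le_of_numHome_eq_zero hm (j := gd i) (by rintro ⟨i', h⟩; exact S.fil_ne_gd _ _ h)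
    have hG : ∀ y, guardLine f (g + 1) (min y (f + 1 / 8)) = guardLine f (g + 1) y := by
      intro y
      rcases le_total y ((f : ℝ) + 1 / 8) with h2 | h2
      · rw [min_eq_left h2]
      · rw [min_eq_right h2, guardLine_of_ge (by linarith), guardLine_of_ge (by linarith)]
    -- A room of `1 / 8` at density at most `16 * N ^ 2`, together with the spot, gives at most `2 *
    -- N ^ 2 + 5 * N ^ 2`, less than the required `8 * N ^ 2`.
    have h2 := guardLine_sub_le (f := f) (N := g + 1)
      (le_min (S.nonneg (gd i)) (by positivity : (0 : ℝ) ≤ f + 1 / 8))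
      (min_le_min_right ((f : ℝ) + 1 / 8) hlt.le)
    rw [hG, hG] at h2
    push_cast at h2
    nlinarith
  · have hst := S.exists_start_eq_natCast hF hm
    rcases lt_or_ge (lo (gd i)) f with h1 | h1
    · have h0 := S.nonneg (gd i)
      have h2 := Nat.floor_le h0
      have h3 := Nat.lt_floor_add_one (lo (gd i))
      set t := ⌊lo (gd i)⌋₊
      have ht : t < f := by
        have : (t : ℝ) < f := by linarith
        exact_mod_cast this
      have htf : (t : ℝ) + 1 ≤ f := by exact_mod_cast ht
      obtain ⟨j, hj⟩ := hst (t + 1) ht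
      push_cast at hj
      -- The piece starting at `t + 1` stops the guard, who is thus confined to cell `t`.
      have hne : j ≠ gd i := by rintro rfl; linarith
      have h4 : hi (gd i) ≤ t + 1 := by
        rcases S.disj j (gd i) hne with h5 | h5 <;> linarith [S.lt j]
      refine ⟨by linarith, ?_⟩
      have h5 := guardLine_mono f (g + 1) h4
      have h6 := guardLine_mono f (g + 1) h2
      have h7 := guardLine_natCast (f := f) (g + 1) (t := t + 1) ht
      have h8 := guardLine_natCast (f := f) (g + 1) (t := t) ht.le
      push_cast at h7 h8
      rw [ramp_of_le (y := hi (gd i)) (by linarith) (by linarith),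
        ramp_of_le (y := lo (gd i)) (by linarith) (by linarith)]
      linarith
    -- Beyond the cells only the spot is left, and `5 * N ^ 2 < 8 * N ^ 2`.
    · exfalso
      rw [guardLine_of_ge (by linarith), guardLine_of_ge h1] at hval
      nlinarith

/-- A piece which starts in the first half of cell `t`, neither too early nor too late, belongs to
a guard, and the next one does so with respect to cell `t + 1`. -/
theorem guard_of_start [Fintype ι] (S : Side f g lo hi fil gd h) (hmg : numHome f lo fil ≤ g)
    {p : ι} (hp0 : lo p = 0)
    (hF : ∀ j, j ∉ Set.range fil → j ∉ Set.range gd → j ≠ p → (f : ℝ) + 1 / 8 < hi j)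
    (hv : ∀ j, (guardLine f (g + 1) (hi j) - guardLine f (g + 1) (lo j)) +
        5 * ((g : ℝ) + 1) ^ 2 * (ramp (f + 1) (f + 2) (hi j) - ramp (f + 1) (f + 2) (lo j)) ≤
      8 * ((g : ℝ) + 1) ^ 2 + 1) {t : ℕ} (ht : t < g) {s : ℝ} (hs0 : 0 < s) (hs1 : s ≤ 1 / 2)
    (hK1 : 3 / 2 * ((g : ℝ) + 1) < 2 * headMass (g + 1) t * s)
    (hK2 : 2 * headMass (g + 1) t * s ≤ 4 * ((g : ℝ) + 1) + t) {j : ι} (hj : lo j = t + s) :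
    j ∈ Set.range gd ∧ ∃ s', 0 < s' ∧ s' ≤ 1 / 2 ∧ hi j = t + 1 + s' ∧
      3 / 2 * ((g : ℝ) + 1) < 2 * headMass (g + 1) (t + 1) * s' ∧
      2 * headMass (g + 1) (t + 1) * s' ≤ 4 * ((g : ℝ) + 1) + (t + 1) := by
  have hg := S.two_mul_lt
  have hh := S.le_h
  have hgf : 2 * (g : ℝ) + 2 ≤ f := by exact_mod_cast hg
  have hN : ((g + 1 : ℕ) : ℝ) = g + 1 := by push_cast; rfl
  have hM : ∀ t : ℕ, t ≤ g → headMass (g + 1) t = 4 * ((g : ℝ) + 1) * (t + 1) := by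
    intro t ht
    rw [headMass_of_lt (by omega), hN]
  have htg : (t : ℝ) + 1 ≤ g := by exact_mod_cast ht
  have ht0 : (0 : ℝ) ≤ t := Nat.cast_nonneg t
  have hM' := hM (t + 1) ht
  push_cast at hM'
  have hGlo := guardLine_head (f := f) (t := t) (g + 1) (by omega) hs0.le hs1
  rw [← hj, hN] at hGlo
  have hvj := hv j
  have hr := ramp_mono (a := (f : ℝ) + 1) (b := f + 2) (by linarith) (S.lt j).le
  have hr' : 0 ≤ 5 * ((g : ℝ) + 1) ^ 2 *
    (ramp (f + 1) (f + 2) (hi j) - ramp (f + 1) (f + 2) (lo j)) :=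
    mul_nonneg (by positivity) (by linarith)
  -- Let `K = 2 * headMass (g + 1) t * s` be the value of cell `t` before the piece. Reaching `t +
  -- 3/2` would give `8 * N ^ 2 - K` plus the next head, exceeding `8 * N ^ 2 + 1` since `K ≤ 4 * N
  -- + t`.
  have hhi : hi j ≤ t + 3 / 2 := by
    by_contra hcon
    have h1 := guardLine_mono f (g + 1) (not_le.1 hcon).le
    have h2 := guardLine_head (f := f) (t := t + 1) (g + 1) (s := 1 / 2) (by omega)
      (by norm_num) le_rfl
    push_cast at h2
    rw [show (t : ℝ) + 1 + 1 / 2 = t + 3 / 2 by ring, hM'] at h2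
    nlinarith
  -- A filler's unit length would give at least `8 * N ^ 2 + 8 * N * s`, hence `8 * N * s ≤ 1`. Then
  -- `K = 8 * N * (t + 1) * s ≤ t + 1 < N`, against `K > 3/2 * N`.
  have hjf : j ∉ Set.range fil := by
    rintro ⟨i, rfl⟩
    have h1 := S.one_le_room (by omega) i (by linarith)
    rw [min_eq_left (a := hi _) (by linarith), min_eq_left (by linarith)] at h1
    have h2 := guardLine_mono f (g + 1) (show ((t + 1 : ℕ) : ℝ) + s ≤ hi (fil i) by
      push_cast; linarith)
    have h3 := guardLine_head (f := f) (t := t + 1) (g + 1) (by omega) hs0.le hs1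
    rw [h3, hN] at h2
    push_cast at h2
    rw [hM t ht.le] at hK1 hGlo
    rw [hM'] at h2
    have h4 : 8 * ((g : ℝ) + 1) * s ≤ 1 := by nlinarith
    nlinarith
  have hjp : j ≠ p := by rintro rfl; linarith
  have hjg : j ∈ Set.range gd := by
    by_contra h1
    linarith [hF j hjf h1 hjp]
  refine ⟨hjg, hi j - (t + 1), ?_⟩
  obtain ⟨i, rfl⟩ := hjg
  have hval := S.le_guard_value hmg i (by linarith)
  rw [ramp_of_le (y := hi (gd i)) (by linarith) (by linarith),
      ramp_of_le (y := lo (gd i)) (by linarith) (by linarith)] at hval hvj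
  have h1 : t + 1 < hi (gd i) := by
    by_contra hcon
    have h2 := guardLine_mono f (g + 1) (not_lt.1 hcon)
    have h3 := guardLine_natCast (f := f) (g + 1) (t := t + 1) (by omega)
    push_cast at h3
    nlinarith
  have h3 := guardLine_head (f := f) (t := t + 1) (g + 1) (s := hi (gd i) - (t + 1)) (by omega)
    (by linarith) (by linarith)
  push_cast at h3
  rw [show (t : ℝ) + 1 + (hi (gd i) - (t + 1)) = hi (gd i) by ring] at h3
  -- The piece is worth between `8 * N ^ 2` and `8 * N ^ 2 + 1`, so `K` does not decrease and grows
  -- by at most `1` from cell to cell.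
  exact ⟨by linarith, by linarith, by ring, by linarith, by linarith⟩

/-- If a further agent `p` takes between `3/16` and `1/2` of the line at the cake end, and guards
cannot have much more than a cell, then all guards are on the line. -/
theorem guard_of_on [Fintype ι] (S : Side f g lo hi fil gd h) {p : ι} (hp0 : lo p = 0)
    (hp1 : 3 / 16 < hi p) (hp2 : hi p < 1 / 2) (hpf : p ∉ Set.range fil)
    (hF : ∀ j, j ∉ Set.range fil → j ∉ Set.range gd → j ≠ p → (f : ℝ) + 1 / 8 < hi j)
    (i₀ : Fin g)
    (hv : ∀ j, (guardLine f (g + 1) (hi j) - guardLine f (g + 1) (lo j)) +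
        5 * ((g : ℝ) + 1) ^ 2 * (ramp (f + 1) (f + 2) (hi j) - ramp (f + 1) (f + 2) (lo j)) ≤
      8 * ((g : ℝ) + 1) ^ 2 + 1) : lo (gd i₀) < f + 1 / 8 := by
  classical
  by_contra hi₀
  have hg := S.two_mul_lt
  have hh := S.le_h
  have hgf : 2 * (g : ℝ) + 2 ≤ f := by exact_mod_cast hg
  have hg0 : (0 : ℝ) ≤ g := Nat.cast_nonneg g
  -- With guard `i₀` off the line, at most `g - 1` guards, `p`, and one crossing piece are there
  -- besides fillers.
  have hmg : numHome f lo fil ≤ g := by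
    refine S.numHome_le (insert p (Finset.univ.filter fun j => lo j < (f : ℝ) + 1 / 8 ∧
      j ∉ Set.range fil ∧ j ∉ Set.range gd ∧ j ≠ p)) (fun j h1 h2 h3 => ?_) ?_
    · by_cases h4 : j = p
      · exact h4 ▸ Finset.mem_insert_self _ _
      · exact Finset.mem_insert_of_mem (Finset.mem_filter.2 ⟨Finset.mem_univ _, h1, h2, h3, h4⟩)
    · have h1 := S.card_crossing_le_one (b := (f : ℝ) + 1 / 8) (Finset.univ.filter fun j =>
        lo j < (f : ℝ) + 1 / 8 ∧ j ∉ Set.range fil ∧ j ∉ Set.range gd ∧ j ≠ p) (fun j hj => by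
          have hj := (Finset.mem_filter.1 hj).2
          exact ⟨hj.1, hF j hj.2.1 hj.2.2.1 hj.2.2.2⟩)
      have h2 : numGuard f lo gd < g := by
        unfold numGuard
        calc _ < (Finset.univ : Finset (Fin g)).card := Finset.card_lt_card
              ⟨Finset.subset_univ _, fun h => hi₀ (Finset.mem_filter.1 (h (Finset.mem_univ i₀))).2⟩
          _ = g := by simp
      have h3 := Finset.card_insert_le p (Finset.univ.filter fun j => lo j < (f : ℝ) + 1 / 8 ∧
        j ∉ Set.range fil ∧ j ∉ Set.range gd ∧ j ≠ p)
      omega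
  -- If every filler were on the line, `p` would have room at most `1 / 8`, less than `3 / 16`.
  have hm : numHome f lo fil ≠ 0 := by
    intro hm
    have h1 := S.room_le_of_numHome_eq_zero hm hpf
    rw [hp0, min_eq_left (by linarith), min_eq_left (by linarith)] at h1
    linarith
  have hN : ((g + 1 : ℕ) : ℝ) = g + 1 := by push_cast; rfl
  have hM : ∀ t : ℕ, t ≤ g → headMass (g + 1) t = 4 * ((g : ℝ) + 1) * (t + 1) := by
    intro t ht
    rw [headMass_of_lt (by omega), hN]
  have step := fun t ht s hs0 hs1 hK1 hK2 j hj =>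
    S.guard_of_start hmg hp0 hF hv (t := t) (s := s) ht hs0 hs1 hK1 hK2 (j := j) hj
  have main : ∀ t : ℕ, t ≤ g → ∃ s, 0 < s ∧ s ≤ 1 / 2 ∧
      3 / 2 * ((g : ℝ) + 1) < 2 * headMass (g + 1) t * s ∧
      2 * headMass (g + 1) t * s ≤ 4 * ((g : ℝ) + 1) + t ∧ ∃ j, lo j = t + s := by
    intro t
    induction t with
    | zero =>
      intro _
      -- In cell `0` the value taken by `p` is `8 * N * hi p`, and `3/16 < hi p < 1/2` places it
      -- between `3/2 * N` and `4 * N`.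
      refine ⟨hi p, by linarith, hp2.le, ?_, ?_, ?_⟩
      · rw [hM 0 (Nat.zero_le _)]; push_cast; nlinarith
      · rw [hM 0 (Nat.zero_le _)]; push_cast; nlinarith
      · simpa using S.exists_start_eq_hi (j := p) (by linarith)
    | succ t ih =>
      intro ht
      obtain ⟨s, h1, h2, h3, h4, j, hj⟩ := ih (by omega)
      obtain ⟨-, s', h5, h6, h7, h8, h9⟩ := step t ht s h1 h2 h3 h4 j hj
      have htg : (t : ℝ) + 1 ≤ g := by exact_mod_cast ht
      obtain ⟨j', hj'⟩ := S.exists_start_eq_hi (j := j) (by linarith)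
      exact ⟨s', h5, h6, h8, by push_cast; exact h9, j', by rw [hj', h7]; push_cast; ring⟩
  -- A guard starts in each of the first `g` cells. These are `g` different guards, so `i₀` is among
  -- them.
  have hex : ∀ t : Fin g, ∃ i, (t : ℝ) < lo (gd i) ∧ lo (gd i) ≤ t + 1 / 2 := by
    intro t
    obtain ⟨s, h1, h2, h3, h4, j, hj⟩ := main t t.2.le
    obtain ⟨⟨i, rfl⟩, -⟩ := step t t.2 s h1 h2 h3 h4 j hj
    exact ⟨i, by linarith, by linarith⟩
  choose φ hφ using hex
  have hinj : Function.Injective φ := by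
    intro a b hab
    have h1 := hφ a
    have h2 := hφ b
    rw [hab] at h1
    have h3 : ((a : ℕ) : ℝ) < (b : ℕ) + 1 := by linarith
    have h4 : ((b : ℕ) : ℝ) < (a : ℕ) + 1 := by linarith
    have h5 : (a : ℕ) < b + 1 := by exact_mod_cast h3
    have h6 : (b : ℕ) < a + 1 := by exact_mod_cast h4
    exact Fin.ext (by omega)
  obtain ⟨t, rfl⟩ := Finite.surjective_of_injective hinj i₀
  have h1 := (hφ t).2
  have h2 : ((t : ℕ) : ℝ) + 1 ≤ g := by exact_mod_cast t.2
  exact hi₀ (by linarith)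

end Side

/-! ### The two-sided construction and its cumulative valuations. -/

/-- The agents: on each side of the cake a liar, `g` guards, and the fillers. -/
inductive Agent (f : Bool → ℕ) (g : ℕ) : Type
  | liar (s : Bool) : Agent f g
  | guard (s : Bool) (i : Fin g) : Agent f g
  | filler (s : Bool) (i : Fin (f s)) : Agent f g

namespace Agent

variable {f : Bool → ℕ} {g : ℕ}

/-- Agents as a sum type. -/
def equivSum (f : Bool → ℕ) (g : ℕ) :
    Agent f g ≃ Bool ⊕ (Bool × Fin g) ⊕ (Σ s : Bool, Fin (f s)) where
  toFun
    | liar s => Sum.inl s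
    | guard s i => Sum.inr (Sum.inl (s, i))
    | filler s i => Sum.inr (Sum.inr ⟨s, i⟩)
  invFun
    | Sum.inl s => liar s
    | Sum.inr (Sum.inl (s, i)) => guard s i
    | Sum.inr (Sum.inr ⟨s, i⟩) => filler s i
  left_inv a := by cases a <;> rfl
  right_inv a := by rcases a with s | ⟨s, i⟩ | ⟨s, i⟩ <;> rfl

instance : Fintype (Agent f g) := Fintype.ofEquiv _ (equivSum f g).symm

instance : DecidableEq (Agent f g) := (equivSum f g).injective.decidableEq

theorem card_eq (f : Bool → ℕ) (g : ℕ) :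
    Fintype.card (Agent f g) = 2 + 2 * g + f false + f true := by
  rw [Fintype.card_congr (equivSum f g)]
  simp
  ring

end Agent

/-- The place where the homes of the fillers start on a side with a line of length `f`. -/
noncomputable def homeStart (f g : ℕ) : ℝ := f + 6 + 2 * g

/-- Cumulative value of a truthful liar on his side: a tip near the cake end and `g + 1` units. -/
noncomputable def liarCum (f g : ℕ) (y : ℝ) : ℝ :=
  21 / 20 * ramp (3 / 16) (1 / 4) y +
    ∑ j ∈ Finset.range (g + 1), ramp (f + 4 + 2 * j) (f + 4 + 2 * j + 1) y

/-- Cumulative value on his side which a lying agent reports. -/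
noncomputable def lieCum (f g : ℕ) (y : ℝ) : ℝ :=
  ramp (f + 3) (f + 4) y + 51 / 50 * ramp (f + 5 + 2 * g) (f + 6 + 2 * g) y

/-- Cumulative value on the other side which a lying agent reports. -/
noncomputable def lieAwayCum (y : ℝ) : ℝ :=
  9 / 10 * ramp (3 / 16) (1 / 4) y + 3 / 20 * ramp (1 / 4) (1 / 2) y

/-- Cumulative value of a guard on his side. -/
noncomputable def guardCum (f g : ℕ) (y : ℝ) : ℝ :=
  guardLine f (g + 1) y + 5 * ((g : ℝ) + 1) ^ 2 * ramp (f + 1) (f + 2) y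

/-- Cumulative value of a guard on the other side: a wall between two units of the liar there. -/
noncomputable def wallCum (f g i : ℕ) (y : ℝ) : ℝ :=
  (8 * ((g : ℝ) + 1) ^ 2 + 1) * ramp (f + 4 + 2 * i + 1) (f + 4 + 2 * i + 2) y

/-- Cumulative value of a filler. -/
noncomputable def fillerCum (f g i : ℕ) (y : ℝ) : ℝ :=
  ((f : ℝ) + 1 / 8) * ramp 0 (f + 1 / 8) y + ramp (homeStart f g + i) (homeStart f g + i + 1) y

/-- Cumulative values on side `t` of the cake, measured from the cake end, when the liar of side `s`
lies if `o = some s`. -/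
noncomputable def cum (f : Bool → ℕ) (g : ℕ) (o : Option Bool) (t : Bool) : Agent f g → ℝ → ℝ
  | .liar s => if t = s then (if o = some s then lieCum (f s) g else liarCum (f s) g)
      else (if o = some s then lieAwayCum else 0)
  | .guard s i => if t = s then guardCum (f s) g else wallCum (f t) g i
  | .filler s i => if t = s then fillerCum (f s) g i else 0

/-- A tiling of the cake, of length `2 * D`, by one interval for each agent, described from both
cake ends, which is envy-free for the cumulative values `Ψ`. -/
structure Division {ι : Type*} (Ψ : Bool → ι → ℝ → ℝ) (D : ℝ) where
  lo : Bool → ι → ℝ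
  hi : Bool → ι → ℝ
  lo_not : ∀ s j, lo (!s) j = 2 * D - hi s j
  lt : ∀ s j, lo s j < hi s j
  nonneg : ∀ s j, 0 ≤ lo s j
  disj : ∀ s i j, i ≠ j → hi s i ≤ lo s j ∨ hi s j ≤ lo s i
  cover : ∀ s y, 0 ≤ y → y < 2 * D → ∃ j, lo s j ≤ y ∧ y < hi s j
  envyFree : ∀ i j, ∑ t, (Ψ t i (hi t j) - Ψ t i (lo t j)) ≤ ∑ t, (Ψ t i (hi t i) - Ψ t i (lo t i))

namespace Division

variable {ι : Type*} {Ψ : Bool → ι → ℝ → ℝ} {D : ℝ}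

/-- The value on side `t` which the piece of agent `j` has for agent `i`. -/
def part (E : Division Ψ D) (t : Bool) (i j : ι) : ℝ := Ψ t i (E.hi t j) - Ψ t i (E.lo t j)

theorem part_add_part_le (E : Division Ψ D) (s : Bool) (i j : ι) :
    E.part s i j + E.part (!s) i j ≤ E.part s i i + E.part (!s) i i := by
  have h := E.envyFree i j
  simp only [Fintype.sum_bool] at h
  unfold part
  cases s <;> simp only [Bool.not_true, Bool.not_false] <;> linarith

theorem hi_eq (E : Division Ψ D) (s : Bool) (j : ι) : E.hi s j = 2 * D - E.lo (!s) j := by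
  rw [E.lo_not]; ring

end Division

theorem cum_liar (f : Bool → ℕ) (g : ℕ) {o : Option Bool} {s : Bool} (h : o ≠ some s) :
    cum f g o s (.liar s) = liarCum (f s) g := by simp [cum, h]

theorem cum_liar_away (f : Bool → ℕ) (g : ℕ) {o : Option Bool} {s : Bool} (h : o ≠ some s) :
    cum f g o (!s) (.liar s) = 0 := by simp [cum, h]

theorem cum_lie (f : Bool → ℕ) (g : ℕ) (s : Bool) :
    cum f g (some s) s (.liar s) = lieCum (f s) g := by simp [cum]

theorem cum_lie_away (f : Bool → ℕ) (g : ℕ) (s : Bool) :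
    cum f g (some s) (!s) (.liar s) = lieAwayCum := by simp [cum]

theorem cum_guard (f : Bool → ℕ) (g : ℕ) (o : Option Bool) (s : Bool) (i : Fin g) :
    cum f g o s (.guard s i) = guardCum (f s) g := by simp [cum]

theorem cum_guard_away (f : Bool → ℕ) (g : ℕ) (o : Option Bool) (s : Bool) (i : Fin g) :
    cum f g o (!s) (.guard s i) = wallCum (f !s) g i := by simp [cum]

theorem cum_filler (f : Bool → ℕ) (g : ℕ) (o : Option Bool) (s : Bool) (i : Fin (f s)) :
    cum f g o s (.filler s i) = fillerCum (f s) g i := by simp [cum]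

theorem cum_filler_away (f : Bool → ℕ) (g : ℕ) (o : Option Bool) (s : Bool) (i : Fin (f s)) :
    cum f g o (!s) (.filler s i) = 0 := by simp [cum]

theorem liarCum_mono (f g : ℕ) : Monotone (liarCum f g) := by
  intro x y hxy
  have h1 := ramp_mono (a := (3 : ℝ) / 16) (b := 1 / 4) (by norm_num) hxy
  have h2 : ∑ j ∈ Finset.range (g + 1), ramp ((f : ℝ) + 4 + 2 * j) (f + 4 + 2 * j + 1) x ≤
      ∑ j ∈ Finset.range (g + 1), ramp ((f : ℝ) + 4 + 2 * j) (f + 4 + 2 * j + 1) y :=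
    Finset.sum_le_sum fun j _ => ramp_mono (by linarith) hxy
  unfold liarCum
  linarith

theorem lieCum_mono (f g : ℕ) : Monotone (lieCum f g) := by
  intro x y hxy
  have h1 := ramp_mono (a := (f : ℝ) + 3) (b := f + 4) (by linarith) hxy
  have h2 := ramp_mono (a := (f : ℝ) + 5 + 2 * g) (b := f + 6 + 2 * g) (by linarith) hxy
  unfold lieCum
  linarith

theorem lieAwayCum_mono : Monotone lieAwayCum := by
  intro x y hxy
  have h1 := ramp_mono (a := (3 : ℝ) / 16) (b := 1 / 4) (by norm_num) hxy
  have h2 := ramp_mono (a := (1 : ℝ) / 4) (b := 1 / 2) (by norm_num) hxy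
  unfold lieAwayCum
  linarith

theorem guardCum_mono (f g : ℕ) : Monotone (guardCum f g) := by
  intro x y hxy
  have h1 := guardLine_mono f (g + 1) hxy
  have h2 := ramp_mono (a := (f : ℝ) + 1) (b := f + 2) (by linarith) hxy
  have h3 := mul_le_mul_of_nonneg_left h2 (by positivity : 0 ≤ 5 * ((g : ℝ) + 1) ^ 2)
  unfold guardCum
  linarith

theorem wallCum_mono (f g i : ℕ) : Monotone (wallCum f g i) := by
  intro x y hxy
  exact mul_le_mul_of_nonneg_left (ramp_mono (by linarith) hxy) (by positivity)

theorem fillerCum_mono (f g i : ℕ) : Monotone (fillerCum f g i) := by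
  intro x y hxy
  have h1 := ramp_mono (a := 0) (b := (f : ℝ) + 1 / 8) (by positivity) hxy
  have h2 := ramp_mono (a := homeStart f g + i) (b := homeStart f g + i + 1) (by linarith) hxy
  have h3 := mul_le_mul_of_nonneg_left h1 (by positivity : 0 ≤ (f : ℝ) + 1 / 8)
  unfold fillerCum
  linarith

theorem fillerCum_eq (f g i : ℕ) {y : ℝ} (hy : 0 ≤ y) : fillerCum f g i y =
    min y (f + 1 / 8) + ramp (homeStart f g + i) (homeStart f g + i + 1) y := by
  have hf : (0 : ℝ) < f + 1 / 8 := by positivity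
  unfold fillerCum
  congr 1
  rcases le_total y (f + 1 / 8) with h | h
  · rw [ramp_of_mem hf hy h, min_eq_left h, sub_zero, sub_zero, mul_div_cancel₀ _ hf.ne']
  · rw [ramp_of_ge hf h, min_eq_right h, mul_one]

theorem cum_mono (f : Bool → ℕ) (g : ℕ) (o : Option Bool) (t : Bool) (a : Agent f g) :
    Monotone (cum f g o t a) := by
  cases a <;> simp only [cum] <;> split_ifs
  · exact lieCum_mono _ _
  · exact liarCum_mono _ _
  · exact lieAwayCum_mono
  · exact monotone_const
  · exact guardCum_mono _ _
  · exact wallCum_mono _ _ _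
  · exact fillerCum_mono _ _ _
  · exact monotone_const

theorem liarCum_of_le {f g : ℕ} {y : ℝ} (hy : y ≤ f + 4) :
    liarCum f g y = 21 / 20 * ramp (3 / 16) (1 / 4) y := by
  unfold liarCum
  refine add_eq_left.2 (Finset.sum_eq_zero fun j _ => ?_)
  have : (0 : ℝ) ≤ j := Nat.cast_nonneg j
  exact ramp_of_le (by linarith) (by linarith)

theorem liarCum_of_ge {f g : ℕ} {y : ℝ} (hy : (f : ℝ) + 5 + 2 * g ≤ y) :
    liarCum f g y = 21 / 20 + (g + 1) := by
  have hf : (0 : ℝ) ≤ f := Nat.cast_nonneg f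
  have hg : (0 : ℝ) ≤ g := Nat.cast_nonneg g
  unfold liarCum
  rw [ramp_of_ge (by norm_num) (by linarith)]
  have : ∀ j ∈ Finset.range (g + 1), ramp ((f : ℝ) + 4 + 2 * j) (f + 4 + 2 * j + 1) y = 1 := by
    intro j hj
    have : (j : ℝ) ≤ g := by exact_mod_cast Nat.lt_succ_iff.1 (Finset.mem_range.1 hj)
    exact ramp_of_ge (by linarith) (by linarith)
  rw [Finset.sum_congr rfl this]
  simp

/-- Beyond the middle of the cake the cumulative values are constant. -/
theorem cum_of_ge {f : Bool → ℕ} {g : ℕ} {t : Bool} {D : ℝ} (hD : homeStart (f t) g + f t ≤ D)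
    (o : Option Bool) (a : Agent f g) {y : ℝ} (hy : D ≤ y) : cum f g o t a y = cum f g o t a D := by
  have key : ∀ x y : ℝ, homeStart (f t) g + f t ≤ x → homeStart (f t) g + f t ≤ y →
      cum f g o t a y = cum f g o t a x := by
    intro x y hx hy
    unfold homeStart at hx hy
    have hf : (0 : ℝ) ≤ f t := Nat.cast_nonneg _
    have hg : (0 : ℝ) ≤ g := Nat.cast_nonneg g
    cases a with
    | liar s =>
      simp only [cum]
      split_ifs with h1 h2 h2
      · subst h1
        unfold lieCum
        rw [ramp_of_ge (y := x) (by linarith) (by linarith),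
          ramp_of_ge (y := x) (by linarith) (by linarith),
          ramp_of_ge (y := y) (by linarith) (by linarith),
          ramp_of_ge (y := y) (by linarith) (by linarith)]
      · subst h1
        rw [liarCum_of_ge (by linarith), liarCum_of_ge (by linarith)]
      · unfold lieAwayCum
        rw [ramp_of_ge (y := x) (by linarith) (by linarith),
          ramp_of_ge (y := x) (by linarith) (by linarith),
          ramp_of_ge (y := y) (by linarith) (by linarith),
          ramp_of_ge (y := y) (by linarith) (by linarith)]
      · rfl
    | guard s i =>
      have hi : ((i : ℕ) : ℝ) + 1 ≤ g := by exact_mod_cast i.2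
      simp only [cum]
      split_ifs with h1
      · subst h1
        unfold guardCum
        rw [ramp_of_ge (y := x) (by linarith) (by linarith),
          ramp_of_ge (y := y) (by linarith) (by linarith), guardLine_of_ge (by linarith),
          guardLine_of_ge (by linarith)]
      · unfold wallCum
        rw [ramp_of_ge (y := x) (by linarith) (by linarith),
          ramp_of_ge (y := y) (by linarith) (by linarith)]
    | filler s i =>
      simp only [cum]
      split_ifs with h1
      · subst h1
        have hi : ((i : ℕ) : ℝ) + 1 ≤ f t := by exact_mod_cast i.2
        unfold fillerCum homeStart
        rw [ramp_of_ge (y := x) (by linarith) (by linarith),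
          ramp_of_ge (y := y) (by linarith) (by linarith),
          ramp_of_ge (y := x) (by linarith) (by linarith),
          ramp_of_ge (y := y) (by linarith) (by linarith)]
      · rfl
  exact key D y hD (hD.trans hy)

/-- An interval meeting two units contains the wall just after the earlier one; without a full wall
only one summand is positive. -/
theorem sum_unit_le_one {a b c : ℝ} (g : ℕ)
    (h : ∀ i < g, ¬ (a ≤ c + 2 * i + 1 ∧ c + 2 * i + 2 ≤ b)) :
    ∑ j ∈ Finset.range (g + 1),
      (ramp (c + 2 * j) (c + 2 * j + 1) b - ramp (c + 2 * j) (c + 2 * j + 1) a) ≤ 1 := by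
  have hle : ∀ j : ℕ, ramp (c + 2 * j) (c + 2 * j + 1) b - ramp (c + 2 * j) (c + 2 * j + 1) a ≤ 1 :=
    fun j => by
      linarith [ramp_le_one (c + 2 * j) (c + 2 * j + 1) b, ramp_nonneg (c + 2 * j) (c + 2 * j + 1) a]
  have hpos : ∀ j : ℕ,
      0 < ramp (c + 2 * j) (c + 2 * j + 1) b - ramp (c + 2 * j) (c + 2 * j + 1) a →
      c + 2 * j < b ∧ a < c + 2 * j + 1 := by
    intro j hj
    constructor
    · by_contra h1
      rw [ramp_of_le (y := b) (by linarith) (not_lt.1 h1)] at hj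
      linarith [ramp_nonneg (c + 2 * j) (c + 2 * j + 1) a]
    · by_contra h1
      rw [ramp_of_ge (y := a) (by linarith) (not_lt.1 h1)] at hj
      linarith [ramp_le_one (c + 2 * j) (c + 2 * j + 1) b]
  have hcon : ∀ i j : ℕ, i < j → j ≤ g →
      0 < ramp (c + 2 * i) (c + 2 * i + 1) b - ramp (c + 2 * i) (c + 2 * i + 1) a →
      ¬ 0 < ramp (c + 2 * j) (c + 2 * j + 1) b - ramp (c + 2 * j) (c + 2 * j + 1) a := by
    intro i j hij hj h1 h2
    have hij' : (i : ℝ) + 1 ≤ j := by exact_mod_cast hij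
    refine h i (by omega) ⟨(hpos i h1).2.le, ?_⟩
    linarith [(hpos j h2).1]
  by_cases hex : ∃ j ∈ Finset.range (g + 1),
      0 < ramp (c + 2 * j) (c + 2 * j + 1) b - ramp (c + 2 * j) (c + 2 * j + 1) a
  · obtain ⟨j, hj, hjpos⟩ := hex
    rw [← Finset.add_sum_erase _ _ hj]
    refine le_trans (add_le_of_nonpos_right (Finset.sum_nonpos fun i hi => ?_)) (hle j)
    obtain ⟨hne, hi⟩ := Finset.mem_erase.1 hi
    have hj := Finset.mem_range.1 hj
    have hi := Finset.mem_range.1 hi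
    rcases lt_or_gt_of_ne hne with h1 | h1
    · by_contra h2
      exact hcon i j h1 (by omega) (not_le.1 h2) hjpos
    · exact not_lt.1 (hcon j i h1 (by omega) hjpos)
  · push Not at hex
    exact (Finset.sum_nonpos hex).trans zero_le_one

/-- The inequalities between the parameters of the construction. -/
structure GadgetParams (f : Bool → ℕ) (g : ℕ) (D : ℝ) (n : ℕ) : Prop where
  home_le : ∀ s, homeStart (f s) g + f s ≤ D
  two_mul_lt : ∀ s, 2 * g + 2 ≤ f s
  one_le : 1 ≤ g
  -- A filler values the cake at `f + 9/8`, so this makes length `1 / 4` of the line less than his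
  -- proportional share.
  n_lt : ∀ s, (n : ℝ) < 4 * f s + 9 / 2
  -- This makes a liar's proportional share exceed `1 / 17` of his tip.
  n_le : n ≤ 16 * (g + 1)

/-- A division of the cake among the agents of the construction. -/
structure GadgetDivision (f : Bool → ℕ) (g : ℕ) (o : Option Bool) (D : ℝ) (n : ℕ) extends
    Division (cum f g o) D, GadgetParams f g D n where
  total_le : ∀ a, ∑ t, cum f g o t a D ≤ n * ∑ t, toDivision.part t a a

theorem cum_nonneg (f : Bool → ℕ) (g : ℕ) (o : Option Bool) (t : Bool) (a : Agent f g) (y : ℝ) :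
    0 ≤ cum f g o t a y := by
  cases a <;> simp only [cum] <;> split_ifs
  · exact add_nonneg (ramp_nonneg _ _ _) (mul_nonneg (by norm_num) (ramp_nonneg _ _ _))
  · exact add_nonneg (mul_nonneg (by norm_num) (ramp_nonneg _ _ _))
      (Finset.sum_nonneg fun _ _ => ramp_nonneg _ _ _)
  · exact add_nonneg (mul_nonneg (by norm_num) (ramp_nonneg _ _ _))
      (mul_nonneg (by norm_num) (ramp_nonneg _ _ _))
  · exact le_rfl
  · unfold guardCum guardLine cells
    refine add_nonneg ?_ (mul_nonneg (by positivity) (ramp_nonneg _ _ _))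
    refine Finset.sum_nonneg fun j _ => add_nonneg ?_ ?_
    · exact mul_nonneg (headMass_nonneg _ _) (ramp_nonneg _ _ _)
    · exact mul_nonneg (tailMass_nonneg _ _) (ramp_nonneg _ _ _)
  · exact mul_nonneg (by positivity) (ramp_nonneg _ _ _)
  · exact add_nonneg (mul_nonneg (by positivity) (ramp_nonneg _ _ _)) (ramp_nonneg _ _ _)
  · exact le_rfl

theorem cum_le_total (f : Bool → ℕ) (g : ℕ) (o : Option Bool) (s : Bool) (a : Agent f g) (y : ℝ) :
    cum f g o s a y ≤ ∑ t, cum f g o t a y :=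
  Finset.single_le_sum (f := fun t => cum f g o t a y) (fun t _ => cum_nonneg f g o t a y)
    (Finset.mem_univ s)

namespace GadgetParams

variable {f : Bool → ℕ} {g : ℕ} {o : Option Bool} {D : ℝ} {n : ℕ}

theorem layout (E : GadgetParams f g D n) (s : Bool) :
    (1 : ℝ) ≤ g ∧ 2 * (g : ℝ) + 2 ≤ f s ∧ (f s : ℝ) + 6 + 2 * g + f s ≤ D ∧
      homeStart (f s) g = f s + 6 + 2 * g :=
  ⟨by exact_mod_cast E.one_le, by exact_mod_cast E.two_mul_lt s, E.home_le s, rfl⟩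

theorem liar_total (E : GadgetParams f g D n) {s : Bool} (h : o ≠ some s) :
    21 / 20 + ((g : ℝ) + 1) ≤ ∑ t, cum f g o t (.liar s) D := by
  refine le_trans (le_of_eq ?_) (cum_le_total f g o s _ D)
  obtain ⟨h1, h2, h3, h4⟩ := E.layout s
  rw [cum_liar f g h, liarCum_of_ge (by linarith)]

theorem guard_total (E : GadgetParams f g D n) (s : Bool) (i : Fin g) :
    f s * (8 * ((g : ℝ) + 1) ^ 2) ≤ ∑ t, cum f g o t (.guard s i) D := by
  refine le_trans ?_ (cum_le_total f g o s _ D)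
  obtain ⟨h1, h2, h3, h4⟩ := E.layout s
  rw [cum_guard, guardCum, guardLine_of_ge (by linarith)]
  have h5 : 0 ≤ 5 * ((g : ℝ) + 1) ^ 2 * ramp (f s + 1) (f s + 2) D :=
    mul_nonneg (by positivity) (ramp_nonneg _ _ _)
  push_cast
  linarith

theorem filler_total (E : GadgetParams f g D n) (s : Bool) (i : Fin (f s)) :
    (f s : ℝ) + 9 / 8 ≤ ∑ t, cum f g o t (.filler s i) D := by
  refine le_trans (le_of_eq ?_) (cum_le_total f g o s _ D)
  obtain ⟨h1, h2, h3, h4⟩ := E.layout s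
  have hi : ((i : ℕ) : ℝ) + 1 ≤ f s := by exact_mod_cast i.2
  rw [cum_filler, fillerCum, ramp_of_ge (by positivity) (by linarith),
    ramp_of_ge (by linarith) (by linarith)]
  ring

/-- Each agent values the cake. -/
theorem total_pos (E : GadgetParams f g D n) (a : Agent f g) : 0 < ∑ t, cum f g o t a D := by
  cases a with
  | liar s =>
    by_cases h : o = some s
    · subst h
      refine lt_of_lt_of_le ?_ (cum_le_total f g (some s) s _ D)
      obtain ⟨h1, h2, h3, h4⟩ := E.layout s
      rw [cum_lie, lieCum, ramp_of_ge (by linarith) (by linarith),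
        ramp_of_ge (by linarith) (by linarith)]
      norm_num
    · exact lt_of_lt_of_le (by positivity) (E.liar_total h)
  | guard s i =>
    obtain ⟨h1, h2, h3, h4⟩ := E.layout s
    have : (0 : ℝ) < f s := by linarith
    exact lt_of_lt_of_le (by positivity) (E.guard_total s i)
  | filler s i => exact lt_of_lt_of_le (by positivity) (E.filler_total s i)

end GadgetParams

/-! ### Consequences of envy-freeness, and the truthful case. -/

namespace GadgetDivision

variable {f : Bool → ℕ} {g : ℕ} {o : Option Bool} {D : ℝ} {n : ℕ}

/-- The value of agent `a` for his own piece. -/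
noncomputable def own (E : GadgetDivision f g o D n) (a : Agent f g) : ℝ := ∑ t, E.part t a a

theorem own_eq (E : GadgetDivision f g o D n) (s : Bool) (a : Agent f g) :
    E.own a = E.part s a a + E.part (!s) a a := by
  unfold own
  rw [Fintype.sum_bool]
  cases s
  · exact add_comm _ _
  · rfl

theorem part_nonneg (E : GadgetDivision f g o D n) (s : Bool) (a j : Agent f g) :
    0 ≤ E.part s a j :=
  sub_nonneg.2 (cum_mono f g o s a (E.lt s j).le)

theorem part_le_own (E : GadgetDivision f g o D n) (s : Bool) (a j : Agent f g) :
    E.part s a j ≤ E.own a := by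
  have h1 := E.part_add_part_le s a j
  have h2 := E.part_nonneg (!s) a j
  rw [E.own_eq s]
  linarith

theorem part_eq_zero (E : GadgetDivision f g o D n) {s : Bool} (a : Agent f g) {j : Agent f g}
    (h : D ≤ E.lo s j) : E.part s a j = 0 := by
  unfold Division.part
  rw [cum_of_ge (E.home_le s) o a h,
    cum_of_ge (E.home_le s) o a (h.trans (E.lt s j).le), sub_self]

theorem part_not_eq_zero (E : GadgetDivision f g o D n) {s : Bool} (a : Agent f g) {j : Agent f g}
    (h : E.hi s j ≤ D) : E.part (!s) a j = 0 :=
  E.part_eq_zero a (by rw [E.lo_not]; linarith)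

/-- Each agent gets a positive value. -/
theorem own_pos (E : GadgetDivision f g o D n) (a : Agent f g) : 0 < E.own a := by
  have h1 := (E.toGadgetParams.total_pos (o := o) a).trans_le (E.total_le a)
  exact pos_of_mul_pos_right h1 (Nat.cast_nonneg n)

/-- A piece without value for its owner on side `s` reaches to the other half of the cake. -/
theorem lt_hi_of_part_eq_zero (E : GadgetDivision f g o D n) {s : Bool} {a : Agent f g}
    (h : E.part s a a = 0) : D < E.hi s a := by
  by_contra h1
  have h2 := E.own_pos a
  rw [E.own_eq s, h, E.part_not_eq_zero a (not_lt.1 h1)] at h2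
  linarith

theorem part_liar (E : GadgetDivision f g o D n) {s : Bool} (h : o ≠ some s) (j : Agent f g) :
    E.part s (.liar s) j = liarCum (f s) g (E.hi s j) - liarCum (f s) g (E.lo s j) := by
  rw [Division.part, cum_liar f g h]

theorem part_liar_not (E : GadgetDivision f g o D n) {s : Bool} (h : o ≠ some s) (j : Agent f g) :
    E.part (!s) (.liar s) j = 0 := by
  rw [Division.part, cum_liar_away f g h]
  exact sub_self _

theorem part_guard (E : GadgetDivision f g o D n) (s : Bool) (i : Fin g) (j : Agent f g) :
    E.part s (.guard s i) j =
      (guardLine (f s) (g + 1) (E.hi s j) - guardLine (f s) (g + 1) (E.lo s j)) +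
        5 * ((g : ℝ) + 1) ^ 2 * (ramp (f s + 1) (f s + 2) (E.hi s j) -
          ramp (f s + 1) (f s + 2) (E.lo s j)) := by
  rw [Division.part, cum_guard, guardCum, guardCum]
  ring

theorem part_guard_not (E : GadgetDivision f g o D n) (s : Bool) (i : Fin g) (j : Agent f g) :
    E.part (!s) (.guard s i) j = (8 * ((g : ℝ) + 1) ^ 2 + 1) *
      (ramp (f (!s) + 4 + 2 * (i : ℕ) + 1) (f (!s) + 4 + 2 * (i : ℕ) + 2) (E.hi (!s) j) -
        ramp (f (!s) + 4 + 2 * (i : ℕ) + 1) (f (!s) + 4 + 2 * (i : ℕ) + 2) (E.lo (!s) j)) := by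
  rw [Division.part, cum_guard_away, wallCum, wallCum]
  ring

theorem part_filler (E : GadgetDivision f g o D n) (s : Bool) (i : Fin (f s)) (j : Agent f g) :
    E.part s (.filler s i) j =
      (min (E.hi s j) (f s + 1 / 8) - min (E.lo s j) (f s + 1 / 8)) +
        (ramp (homeStart (f s) g + (i : ℕ)) (homeStart (f s) g + (i : ℕ) + 1) (E.hi s j) -
          ramp (homeStart (f s) g + (i : ℕ)) (homeStart (f s) g + (i : ℕ) + 1) (E.lo s j)) := by
  rw [Division.part, cum_filler, fillerCum_eq _ _ _ (E.nonneg s j),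
    fillerCum_eq _ _ _ ((E.nonneg s j).trans (E.lt s j).le)]
  ring

theorem part_filler_not (E : GadgetDivision f g o D n) (s : Bool) (i : Fin (f s))
    (j : Agent f g) : E.part (!s) (.filler s i) j = 0 := by
  rw [Division.part, cum_filler_away]
  exact sub_self _

theorem part_lie (E : GadgetDivision f g (some s) D n) (j : Agent f g) :
    E.part s (.liar s) j = lieCum (f s) g (E.hi s j) - lieCum (f s) g (E.lo s j) := by
  rw [Division.part, cum_lie]

theorem part_lie_not (E : GadgetDivision f g (some s) D n) (j : Agent f g) :
    E.part (!s) (.liar s) j = lieAwayCum (E.hi (!s) j) - lieAwayCum (E.lo (!s) j) := by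
  rw [Division.part, cum_lie_away]

/-- Only the liar of a side can get all his units together with the spots around them. -/
theorem eq_liar_of_le (E : GadgetDivision f g o D n) {s : Bool} {j : Agent f g}
    (h1 : E.lo s j ≤ f s + 3) (h2 : homeStart (f s) g ≤ E.hi s j) : j = .liar s := by
  by_contra hne
  obtain ⟨hg, hf, hD, hh⟩ := E.layout s
  have hlt := E.lt s (.liar s)
  have hfs := E.part_le_own s (.liar s) j
  -- Such a piece is worth at least `101/50` to the lying report, which has at most `21/20`
  -- elsewhere, and at least `g + 1 ≥ 2` to a truthful liar, who has at most his tip elsewhere.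
  by_cases ho : o = some s
  · subst ho
    rw [E.part_lie, lieCum, lieCum, ramp_of_ge (y := E.hi s j) (by linarith) (by linarith),
      ramp_of_ge (y := E.hi s j) (by linarith) (by linarith),
      ramp_of_le (y := E.lo s j) (by linarith) (by linarith),
      ramp_of_le (y := E.lo s j) (by linarith) (by linarith), E.own_eq s] at hfs
    rcases E.disj s _ _ hne with h3 | h3
    · have h4 : E.part s (.liar s) (.liar s) = 0 := by
        rw [E.part_lie, lieCum, lieCum, ramp_of_ge (y := E.lo s _) (by linarith) (by linarith),
          ramp_of_ge (y := E.lo s _) (by linarith) (by linarith),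
          ramp_of_ge (y := E.hi s _) (by linarith) (by linarith),
          ramp_of_ge (y := E.hi s _) (by linarith) (by linarith)]
        ring
      rw [h4, E.part_lie_not, lieAwayCum, lieAwayCum] at hfs
      have h5 := ramp_le_one (3 / 16) (1 / 4) (E.hi (!s) (.liar s))
      have h6 := ramp_le_one (1 / 4) (1 / 2) (E.hi (!s) (.liar s))
      have h7 := ramp_nonneg (3 / 16) (1 / 4) (E.lo (!s) (.liar s))
      have h8 := ramp_nonneg (1 / 4) (1 / 2) (E.lo (!s) (.liar s))
      linarith
    · rw [E.part_not_eq_zero _ (by linarith), E.part_lie, lieCum, lieCum,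
        ramp_of_le (y := E.lo s (.liar s)) (by linarith) (by linarith),
        ramp_of_le (y := E.lo s (.liar s)) (by linarith) (by linarith),
        ramp_of_le (y := E.hi s (.liar s)) (by linarith) (by linarith),
        ramp_of_le (y := E.hi s (.liar s)) (by linarith) (by linarith)] at hfs
      linarith
  · rw [E.own_eq s, E.part_liar_not ho, E.part_liar ho, E.part_liar ho,
      liarCum_of_ge (y := E.hi s j) (by linarith),
      liarCum_of_le (y := E.lo s j) (by linarith)] at hfs
    have h5 := ramp_le_one (3 / 16) (1 / 4) (E.lo s j)
    rcases E.disj s _ _ hne with h3 | h3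
    · rw [liarCum_of_ge (y := E.lo s (.liar s)) (by linarith),
        liarCum_of_ge (by linarith)] at hfs
      linarith
    · rw [liarCum_of_le (y := E.lo s (.liar s)) (by linarith),
        liarCum_of_le (y := E.hi s (.liar s)) (by linarith)] at hfs
      have h6 := ramp_le_one (3 / 16) (1 / 4) (E.hi s (.liar s))
      have h7 := ramp_nonneg (3 / 16) (1 / 4) (E.lo s (.liar s))
      linarith

/-- Within side `s`, beyond the spot of the guards and before the homes, only a liar of that side
and guards of the other side have a positive value. -/
theorem part_eq_zero_of_mem (E : GadgetDivision f g o D n) {s : Bool} {a : Agent f g}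
    (ha : a ≠ .liar s) (ha' : ∀ i, a ≠ .guard (!s) i) (h1 : f s + 2 ≤ E.lo s a)
    (h2 : E.hi s a ≤ homeStart (f s) g) : E.part s a a = 0 := by
  obtain ⟨hg, hf, hD, hh⟩ := E.layout s
  have hlt := E.lt s a
  cases a with
  | liar s' =>
    obtain rfl : s' = !s := by
      cases s <;> cases s' <;> simp_all
    by_cases ho : o = some (!s)
    · subst ho
      have := E.part_lie_not (s := !s) (.liar (!s))
      rw [Bool.not_not] at this
      rw [this, lieAwayCum, lieAwayCum,
        ramp_of_ge (y := E.lo s _) (by linarith) (by linarith),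
        ramp_of_ge (y := E.lo s _) (by linarith) (by linarith),
        ramp_of_ge (y := E.hi s _) (by linarith) (by linarith),
        ramp_of_ge (y := E.hi s _) (by linarith) (by linarith), sub_self]
    · simpa using E.part_liar_not ho (.liar (!s))
  | guard s' i =>
    obtain rfl : s' = s := by
      cases s <;> cases s' <;> simp_all
    rw [E.part_guard, guardLine_of_ge (by linarith), guardLine_of_ge (by linarith),
      ramp_of_ge (y := E.lo s' _) (by linarith) (by linarith),
      ramp_of_ge (y := E.hi s' _) (by linarith) (by linarith)]
    ring
  | filler s' i =>
    by_cases hs : s' = s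
    · subst hs
      have hi : (0 : ℝ) ≤ (i : ℕ) := Nat.cast_nonneg _
      rw [E.part_filler, min_eq_right (by linarith), min_eq_right (by linarith),
        ramp_of_le (y := E.lo s' _) (by linarith) (by linarith),
        ramp_of_le (y := E.hi s' _) (by linarith) (by linarith)]
      ring
    · obtain rfl : s' = !s := by
        cases s <;> cases s' <;> simp_all
      simpa using E.part_filler_not (!s) i (.filler (!s) i)

/-- Agents who have no value on the line of side `s`, except possibly at its tip. -/
theorem part_eq_zero_of_le (E : GadgetDivision f g o D n) {s : Bool} {a : Agent f g}
    (ha : ∀ s', a ≠ .liar s') (hfil : ∀ i, a ≠ .filler s i) (hgd : ∀ i, a ≠ .guard s i)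
    (h2 : E.hi s a ≤ f s + 4) : E.part s a a = 0 := by
  obtain ⟨hg, hf, hD, hh⟩ := E.layout s
  have hlt := E.lt s a
  cases a with
  | liar s' => exact absurd rfl (ha s')
  | guard s' i =>
    obtain rfl : s' = !s := by
      cases s <;> cases s' <;> simp_all
    have h := E.part_guard_not (!s) i (.guard (!s) i)
    have hi : (0 : ℝ) ≤ (i : ℕ) := Nat.cast_nonneg _
    rw [Bool.not_not] at h
    rw [h, ramp_of_le (y := E.lo s _) (by linarith) (by linarith),
      ramp_of_le (y := E.hi s _) (by linarith) (by linarith)]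
    ring
  | filler s' i =>
    obtain rfl : s' = !s := by
      cases s <;> cases s' <;> simp_all
    simpa using E.part_filler_not (!s) i (.filler (!s) i)

theorem side (E : GadgetDivision f g o D n) (s : Bool) :
    Side (f s) g (E.lo s) (E.hi s) (.filler s) (.guard s) (homeStart (f s) g) := by
  obtain ⟨hg, hf, hD, hh⟩ := E.layout s
  refine ⟨E.two_mul_lt s, by linarith, E.lt s, E.nonneg s, E.disj s,
    fun y h1 h2 => E.cover s y h1 (by linarith), fun a b h => by injection h,
    fun i j h => by injection h, ?_, ?_, ?_, ?_⟩
  · intro i h1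
    by_contra h2
    cases E.eq_liar_of_le (s := s) (by linarith) (not_le.1 h2).le
  · intro i j
    have h := E.part_add_part_le s (.filler s i) j
    rw [E.part_filler_not, E.part_filler_not, E.part_filler, E.part_filler] at h
    linarith
  -- Among the homes of this side only its fillers have value; a piece of anyone else would have to
  -- reach the other half of the cake.
  · intro j h1 h2
    by_contra h3
    have hlt := E.lt s j
    have h4 : E.part s j j = 0 := by
      cases j with
      | liar s' =>
        by_cases hs : s' = s
        · subst hs
          by_cases ho : o = some s'
          · subst ho
            rw [E.part_lie, lieCum, lieCum,
              ramp_of_ge (y := E.lo s' _) (by linarith) (by linarith),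
              ramp_of_ge (y := E.lo s' _) (by linarith) (by linarith),
              ramp_of_ge (y := E.hi s' _) (by linarith) (by linarith),
              ramp_of_ge (y := E.hi s' _) (by linarith) (by linarith), sub_self]
          · rw [E.part_liar ho, liarCum_of_ge (by linarith),
              liarCum_of_ge (by linarith), sub_self]
        · obtain rfl : s' = !s := by
            cases s <;> cases s' <;> simp_all
          by_cases ho : o = some (!s)
          · subst ho
            have := E.part_lie_not (s := !s) (.liar (!s))
            rw [Bool.not_not] at this
            rw [this, lieAwayCum, lieAwayCum,
              ramp_of_ge (y := E.lo s _) (by linarith) (by linarith),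
              ramp_of_ge (y := E.lo s _) (by linarith) (by linarith),
              ramp_of_ge (y := E.hi s _) (by linarith) (by linarith),
              ramp_of_ge (y := E.hi s _) (by linarith) (by linarith), sub_self]
          · simpa using E.part_liar_not ho (.liar (!s))
      | guard s' i =>
        by_cases hs : s' = s
        · subst hs
          rw [E.part_guard, guardLine_of_ge (by linarith), guardLine_of_ge (by linarith),
            ramp_of_ge (y := E.lo s' _) (by linarith) (by linarith),
            ramp_of_ge (y := E.hi s' _) (by linarith) (by linarith)]
          ring
        · obtain rfl : s' = !s := by
            cases s <;> cases s' <;> simp_all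
          have h := E.part_guard_not (!s) i (.guard (!s) i)
          have hi : ((i : ℕ) : ℝ) + 1 ≤ g := by exact_mod_cast i.2
          rw [Bool.not_not] at h
          rw [h, ramp_of_ge (y := E.lo s _) (by linarith) (by linarith),
            ramp_of_ge (y := E.hi s _) (by linarith) (by linarith)]
          ring
      | filler s' i =>
        by_cases hs : s' = s
        · subst hs
          exact absurd ⟨i, rfl⟩ h3
        · obtain rfl : s' = !s := by
            cases s <;> cases s' <;> simp_all
          simpa using E.part_filler_not (!s) i (.filler (!s) i)
    have h5 := E.lt_hi_of_part_eq_zero h4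
    linarith
  · intro i j h1
    have h := E.part_add_part_le s (.guard s i) j
    rw [E.part_not_eq_zero (.guard s i) (j := .guard s i) (by linarith), E.part_guard,
      E.part_guard] at h
    have h2 := E.part_nonneg (!s) (.guard s i) j
    linarith

/-- A piece of a non-filler which meets the cake end does not contain the rest of the line. -/
theorem hi_lt_of_lo_le (E : GadgetDivision f g o D n) {s : Bool} {j : Agent f g}
    (hj : ∀ i, j ≠ .filler s i) (h1 : E.lo s j ≤ 1 / 2) : E.hi s j < f s + 1 / 8 := by
  by_contra h2
  obtain ⟨hg, hf, hD, hh⟩ := E.layout s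
  obtain ⟨i⟩ : Nonempty (Fin (f s)) := ⟨⟨0, by have := E.two_mul_lt s; omega⟩⟩
  have hi : (0 : ℝ) ≤ (i : ℕ) := Nat.cast_nonneg _
  -- A filler would see at least `f - 3/8` in this piece, but has at most `1/2` before it or at most
  -- his home after it.
  have h3 := (E.side s).filler_envyFree i j
  have hm := ramp_mono (a := homeStart (f s) g + (i : ℕ)) (b := homeStart (f s) g + (i : ℕ) + 1)
    (by linarith) (E.lt s j).le
  rw [min_eq_right (not_lt.1 h2), min_eq_left (a := E.lo s j) (by linarith)] at h3
  have hlt := E.lt s (.filler s i)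
  have hr1 := ramp_le_one (homeStart (f s) g + (i : ℕ)) (homeStart (f s) g + (i : ℕ) + 1)
    (E.hi s (.filler s i))
  have hr2 := ramp_nonneg (homeStart (f s) g + (i : ℕ)) (homeStart (f s) g + (i : ℕ) + 1)
    (E.lo s (.filler s i))
  rcases E.disj s _ _ (hj i) with h4 | h4
  · rw [min_eq_right (by linarith), min_eq_right (by linarith)] at h3
    linarith
  · have h5 := E.nonneg s (.filler s i)
    rw [min_eq_left (a := E.hi s (.filler s i)) (by linarith),
      min_eq_left (a := E.lo s (.filler s i)) (by linarith),
      ramp_of_le (y := E.hi s (.filler s i)) (by linarith)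
        (by linarith)] at h3
    linarith

/-- Apart from liars and the fillers and guards of this side, nobody has value on this line, so
their pieces must reach the other half. Only the liars need a separate check. -/
theorem off_of_liars (E : GadgetDivision f g o D n) {s : Bool}
    (h1 : (f s : ℝ) + 1 / 8 < E.hi s (.liar s)) (h2 : (f s : ℝ) + 1 / 8 < E.hi s (.liar (!s)))
    (j : Agent f g) (hfil : j ∉ Set.range (Agent.filler s)) (hgd : j ∉ Set.range (Agent.guard s)) :
    (f s : ℝ) + 1 / 8 < E.hi s j := by
  obtain ⟨hg, hf, hD, hh⟩ := E.layout s
  by_cases hl : ∀ s', j ≠ .liar s'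
  · by_contra h3
    have h4 := E.lt_hi_of_part_eq_zero (E.part_eq_zero_of_le hl (fun i hi => hfil ⟨i, hi.symm⟩)
      (fun i hi => hgd ⟨i, hi.symm⟩) (by linarith))
    linarith
  · push Not at hl
    obtain ⟨s', rfl⟩ := hl
    by_cases hs : s' = s
    · rw [hs]; exact h1
    · obtain rfl : s' = !s := by
        cases s <;> cases s' <;> simp_all
      exact h2

/-- A piece violating both would cover everything from `f + 3` to the homes, which is reserved for
the liar. -/
theorem guard_dichotomy (E : GadgetDivision f g o D n) (s : Bool) (i : Fin g) :
    E.hi s (.guard s i) ≤ homeStart (f s) g ∨ f s + 2 ≤ E.lo s (.guard s i) := by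
  by_contra h
  push Not at h
  cases E.eq_liar_of_le (s := s) (by linarith) h.1.le

theorem guard_own_of_hi_le (E : GadgetDivision f g o D n) {s : Bool} {i : Fin g}
    (h : E.hi s (.guard s i) ≤ homeStart (f s) g) :
    E.own (.guard s i) = E.part s (.guard s i) (.guard s i) := by
  obtain ⟨hg, hf, hD, hh⟩ := E.layout s
  rw [E.own_eq s, E.part_not_eq_zero _ (by linarith), add_zero]

theorem guard_part_of_le_lo (E : GadgetDivision f g o D n) {s : Bool} (i : Fin g) {j : Agent f g}
    (h : f s + 2 ≤ E.lo s j) : E.part s (.guard s i) j = 0 := by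
  have hlt := E.lt s j
  rw [E.part_guard, guardLine_of_ge (by linarith), guardLine_of_ge (by linarith),
    ramp_of_ge (y := E.lo s _) (by linarith) (by linarith),
    ramp_of_ge (y := E.hi s _) (by linarith) (by linarith)]
  ring

theorem wall_part_le (E : GadgetDivision f g o D n) (s : Bool) (i : Fin g) (j : Agent f g) :
    E.part (!s) (.guard s i) j ≤ 8 * ((g : ℝ) + 1) ^ 2 + 1 := by
  rw [E.part_guard_not]
  have h1 := ramp_le_one (f (!s) + 4 + 2 * (i : ℕ) + 1) (f (!s) + 4 + 2 * (i : ℕ) + 2)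
    (E.hi (!s) j)
  have h2 := ramp_nonneg (f (!s) + 4 + 2 * (i : ℕ) + 1) (f (!s) + 4 + 2 * (i : ℕ) + 2)
    (E.lo (!s) j)
  exact mul_le_of_le_one_right (by positivity) (by linarith)

/-- A guard has either a cell on his side or, beyond his spot, nothing but his wall. -/
theorem guard_own_le (E : GadgetDivision f g o D n) {s : Bool}
    (hoff : ∀ j, j ∉ Set.range (Agent.filler s) → j ∉ Set.range (Agent.guard s) →
      (f s : ℝ) + 1 / 8 < E.hi s j) (i : Fin g) :
    E.own (.guard s i) ≤ 8 * ((g : ℝ) + 1) ^ 2 + 1 := by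
  rcases E.guard_dichotomy s i with h | h
  · rw [E.guard_own_of_hi_le h, E.part_guard]
    linarith [((E.side s).guard_of_off hoff i h).2]
  · rw [E.own_eq s, E.guard_part_of_le_lo i h, zero_add]
    exact E.wall_part_le s i _

/-- No piece of another agent contains the wall of a guard. -/
theorem not_wall_of_off (E : GadgetDivision f g o D n) {s : Bool}
    (hoff : ∀ j, j ∉ Set.range (Agent.filler s) → j ∉ Set.range (Agent.guard s) →
      (f s : ℝ) + 1 / 8 < E.hi s j) (i : Fin g) {j : Agent f g} (hne : j ≠ .guard s i) :
    ¬ (E.lo (!s) j ≤ f (!s) + 4 + 2 * (i : ℕ) + 1 ∧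
      f (!s) + 4 + 2 * (i : ℕ) + 2 ≤ E.hi (!s) j) := by
  rintro ⟨h1, h2⟩
  obtain ⟨hg, hf, hD, hh⟩ := E.layout s
  have h3 := E.part_le_own (!s) (.guard s i) j
  rw [E.part_guard_not, ramp_of_ge (by linarith) h2, ramp_of_le (by linarith) h1] at h3
  have h4 : E.part (!s) (.guard s i) (.guard s i) = 0 := by
    rw [E.part_guard_not]
    have hlt := E.lt (!s) (.guard s i)
    rcases E.disj (!s) _ _ hne with h5 | h5
    · rw [ramp_of_ge (y := E.hi _ _) (by linarith) (by linarith),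
        ramp_of_ge (y := E.lo _ _) (by linarith) (by linarith)]
      ring
    · rw [ramp_of_le (y := E.hi _ _) (by linarith) (by linarith),
        ramp_of_le (y := E.lo _ _) (by linarith) (by linarith)]
      ring
  -- A guard without his wall has at most a cell, one less than the wall is worth to him.
  rcases E.guard_dichotomy s i with h | h
  · rw [E.guard_own_of_hi_le h, E.part_guard] at h3
    linarith [((E.side s).guard_of_off hoff i h).2]
  · rw [E.own_eq s, h4, E.guard_part_of_le_lo i h] at h3
    nlinarith

/-- A truthful liar on the other side gets at most one unit. -/
theorem part_liar_le_of_off (E : GadgetDivision f g o D n) {s : Bool}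
    (hoff : ∀ j, j ∉ Set.range (Agent.filler s) → j ∉ Set.range (Agent.guard s) →
      (f s : ℝ) + 1 / 8 < E.hi s j) (ho : o ≠ some (!s)) :
    E.part (!s) (.liar (!s)) (.liar (!s)) ≤ 21 / 20 * (ramp (3 / 16) (1 / 4)
      (E.hi (!s) (.liar (!s))) - ramp (3 / 16) (1 / 4) (E.lo (!s) (.liar (!s)))) + 1 := by
  have h := sum_unit_le_one (a := E.lo (!s) (.liar (!s))) (b := E.hi (!s) (.liar (!s)))
    (c := f (!s) + 4) g (fun i hi => E.not_wall_of_off hoff ⟨i, hi⟩ (by simp))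
  rw [Finset.sum_sub_distrib] at h
  rw [E.part_liar ho, liarCum, liarCum]
  linarith

theorem own_liar_of_lo_le (E : GadgetDivision f g o D n) {s : Bool} (ho : o ≠ some s)
    (h : E.lo s (.liar s) ≤ 1 / 2) : E.own (.liar s) = 21 / 20 * (ramp (3 / 16) (1 / 4)
      (E.hi s (.liar s)) - ramp (3 / 16) (1 / 4) (E.lo s (.liar s))) := by
  have h1 := E.hi_lt_of_lo_le (s := s) (j := .liar s) (by simp) h
  have hlt := E.lt s (.liar s)
  rw [E.own_eq s, E.part_liar_not ho, E.part_liar ho, liarCum_of_le (by linarith),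
    liarCum_of_le (by linarith)]
  ring

theorem lt_hi_liar_not (E : GadgetDivision f g o D n) {s : Bool} (ho : o ≠ some (!s)) :
    (f s : ℝ) + 1 / 8 < E.hi s (.liar (!s)) := by
  obtain ⟨hg, hf, hD, hh⟩ := E.layout s
  have h1 := E.part_liar_not ho (.liar (!s))
  rw [Bool.not_not] at h1
  linarith [E.lt_hi_of_part_eq_zero h1]

/-- If everybody is truthful, then one of the liars gets little. -/
theorem exists_own_le (E : GadgetDivision f g none D n) : ∃ s, E.own (.liar s) ≤ 21 / 20 := by
  by_cases h : ∃ s, E.lo s (.liar s) ≤ 1 / 2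
  · obtain ⟨s, hs⟩ := h
    refine ⟨s, ?_⟩
    rw [E.own_liar_of_lo_le (by simp) hs]
    linarith [ramp_le_one (3 / 16) (1 / 4) (E.hi s (.liar s)),
      ramp_nonneg (3 / 16) (1 / 4) (E.lo s (.liar s))]
  -- Both liars have skipped their tips. The `false` line is then undisturbed, its guards protect
  -- the walls on the `true` side, and the liar there is limited to one unit.
  · push Not at h
    have hoff := E.off_of_liars (s := false) (by
      obtain ⟨hg, hf, hD, hh⟩ := E.layout false
      by_contra h1
      have h2 := h false
      have hlt := E.lt false (.liar false)
      have h3 : E.part false (.liar false) (.liar false) = 0 := by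
        rw [E.part_liar (by simp), liarCum_of_le (by linarith), liarCum_of_le (by linarith),
          ramp_of_ge (by norm_num) (by linarith), ramp_of_ge (by norm_num) (by linarith), sub_self]
      linarith [E.lt_hi_of_part_eq_zero h3]) (E.lt_hi_liar_not (by simp))
    refine ⟨true, ?_⟩
    have h1 := E.part_liar_le_of_off hoff (by simp)
    have h2 := h true
    have h3 := E.lt true (.liar true)
    simp only [Bool.not_false] at h1
    rw [ramp_of_ge (y := E.hi true _) (by norm_num) (by linarith),
      ramp_of_ge (y := E.lo true _) (by norm_num) (by linarith)] at h1
    rw [E.own_eq true, E.part_liar_not (by simp)]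
    linarith

end GadgetDivision
-- The case of a lying agent.
namespace GadgetDivision

variable {f : Bool → ℕ} {g : ℕ} {s : Bool} {D : ℝ} {n : ℕ}

theorem lo_eq {o : Option Bool} (E : GadgetDivision f g o D n) (s : Bool) (j : Agent f g) :
    E.lo s j = 2 * D - E.hi (!s) j := by
  have h := E.lo_not (!s) j
  rwa [Bool.not_not] at h

theorem off_of_lie (E : GadgetDivision f g (some s) D n) (j : Agent f g)
    (hfil : j ∉ Set.range (Agent.filler s)) (hgd : j ∉ Set.range (Agent.guard s)) :
    (f s : ℝ) + 1 / 8 < E.hi s j := by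
  refine E.off_of_liars ?_ (E.lt_hi_liar_not (by simp)) j hfil hgd
  obtain ⟨hg, hf, hD, hh⟩ := E.layout s
  by_contra h1
  have hlt := E.lt s (.liar s)
  have h2 : E.part s (.liar s) (.liar s) = 0 := by
    rw [E.part_lie, lieCum, lieCum, ramp_of_le (y := E.hi s _) (by linarith) (by linarith),
      ramp_of_le (y := E.hi s _) (by linarith) (by linarith),
      ramp_of_le (y := E.lo s _) (by linarith) (by linarith),
      ramp_of_le (y := E.lo s _) (by linarith) (by linarith), sub_self]
  linarith [E.lt_hi_of_part_eq_zero h2]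

/-- A filler who starts on the line does not reach beyond the spot of the guards. -/
theorem filler_hi_lt (E : GadgetDivision f g (some s) D n) {i : Fin (f s)}
    (h : E.lo s (.filler s i) < f s + 1 / 8) : E.hi s (.filler s i) < f s + 2 := by
  obtain ⟨hg, hf, hD, hh⟩ := E.layout s
  by_contra h1
  have hm := (E.side s).numHome_le_of_off E.off_of_lie
  have hroom := (E.side s).one_le_room (by have := E.two_mul_lt s; omega) i h
  rw [min_eq_left (a := E.lo _ _) h.le] at hroom
  have hmin := min_le_right (E.hi s (.filler s i)) ((f s : ℝ) + 1 / 8)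
  have hle := (E.part_le_own s (.guard s ⟨0, E.one_le⟩) (.filler s i)).trans
    (E.guard_own_le E.off_of_lie _)
  obtain ⟨m, hm'⟩ : ∃ m, f s = m + 1 := ⟨f s - 1, by have := E.two_mul_lt s; omega⟩
  have hmg : g + 1 ≤ m + 1 := by have := E.two_mul_lt s; omega
  have hmr : (f s : ℝ) = m + 1 := by rw [hm']; push_cast; rfl
  -- The piece contains the tail of the last cell, worth `4 * N ^ 2` as its head is at the cap, and
  -- the spot worth `5 * N ^ 2`. A guard would envy `9 * N ^ 2 > 8 * N ^ 2 + 1`.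
  have h2 := guardLine_mono (f s) (g + 1) (show E.lo s (.filler s i) ≤ (m : ℝ) + 1 / 2 by linarith)
  rw [guardLine_head (g + 1) (by omega) (by norm_num) le_rfl, headMass_of_ge hmg] at h2
  rw [E.part_guard, guardLine_of_ge (by linarith), ramp_of_ge (by linarith) (not_lt.1 h1),
    ramp_of_le (by linarith) (by linarith)] at hle
  push_cast at h2 hle
  rw [hmr] at hle
  nlinarith

/-- Who may hold the start of the spot before the units of the lying agent. -/
theorem eq_liar_or_guard (E : GadgetDivision f g (some s) D n) {j : Agent f g}
    (h1 : E.lo s j ≤ f s + 3) (h2 : f s + 3 < E.hi s j) :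
    j = .liar s ∨ (f s + 4 ≤ E.hi s j ∧ E.hi s j < homeStart (f s) g ∧ ∃ i, j = .guard (!s) i) := by
  by_cases hj : j = .liar s
  · exact Or.inl hj
  right
  obtain ⟨hg, hf, hD, hh⟩ := E.layout s
  have h3 : E.hi s j < homeStart (f s) g := by
    by_contra h3
    exact hj (E.eq_liar_of_le h1 (not_lt.1 h3))
  have hno : E.part s j j ≠ 0 := fun h4 => by linarith [E.lt_hi_of_part_eq_zero h4]
  cases j with
  | liar s' =>
    obtain rfl : s' = !s := by
      cases s <;> cases s' <;> simp_all
    refine absurd ?_ hno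
    simpa using E.part_liar_not (s := !s) (by simp) (.liar (!s))
  | guard s' i =>
    by_cases hs : s' = s
    · subst hs
      linarith [((E.side s').guard_of_off E.off_of_lie i h3.le).1]
    · obtain rfl : s' = !s := by
        cases s <;> cases s' <;> simp_all
      refine ⟨?_, h3, i, rfl⟩
      by_contra h4
      exact hno (E.part_eq_zero_of_le (by simp) (by simp) (by simp) (not_le.1 h4).le)
  | filler s' i =>
    by_cases hs : s' = s
    · subst hs
      rcases lt_or_ge (E.lo s' (.filler s' i)) (f s' + 1 / 8) with h4 | h4
      · linarith [E.filler_hi_lt h4]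
      · refine absurd ?_ hno
        have hi : (0 : ℝ) ≤ (i : ℕ) := Nat.cast_nonneg _
        rw [E.part_filler, min_eq_right (by linarith), min_eq_right h4,
          ramp_of_le (by linarith) (by linarith), ramp_of_le (by linarith) (by linarith)]
        ring
    · obtain rfl : s' = !s := by
        cases s <;> cases s' <;> simp_all
      refine absurd ?_ hno
      simpa using E.part_filler_not (!s) i (.filler (!s) i)

/-- Anyone else holding the point `f + 3` is a guard of the other side, whose piece contains the
entire first reported spot; absence of envy gives the bound. -/
theorem one_le_own_lie (E : GadgetDivision f g (some s) D n)
    (h : ¬ (E.lo s (.liar s) ≤ f s + 3 ∧ f s + 3 < E.hi s (.liar s))) : 1 ≤ E.own (.liar s) := by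
  obtain ⟨hg, hf, hD, hh⟩ := E.layout s
  obtain ⟨j, h1, h2⟩ := E.cover s (f s + 3) (by linarith) (by linarith)
  rcases E.eq_liar_or_guard h1 h2 with rfl | ⟨h3, -, -⟩
  · exact absurd ⟨h1, h2⟩ h
  · refine le_trans ?_ (E.part_le_own s (.liar s) j)
    rw [E.part_lie, lieCum, lieCum, ramp_of_ge (by linarith) h3, ramp_of_le (by linarith) h1,
      ramp_of_le (y := E.lo s j) (by linarith) (by linarith)]
    linarith [ramp_nonneg (f s + 5 + 2 * g) (f s + 6 + 2 * g) (E.hi s j)]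

theorem part_lie_not_le (E : GadgetDivision f g (some s) D n) (j : Agent f g) :
    E.part (!s) (.liar s) j ≤ 9 / 10 * (1 - ramp (3 / 16) (1 / 4) (E.lo (!s) j)) + 3 / 20 := by
  rw [E.part_lie_not, lieAwayCum, lieAwayCum]
  linarith [ramp_le_one (3 / 16) (1 / 4) (E.hi (!s) j), ramp_le_one (1 / 4) (1 / 2) (E.hi (!s) j),
    ramp_nonneg (1 / 4) (1 / 2) (E.lo (!s) j)]

/-- Only the truthful liar can have a short piece near his cake end. -/
theorem lt_hi_not (E : GadgetDivision f g (some s) D n) {j : Agent f g} (hj : j ≠ .liar (!s)) :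
    1 / 4 < E.hi (!s) j := by
  by_contra hcon
  obtain ⟨hg, hf, hD, hh⟩ := E.layout (!s)
  have hlt := E.lt (!s) j
  have h0 := E.nonneg (!s) j
  have hn := E.n_lt (!s)
  have hn0 : (0 : ℝ) ≤ n := Nat.cast_nonneg n
  have hlo := E.lo_eq s j
  have hz : E.part s j j = 0 := E.part_eq_zero j (by linarith)
  have hown : E.own j = E.part (!s) j j := by rw [E.own_eq s, hz, zero_add]
  have hpos := E.own_pos j
  cases j with
  | liar s' =>
    obtain rfl : s' = s := by
      cases s <;> cases s' <;> simp_all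
    obtain ⟨hg', hf', hD', hh'⟩ := E.layout s'
    -- Within `[0, 1/4]` of the other side the report values at most `9/10`.
    have h1 := E.one_le_own_lie (fun h => by linarith [h.1])
    rw [hown, E.part_lie_not, lieAwayCum, lieAwayCum,
      ramp_of_le (a := 1 / 4) (y := E.hi _ _) (by norm_num) (by linarith),
      ramp_of_le (a := 1 / 4) (y := E.lo _ _) (by norm_num) (by linarith)] at h1
    linarith [ramp_le_one (3 / 16) (1 / 4) (E.hi (!s') (.liar s')),
      ramp_nonneg (3 / 16) (1 / 4) (E.lo (!s') (.liar s'))]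
  | guard s' i =>
    by_cases hs : s' = !s
    · subst hs
      -- The first quarter of the line is worth only `2 * N` to a guard, so proportionality would
      -- give `4 * N * f ≤ n`.
      have h1 := (E.guard_total (!s) i).trans (E.total_le _)
      have h2 : E.own (.guard (!s) i) ≤ 2 * ((g : ℝ) + 1) := by
        rw [hown, E.part_guard, ramp_of_le (by linarith) (by linarith),
          ramp_of_le (by linarith) (by linarith)]
        have h3 := guardLine_mono (f !s) (g + 1) (show E.hi (!s) (.guard (!s) i) ≤
          ((0 : ℕ) : ℝ) + 1 / 4 by push_cast; linarith)
        have h4 := guardLine_mono (f !s) (g + 1) (show ((0 : ℕ) : ℝ) ≤ E.lo (!s) (.guard (!s) i) by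
          push_cast; linarith)
        have hpos : 0 < f (!s) := by have := E.two_mul_lt (!s); omega
        rw [guardLine_head (g + 1) hpos (by norm_num) (by norm_num),
          headMass_of_lt (Nat.succ_pos g)] at h3
        rw [guardLine_natCast (g + 1) hpos.le] at h4
        push_cast at h3 h4
        linarith
      have h5 : (n : ℝ) * E.own (.guard (!s) i) ≤ n * (2 * (g + 1)) :=
        mul_le_mul_of_nonneg_left h2 hn0
      have h6 : (f (!s) : ℝ) * (8 * ((g : ℝ) + 1) ^ 2) ≤ n * (2 * (g + 1)) := h1.trans h5
      have h7 : (f (!s) : ℝ) * (4 * ((g : ℝ) + 1)) ≤ n := by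
        have h8 : (0 : ℝ) < 2 * (g + 1) := by positivity
        refine le_of_mul_le_mul_right ?_ h8
        calc (f (!s) : ℝ) * (4 * ((g : ℝ) + 1)) * (2 * (g + 1))
            = f (!s) * (8 * ((g : ℝ) + 1) ^ 2) := by ring
          _ ≤ _ := h6
      nlinarith
    · obtain rfl : s' = s := by
        cases s <;> cases s' <;> simp_all
      rw [hown, E.part_guard_not, ramp_of_le (by linarith) ?_, ramp_of_le (by linarith) ?_] at hpos
      · linarith
      · linarith [(Nat.cast_nonneg _ : (0 : ℝ) ≤ (i : ℕ))]
      · linarith [(Nat.cast_nonneg _ : (0 : ℝ) ≤ (i : ℕ))]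
  | filler s' i =>
    by_cases hs : s' = !s
    · subst hs
      have h1 := (E.filler_total (!s) i).trans (E.total_le _)
      have hi : (0 : ℝ) ≤ (i : ℕ) := Nat.cast_nonneg _
      have h2 : E.own (.filler (!s) i) ≤ 1 / 4 := by
        rw [hown, E.part_filler, min_eq_left (by linarith), min_eq_left (by linarith),
          ramp_of_le (by linarith) (by linarith), ramp_of_le (by linarith) (by linarith)]
        linarith
      have h5 : (n : ℝ) * E.own (.filler (!s) i) ≤ n * (1 / 4) := mul_le_mul_of_nonneg_left h2 hn0
      have h6 : (f (!s) : ℝ) + 9 / 8 ≤ n * (1 / 4) := h1.trans h5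
      linarith
    · obtain rfl : s' = s := by
        cases s <;> cases s' <;> simp_all
      rw [hown, E.part_filler_not] at hpos
      exact lt_irrefl _ hpos

/-- The truthful liar is at his cake end. -/
theorem liar_not_tip (E : GadgetDivision f g (some s) D n) :
    E.lo (!s) (.liar (!s)) = 0 ∧ 3 / 16 < E.hi (!s) (.liar (!s)) := by
  obtain ⟨hg, hf, hD, hh⟩ := E.layout (!s)
  have ho : some s ≠ some (!s) := by simp
  obtain ⟨j, hj⟩ := (E.side (!s)).exists_start_eq_zero
  by_cases hne : j = .liar (!s)
  · subst hne
    refine ⟨hj, ?_⟩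
    by_contra h1
    have h2 := E.own_pos (.liar (!s))
    rw [E.own_liar_of_lo_le ho (by linarith), hj,
      ramp_of_le (y := E.hi _ _) (by norm_num) (not_lt.1 h1),
      ramp_of_le (y := 0) (by norm_num) (by norm_num)] at h2
    linarith
  -- Otherwise the piece at the cake end contains the whole tip, worth `21/20`, while this liar has
  -- at most one unit.
  · exfalso
    have h1 := E.lt_hi_not hne
    have h2 := E.lt (!s) (.liar (!s))
    have h0 := E.nonneg (!s) (.liar (!s))
    have h3 : E.hi (!s) j ≤ E.lo (!s) (.liar (!s)) := by
      rcases E.disj (!s) _ _ hne with h3 | h3 <;> linarith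
    have h4 := E.part_liar_le_of_off E.off_of_lie ho
    rw [ramp_of_ge (y := E.hi _ _) (by norm_num) (by linarith),
      ramp_of_ge (y := E.lo _ _) (by norm_num) (by linarith)] at h4
    have h5 := E.part_le_own (!s) (.liar (!s)) j
    rw [E.own_eq (!s), E.part_liar_not ho, E.part_liar ho, hj,
      liarCum_of_le (y := 0) (by linarith), ramp_of_le (y := 0) (by norm_num) (by norm_num)] at h5
    have h6 := liarCum_mono (f !s) g h1.le
    rw [liarCum_of_le (by linarith), ramp_of_ge (by norm_num) le_rfl] at h6
    linarith

/-- Proportionality: this liar values the cake above `g + 1`, there are at most `16 * (g + 1)`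
shares, and he has only tip. -/
theorem ramp_tip_gt (E : GadgetDivision f g (some s) D n) :
    1 / 17 < ramp (3 / 16) (1 / 4) (E.hi (!s) (.liar (!s))) := by
  have ho : some s ≠ some (!s) := by simp
  obtain ⟨h1, h2⟩ := E.liar_not_tip
  have h3 := (E.liar_total ho).trans (E.total_le _)
  have h4 := E.own_liar_of_lo_le ho (by linarith)
  rw [h1, ramp_of_le (y := 0) (by norm_num) (by norm_num)] at h4
  have h5 : 21 / 20 + ((g : ℝ) + 1) ≤ n * E.own (.liar (!s)) := h3
  rw [h4] at h5
  have h6 : (n : ℝ) ≤ 16 * (g + 1) := by exact_mod_cast E.n_le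
  have h7 := ramp_nonneg (3 / 16) (1 / 4) (E.hi (!s) (.liar (!s)))
  have hg : (0 : ℝ) ≤ g := Nat.cast_nonneg g
  by_contra h8
  have h9 : (n : ℝ) * ramp (3 / 16) (1 / 4) (E.hi (!s) (.liar (!s))) ≤ 16 * (g + 1) * (1 / 17) :=
    mul_le_mul h6 (not_lt.1 h8) h7 (by positivity)
  nlinarith

/-- The lying agent does not get anything near the cake end of the other side. -/
theorem lt_hi_not_lie (E : GadgetDivision f g (some s) D n) :
    (f (!s) : ℝ) + 1 / 8 < E.hi (!s) (.liar s) ∧ E.part (!s) (.liar s) (.liar s) = 0 := by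
  obtain ⟨hg, hf, hD, hh⟩ := E.layout (!s)
  obtain ⟨hg', hf', hD', hh'⟩ := E.layout s
  have hlt := E.lt (!s) (.liar s)
  have hmain : (f (!s) : ℝ) + 1 / 8 < E.hi (!s) (.liar s) := by
    by_contra hcon
    obtain ⟨h1, h2⟩ := E.liar_not_tip
    have h3 := E.ramp_tip_gt
    have h0 := E.nonneg (!s) (.liar s)
    have hlo := E.lo_eq s (.liar s)
    have h4 : E.hi (!s) (.liar (!s)) ≤ E.lo (!s) (.liar s) := by
      rcases E.disj (!s) (.liar s) (.liar (!s)) (by simp) with h | h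
      · linarith
      · exact h
    have h5 := ramp_mono (a := 3 / 16) (b := 1 / 4) (by norm_num) h4
    -- After the truthful liar's share of the tip, at most `9/10 * 16/17 + 3/20 < 1` is left there
    -- for the lying agent.
    have h6 := E.part_lie_not_le (.liar s)
    have h7 := E.one_le_own_lie (fun h => by linarith [h.1])
    rw [E.own_eq s, E.part_eq_zero (s := s) _ (by linarith)] at h7
    linarith
  refine ⟨hmain, ?_⟩
  have h1 : 1 / 2 < E.lo (!s) (.liar s) := by
    by_contra h1
    linarith [E.hi_lt_of_lo_le (s := !s) (j := .liar s) (by simp) (not_lt.1 h1)]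
  rw [E.part_lie_not, lieAwayCum, lieAwayCum, ramp_of_ge (by norm_num) (by linarith),
    ramp_of_ge (by norm_num) (by linarith), ramp_of_ge (by norm_num) (by linarith),
    ramp_of_ge (by norm_num) (by linarith), sub_self]

/-- If the truthful liar takes little of the line, then all guards are on the line. -/
theorem guard_on_line (E : GadgetDivision f g (some s) D n)
    (hq : E.hi (!s) (.liar (!s)) < 1 / 2) (i : Fin g) :
    E.lo (!s) (.guard (!s) i) < f (!s) + 1 / 8 := by
  by_contra hcon
  obtain ⟨hg, hf, hD, hh⟩ := E.layout (!s)
  obtain ⟨h1, h2⟩ := E.liar_not_tip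
  refine hcon ((E.side (!s)).guard_of_on h1 h2 hq (by simp) ?_ i ?_)
  · intro j hfil hgd hne
    by_cases hj : j = .liar s
    · subst hj
      exact E.lt_hi_not_lie.1
    by_contra h3
    have h4 := E.lt_hi_of_part_eq_zero (E.part_eq_zero_of_le (s := !s) (a := j) ?_
      (fun i hi => hfil ⟨i, hi.symm⟩) (fun i hi => hgd ⟨i, hi.symm⟩) (by linarith))
    · linarith
    · rintro s' rfl
      cases s <;> cases s' <;> simp_all
  · intro j
    have h3 := E.part_le_own (!s) (.guard (!s) i) j
    rw [E.part_guard] at h3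
    refine h3.trans ?_
    -- A guard off his line has at most the spot or the wall, so his absence of envy bounds the
    -- guards' valuation of every piece on this side.
    rcases E.guard_dichotomy (!s) i with h | h
    · have hlt := E.lt (!s) (.guard (!s) i)
      rw [E.guard_own_of_hi_le h, E.part_guard, guardLine_of_ge (by linarith),
        guardLine_of_ge (by linarith)]
      have hr1 := ramp_le_one (f (!s) + 1) (f (!s) + 2) (E.hi (!s) (.guard (!s) i))
      have hr2 := ramp_nonneg (f (!s) + 1) (f (!s) + 2) (E.lo (!s) (.guard (!s) i))
      have : (0 : ℝ) < ((g : ℝ) + 1) ^ 2 := by positivity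
      nlinarith
    · rw [E.own_eq (!s), E.guard_part_of_le_lo i h, zero_add]
      exact E.wall_part_le (!s) i _

/-- The lying agent gets all units. -/
theorem lie_units (E : GadgetDivision f g (some s) D n) :
    E.lo s (.liar s) < f s + 4 ∧ f s + 5 + 2 * g < E.hi s (.liar s) := by
  obtain ⟨hg, hf, hD, hh⟩ := E.layout s
  obtain ⟨hg', hf', hD', hh'⟩ := E.layout (!s)
  have hlt := E.lt s (.liar s)
  have hown : E.own (.liar s) = E.part s (.liar s) (.liar s) := by
    rw [E.own_eq s, E.lt_hi_not_lie.2, add_zero]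
  obtain ⟨h1, h2⟩ := E.liar_not_tip
  -- Below `1 / 2` the guards are pulled away from the walls; from `1 / 2` on, the report itself
  -- envies the truthful liar.
  rcases lt_or_ge (E.hi (!s) (.liar (!s))) (1 / 2) with hq | hq
  · have hguard : ∀ i, homeStart (f s) g < E.hi s (.guard (!s) i) := by
      intro i
      have h3 := E.guard_on_line hq i
      have h4 := E.hi_eq s (.guard (!s) i)
      linarith
    obtain ⟨j, h3, h4⟩ := E.cover s (f s + 3) (by linarith) (by linarith)
    rcases E.eq_liar_or_guard h3 h4 with rfl | ⟨h5, h6, i, rfl⟩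
    · refine ⟨by linarith, ?_⟩
      by_contra h5
      obtain ⟨j, hj⟩ := (E.side s).exists_start_eq_hi (j := .liar s) (by linarith)
      have hltj := E.lt s j
      have hne : j ≠ .liar s := by rintro rfl; linarith
      have hle : E.own (.liar s) ≤ 1 := by
        rw [hown, E.part_lie, lieCum, lieCum, ramp_of_le (a := f s + 5 + 2 * g) (y := E.hi _ _)
          (by linarith) (by linarith), ramp_of_le (a := f s + 5 + 2 * g) (y := E.lo _ _)
          (by linarith) (by linarith)]
        linarith [ramp_le_one (f s + 3) (f s + 4) (E.hi s (.liar s)),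
          ramp_nonneg (f s + 3) (f s + 4) (E.lo s (.liar s))]
      -- The next piece is worthless to its owner if it ends before the homes. Otherwise it contains
      -- the second spot, and `51/50` exceeds the lying agent's value.
      rcases lt_or_ge (E.hi s j) (homeStart (f s) g) with h6 | h6
      · have h7 := E.lt_hi_of_part_eq_zero (E.part_eq_zero_of_mem hne (fun i hi => by
          subst hi
          linarith [hguard i]) (by linarith) h6.le)
        linarith
      · have h7 := E.part_le_own s (.liar s) j
        rw [E.part_lie, lieCum, lieCum, hj, ramp_of_ge (y := E.hi s j) (by linarith) (by linarith),
          ramp_of_ge (y := E.hi s j) (by linarith) (by linarith),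
          ramp_of_le (a := f s + 5 + 2 * g) (by linarith) (by linarith)] at h7
        linarith [ramp_le_one (f s + 3) (f s + 4) (E.hi s (.liar s))]
    · linarith [hguard i]
  -- The report values the truthful liar's piece at `9/10 + 3/20 = 21/20`, more than either single
  -- spot.
  · have h3 := E.part_le_own (!s) (.liar s) (.liar (!s))
    rw [hown, E.part_lie_not, lieAwayCum, lieAwayCum, h1,
      ramp_of_ge (y := E.hi _ _) (by norm_num) (by linarith), ramp_of_ge (by norm_num) hq,
      ramp_of_le (y := 0) (by norm_num) (by norm_num),
      ramp_of_le (y := 0) (by norm_num) (by norm_num), E.part_lie, lieCum, lieCum] at h3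
    have r1 := ramp_le_one (f s + 3) (f s + 4) (E.hi s (.liar s))
    have r2 := ramp_le_one (f s + 5 + 2 * g) (f s + 6 + 2 * g) (E.hi s (.liar s))
    have r3 := ramp_nonneg (f s + 3) (f s + 4) (E.lo s (.liar s))
    have r4 := ramp_nonneg (f s + 5 + 2 * g) (f s + 6 + 2 * g) (E.lo s (.liar s))
    constructor
    · by_contra h4
      rw [ramp_of_ge (a := f s + 3) (y := E.lo _ _) (by linarith) (by linarith)] at h3
      linarith
    · by_contra h4
      rw [ramp_of_le (a := f s + 5 + 2 * g) (y := E.hi _ _) (by linarith) (by linarith)] at h3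
      linarith

end GadgetDivision

/-! ### Realising cumulative valuations by densities. -/

theorem IsPiecewiseConstant.of_fintype {κ : Type*} [Fintype κ] {d : ℝ → ℝ} (X : κ → Set ℝ)
    (h1 : ∀ t, (X t).OrdConnected) (h2 : Pairwise fun s t => Disjoint (X s) (X t))
    (h3 : ⋃ t, X t = Set.Icc 0 1) (h4 : ∀ t, ∃ c : ℝ, ∀ x ∈ X t, d x = c) :
    IsPiecewiseConstant d := by
  refine ⟨Fintype.card κ, X ∘ (Fintype.equivFin κ).symm, fun t => h1 _, fun s t hst => h2 ?_, ?_,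
    fun t => h4 _⟩
  · exact (Fintype.equivFin κ).symm.injective.ne hst
  · rw [← h3]
    exact (Fintype.equivFin κ).symm.surjective.iUnion_comp X

theorem IsPiecewiseConstant.add {d e : ℝ → ℝ} (hd : IsPiecewiseConstant d)
    (he : IsPiecewiseConstant e) : IsPiecewiseConstant (d + e) := by
  obtain ⟨m, X, hX1, hX2, hX3, hX4⟩ := hd
  obtain ⟨k, Y, hY1, hY2, hY3, hY4⟩ := he
  refine .of_fintype (fun p : Fin m × Fin k => X p.1 ∩ Y p.2) (fun p => (hX1 _).inter (hY1 _)) ?_ ?_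
    fun p => ?_
  · rintro ⟨s, t⟩ ⟨s', t'⟩ hne
    by_cases h : s = s'
    · subst h
      have : t ≠ t' := fun h => hne (by rw [h])
      exact (hY2 this).mono Set.inter_subset_right Set.inter_subset_right
    · exact (hX2 h).mono Set.inter_subset_left Set.inter_subset_left
  · ext x
    rw [Set.mem_iUnion]
    constructor
    · rintro ⟨p, hp⟩
      rw [← hX3]
      exact Set.mem_iUnion.2 ⟨p.1, hp.1⟩
    · intro hx
      have h1 : x ∈ ⋃ t, X t := by rw [hX3]; exact hx
      have h2 : x ∈ ⋃ t, Y t := by rw [hY3]; exact hx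
      obtain ⟨s, hs⟩ := Set.mem_iUnion.1 h1
      obtain ⟨t, ht⟩ := Set.mem_iUnion.1 h2
      exact ⟨(s, t), hs, ht⟩
  · obtain ⟨a, ha⟩ := hX4 p.1
    obtain ⟨b, hb⟩ := hY4 p.2
    exact ⟨a + b, fun x hx => by rw [Pi.add_apply, ha x hx.1, hb x hx.2]⟩

theorem isPiecewiseConstant_const (c : ℝ) : IsPiecewiseConstant fun _ => c :=
  .of_fintype (fun _ : Unit => Set.Icc 0 1) (fun _ => Set.ordConnected_Icc)
    (fun _ _ h => absurd (Subsingleton.elim _ _) h) (Set.iUnion_const _) fun _ => ⟨c, fun _ _ => rfl⟩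

theorem isPiecewiseConstant_indicator {p q : ℝ} (c : ℝ) (h0 : 0 ≤ p) (hpq : p ≤ q) (h1 : q ≤ 1) :
    IsPiecewiseConstant ((Set.Icc p q).indicator fun _ => c) := by
  refine .of_fintype (fun t : Option Bool => match t with
    | none => Set.Icc p q
    | some false => Set.Ico 0 p
    | some true => Set.Ioc q 1) ?_ ?_ ?_ ?_
  · rintro (_ | _ | _)
    exacts [Set.ordConnected_Icc, Set.ordConnected_Ico, Set.ordConnected_Ioc]
  · rintro (_ | _ | _) (_ | _ | _) h <;> first | exact absurd rfl h | skip
    all_goals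
      refine Set.disjoint_left.2 fun x hx hx' => ?_
      have h1 := hx.1
      have h2 := hx.2
      have h3 := hx'.1
      have h4 := hx'.2
      linarith
  · ext x
    rw [Set.mem_iUnion]
    constructor
    · rintro ⟨_ | _ | _, h2, h3⟩
      exacts [⟨h0.trans h2, h3.trans h1⟩, ⟨h2, (h3.le.trans hpq).trans h1⟩,
        ⟨(h0.trans hpq).trans h2.le, h3⟩]
    · rintro ⟨h2, h3⟩
      rcases lt_or_ge x p with h4 | h4
      · exact ⟨some false, h2, h4⟩
      rcases lt_or_ge q x with h5 | h5
      · exact ⟨some true, h5, h3⟩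
      · exact ⟨none, h4, h5⟩
  · rintro (_ | _ | _)
    · exact ⟨c, fun x hx => Set.indicator_of_mem hx _⟩
    · exact ⟨0, fun x hx => Set.indicator_of_notMem (fun h => not_le.2 hx.2 h.1) _⟩
    · exact ⟨0, fun x hx => Set.indicator_of_notMem (fun h => not_le.2 hx.1 h.2) _⟩

theorem IsPiecewiseConstant.const_mul {d : ℝ → ℝ} (hd : IsPiecewiseConstant d) (c : ℝ) :
    IsPiecewiseConstant fun x => c * d x := by
  obtain ⟨m, X, hX1, hX2, hX3, hX4⟩ := hd
  refine ⟨m, X, hX1, hX2, hX3, fun t => ?_⟩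
  obtain ⟨a, ha⟩ := hX4 t
  exact ⟨c * a, fun x hx => congrArg (c * ·) (ha x hx)⟩

/-- Distance of the nearer end of `[u, v]` from the left (`false`) or right (`true`) end of the
cake, rescaled to length `2 * D`. -/
def sideLo (D : ℝ) : Bool → ℝ → ℝ → ℝ
  | false, u, _ => 2 * D * u
  | true, _, v => 2 * D * (1 - v)

/-- Distance of the farther end of `[u, v]` from the left (`false`) or right (`true`) end of the
cake, rescaled to length `2 * D`. -/
def sideHi (D : ℝ) : Bool → ℝ → ℝ → ℝ
  | false, _, v => 2 * D * v
  | true, u, _ => 2 * D * (1 - u)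

/-- The function `d` has all properties of a density but a positive total value, and `Ψ` describes
its integrals from both cake ends. -/
structure HasCum (D : ℝ) (Ψ : Bool → ℝ → ℝ) (d : ℝ → ℝ) : Prop where
  nonneg : ∀ x, 0 ≤ d x
  eq_zero_outside : ∀ x, x ∉ Set.Icc (0 : ℝ) 1 → d x = 0
  piecewiseConstant : IsPiecewiseConstant d
  integrableOn : IntegrableOn d (Set.Icc 0 1)
  integral_eq : ∀ u v, 0 ≤ u → u ≤ v → v ≤ 1 →
    ∫ x in Set.Icc u v, d x = ∑ t, (Ψ t (sideHi D t u v) - Ψ t (sideLo D t u v))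

/-- `Ψ` describes, from both cake ends, the integrals of some piecewise constant function. -/
def Representable (D : ℝ) (Ψ : Bool → ℝ → ℝ) : Prop := ∃ d, HasCum D Ψ d

namespace Representable

variable {D : ℝ} {Ψ Ψ' : Bool → ℝ → ℝ}

theorem zero (D : ℝ) : Representable D 0 :=
  ⟨fun _ => 0, fun _ => le_rfl, fun _ _ => rfl, isPiecewiseConstant_const 0, integrableOn_zero,
    fun u v _ _ _ => by simp⟩

theorem add (h : Representable D Ψ) (h' : Representable D Ψ') : Representable D (Ψ + Ψ') := by
  obtain ⟨d, hd⟩ := h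
  obtain ⟨e, he⟩ := h'
  refine ⟨d + e, fun x => add_nonneg (hd.nonneg x) (he.nonneg x), fun x hx => ?_,
    hd.piecewiseConstant.add he.piecewiseConstant, hd.integrableOn.add he.integrableOn,
    fun u v h0 h1 h2 => ?_⟩
  · rw [Pi.add_apply, hd.eq_zero_outside x hx, he.eq_zero_outside x hx, add_zero]
  · have hsub : Set.Icc u v ⊆ Set.Icc 0 1 := Set.Icc_subset_Icc h0 h2
    simp only [Pi.add_apply]
    rw [integral_add (hd.integrableOn.mono_set hsub) (he.integrableOn.mono_set hsub),
      hd.integral_eq u v h0 h1 h2, he.integral_eq u v h0 h1 h2, ← Finset.sum_add_distrib]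
    exact Finset.sum_congr rfl fun t _ => by ring

theorem const_mul (h : Representable D Ψ) {c : ℝ} (hc : 0 ≤ c) :
    Representable D fun t y => c * Ψ t y := by
  obtain ⟨d, hd⟩ := h
  refine ⟨fun x => c * d x, fun x => mul_nonneg hc (hd.nonneg x), fun x hx => ?_,
    hd.piecewiseConstant.const_mul c, hd.integrableOn.const_mul c, fun u v h0 h1 h2 => ?_⟩
  · rw [hd.eq_zero_outside x hx, mul_zero]
  · rw [integral_const_mul, hd.integral_eq u v h0 h1 h2, Finset.mul_sum]
    exact Finset.sum_congr rfl fun t _ => by ring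

end Representable

/-- The numerator is the length of the overlap of `[u, v]` and `[a, b]`, the form in which the
integral of an indicator appears. -/
theorem ramp_sub_ramp {a b u v : ℝ} (h : a < b) (huv : u ≤ v) :
    ramp a b v - ramp a b u = max (min v b - max u a) 0 / (b - a) := by
  have hb : (0 : ℝ) < b - a := by linarith
  rw [eq_div_iff hb.ne', sub_mul]
  have key : ∀ y, ramp a b y * (b - a) = max a (min y b) - a := by
    intro y
    rcases le_total y a with h1 | h1
    · rw [ramp_of_le h h1, min_eq_left (h1.trans h.le), max_eq_left h1]; ring
    rcases le_total y b with h2 | h2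
    · rw [ramp_of_mem h h1 h2, min_eq_left h2, max_eq_right h1, div_mul_cancel₀ _ hb.ne']
    · rw [ramp_of_ge h h2, min_eq_right h2, max_eq_right h.le]; ring
  rw [key, key]
  rcases le_total v a with h1 | h1
  · rw [min_eq_left (h1.trans h.le), max_eq_left h1, min_eq_left (by linarith),
      max_eq_left (b := u) (by linarith), max_eq_right (by linarith [le_max_right u a])]
    ring
  rcases le_total u b with h2 | h2
  · rw [max_eq_right (le_min h1 h.le), min_eq_left h2, max_comm a u,
      max_eq_left (sub_nonneg.2 (max_le (le_min huv h2) (le_min h1 h.le)))]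
    ring
  · rw [min_eq_right (h2.trans huv), min_eq_right h2, max_eq_left (a := u) (by linarith),
      max_eq_right (a := b - u) (by linarith)]
    ring

theorem ramp_reflect {a b : ℝ} (h : a < b) (c y : ℝ) :
    ramp a b (c - y) = 1 - ramp (c - b) (c - a) y := by
  have hb : (0 : ℝ) < b - a := by linarith
  rcases le_total (c - y) a with h1 | h1
  · rw [ramp_of_le h h1, ramp_of_ge (by linarith) (by linarith), sub_self]
  rcases le_total (c - y) b with h2 | h2
  · rw [ramp_of_mem h h1 h2, ramp_of_mem (by linarith) (by linarith) (by linarith)]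
    have h3 : c - a - (c - b) = b - a := by ring
    rw [h3]
    field_simp
    ring
  · rw [ramp_of_ge h h2, ramp_of_le (by linarith) (by linarith), sub_zero]

theorem hasCum_ramp_false {D a b : ℝ} (h0 : 0 ≤ a) (h : a < b) (h1 : b ≤ 2 * D) :
    HasCum D (Pi.single false (ramp a b)) ((Set.Icc (a / (2 * D)) (b / (2 * D))).indicator
      fun _ => 2 * D / (b - a)) := by
  have hD : 0 < 2 * D := by linarith
  have hb : 0 < b - a := by linarith
  have hc : 0 ≤ 2 * D / (b - a) := by positivity
  have ha' : 0 ≤ a / (2 * D) := by positivity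
  have hb' : b / (2 * D) ≤ 1 := (div_le_one hD).2 h1
  have hab : a / (2 * D) ≤ b / (2 * D) := by gcongr
  refine ⟨fun x => Set.indicator_nonneg (fun _ _ => hc) x, fun x hx => ?_,
    isPiecewiseConstant_indicator _ ha' hab hb', ?_, fun u v hu huv hv => ?_⟩
  · exact Set.indicator_of_notMem (fun hx' => hx ⟨ha'.trans hx'.1, hx'.2.trans hb'⟩) _
  · exact (integrableOn_const (by simp)).indicator measurableSet_Icc
  · rw [setIntegral_indicator measurableSet_Icc, Set.Icc_inter_Icc, setIntegral_const,
      Real.volume_real_Icc]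
    simp only [Fintype.sum_bool, Pi.single_eq_same, sideHi, sideLo, ne_eq, Bool.true_eq_false,
      not_false_eq_true, Pi.single_eq_of_ne, Pi.zero_apply, sub_self, zero_add, smul_eq_mul]
    rw [ramp_sub_ramp h (by gcongr)]
    have e1 : min (2 * D * v) b = 2 * D * min v (b / (2 * D)) := by
      rw [mul_min_of_nonneg _ _ hD.le, mul_div_cancel₀ _ hD.ne']
    have e2 : max (2 * D * u) a = 2 * D * max u (a / (2 * D)) := by
      rw [mul_max_of_nonneg _ _ hD.le, mul_div_cancel₀ _ hD.ne']
    rw [e1, e2, ← mul_sub]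
    conv_rhs => rw [← mul_zero (2 * D), ← mul_max_of_nonneg _ _ hD.le]
    ring

theorem representable_ramp {D a b : ℝ} (h0 : 0 ≤ a) (h : a < b) (h1 : b ≤ 2 * D) (s : Bool) :
    Representable D (Pi.single s (ramp a b)) := by
  cases s
  · exact ⟨_, hasCum_ramp_false h0 h h1⟩
  · have hc := hasCum_ramp_false (D := D) (a := 2 * D - b) (b := 2 * D - a) (by linarith)
      (by linarith) (by linarith)
    refine ⟨_, hc.nonneg, hc.eq_zero_outside, hc.piecewiseConstant, hc.integrableOn,
      fun u v hu huv hv => ?_⟩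
    rw [hc.integral_eq u v hu huv hv]
    simp only [Fintype.sum_bool, Pi.single_eq_same, sideHi, sideLo, ne_eq, Bool.true_eq_false,
      Bool.false_eq_true, not_false_eq_true, Pi.single_eq_of_ne, Pi.zero_apply, sub_self, zero_add,
      add_zero]
    have e : ∀ x, 2 * D * (1 - x) = 2 * D - 2 * D * x := fun x => by ring
    rw [e, e, ramp_reflect h, ramp_reflect h]
    ring

namespace Representable

variable {D : ℝ} {s : Bool} {φ ψ : ℝ → ℝ}

theorem single_add (h : Representable D (Pi.single s φ)) (h' : Representable D (Pi.single s ψ)) :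
    Representable D (Pi.single s fun y => φ y + ψ y) := by
  have : (Pi.single s fun y => φ y + ψ y : Bool → ℝ → ℝ) = Pi.single s φ + Pi.single s ψ :=
    Pi.single_add (f := fun _ : Bool => ℝ → ℝ) s φ ψ
  rw [this]
  exact h.add h'

theorem single_const_mul (h : Representable D (Pi.single s φ)) {c : ℝ} (hc : 0 ≤ c) :
    Representable D (Pi.single s fun y => c * φ y) := by
  have : (Pi.single s fun y => c * φ y : Bool → ℝ → ℝ) =
      fun t y => c * (Pi.single s φ : Bool → ℝ → ℝ) t y := by
    funext t y
    by_cases ht : t = s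
    · subst ht; simp
    · simp [Pi.single_eq_of_ne ht]
  rw [this]
  exact h.const_mul hc

theorem single_sum {m : ℕ} {χ : ℕ → ℝ → ℝ}
    (h : ∀ j < m, Representable D (Pi.single s (χ j))) :
    Representable D (Pi.single s fun y => ∑ j ∈ Finset.range m, χ j y) := by
  induction m with
  | zero =>
    have : (Pi.single s fun y => ∑ j ∈ Finset.range 0, χ j y : Bool → ℝ → ℝ) = 0 :=
      Pi.single_zero s
    rw [this]
    exact zero D
  | succ m ih =>
    simp only [Finset.sum_range_succ]
    exact (ih fun j hj => h j (by omega)).single_add (h m (by omega))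

end Representable

/-- Every valuation is a nonnegative combination of one-sided ramps within the cake. -/
theorem representable_cum {f : Bool → ℕ} {g : ℕ} {D : ℝ}
    (hD : ∀ s, homeStart (f s) g + f s ≤ D) (o : Option Bool) (a : Agent f g) :
    Representable D fun t => cum f g o t a := by
  have hf : ∀ s, (0 : ℝ) ≤ f s := fun s => Nat.cast_nonneg _
  have hg : (0 : ℝ) ≤ g := Nat.cast_nonneg g
  unfold homeStart at hD
  have key : ∀ (s : Bool) (φ ψ : ℝ → ℝ), Representable D (Pi.single s φ) →
      Representable D (Pi.single (!s) ψ) → Representable D fun t => if t = s then φ else ψ := by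
    intro s φ ψ h1 h2
    have : (fun t => if t = s then φ else ψ) = Pi.single s φ + Pi.single (!s) ψ := by
      funext t
      cases t <;> cases s <;> simp
    rw [this]
    exact h1.add h2
  have hzero : ∀ s : Bool, Representable D (Pi.single s (0 : ℝ → ℝ)) := by
    intro s
    rw [Pi.single_zero]
    exact Representable.zero D
  cases a with
  | liar s =>
    have := hf s
    have := hD s
    refine key s _ _ ?_ ?_
    · split_ifs
      · exact (representable_ramp (by linarith) (by linarith) (by linarith) s).single_add
          ((representable_ramp (by linarith) (by linarith) (by linarith) s).single_const_mul
            (by norm_num))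
      · refine Representable.single_add ((representable_ramp (by linarith) (by linarith)
          (by linarith) s).single_const_mul (by norm_num)) (Representable.single_sum fun j hj => ?_)
        have hj : (j : ℝ) ≤ g := by exact_mod_cast Nat.lt_succ_iff.1 hj
        have hj0 : (0 : ℝ) ≤ j := Nat.cast_nonneg j
        exact representable_ramp (by linarith) (by linarith) (by linarith) s
    · split_ifs
      · exact ((representable_ramp (by linarith) (by linarith) (by linarith) _).single_const_mul
          (by norm_num)).single_add ((representable_ramp (by linarith) (by linarith)
            (by linarith) _).single_const_mul (by norm_num))
      · exact hzero _
  | guard s i =>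
    have h := key s (guardCum (f s) g) (wallCum (f !s) g i) ?_ ?_
    rotate_left
    · have := hf s
      have := hD s
      refine Representable.single_add (Representable.single_sum fun j hj => ?_)
        ((representable_ramp (by linarith) (by linarith) (by linarith) s).single_const_mul
          (by positivity))
      have hj : (j : ℝ) + 1 ≤ f s := by exact_mod_cast hj
      have hj0 : (0 : ℝ) ≤ j := Nat.cast_nonneg j
      exact ((representable_ramp (by linarith) (by linarith) (by linarith) s).single_const_mul
        (headMass_nonneg _ _)).single_add ((representable_ramp (by linarith) (by linarith)
          (by linarith) s).single_const_mul (tailMass_nonneg _ _))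
    · have := hf !s
      have := hD !s
      have hi : ((i : ℕ) : ℝ) + 1 ≤ g := by exact_mod_cast i.2
      have hi0 : (0 : ℝ) ≤ (i : ℕ) := Nat.cast_nonneg _
      exact (representable_ramp (by linarith) (by linarith) (by linarith) _).single_const_mul
        (by positivity)
    · have e : (fun t => cum f g o t (.guard s i)) =
          fun t => if t = s then guardCum (f s) g else wallCum (f !s) g i := by
        funext t
        simp only [cum]
        split_ifs with h1
        · rfl
        · rw [show t = !s by cases t <;> cases s <;> simp_all]
      rw [e]
      exact h
  | filler s i =>
    have := hf s
    have := hD s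
    have hi : ((i : ℕ) : ℝ) + 1 ≤ f s := by exact_mod_cast i.2
    have hi0 : (0 : ℝ) ≤ (i : ℕ) := Nat.cast_nonneg _
    refine key s _ _ ?_ (hzero _)
    refine Representable.single_add ((representable_ramp le_rfl (by linarith)
      (by linarith) s).single_const_mul (by positivity)) ?_
    unfold homeStart
    exact representable_ramp (by linarith) (by linarith) (by linarith) s

theorem cum_zero (f : Bool → ℕ) (g : ℕ) (o : Option Bool) (t : Bool) (a : Agent f g) :
    cum f g o t a 0 = 0 := by
  have hf : ∀ s, (0 : ℝ) ≤ f s := fun s => Nat.cast_nonneg _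
  have hg : (0 : ℝ) ≤ g := Nat.cast_nonneg g
  cases a with
  | liar s =>
    have := hf s
    simp only [cum]
    split_ifs
    · rw [lieCum, ramp_of_le (by linarith) (by linarith), ramp_of_le (by linarith) (by linarith)]
      ring
    · rw [liarCum_of_le (by linarith), ramp_of_le (by norm_num) (by norm_num), mul_zero]
    · rw [lieAwayCum, ramp_of_le (by norm_num) (by norm_num),
        ramp_of_le (by norm_num) (by norm_num)]
      ring
    · rfl
  | guard s i =>
    simp only [cum]
    split_ifs
    · have := hf s
      have h := guardLine_natCast (f := f s) (t := 0) (g + 1) (Nat.zero_le _)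
      push_cast at h
      rw [guardCum, h, ramp_of_le (by linarith) (by linarith)]
      ring
    · have := hf t
      have hi0 : (0 : ℝ) ≤ (i : ℕ) := Nat.cast_nonneg _
      rw [wallCum, ramp_of_le (by linarith) (by linarith), mul_zero]
  | filler s i =>
    simp only [cum]
    split_ifs
    · have := hf s
      have hi0 : (0 : ℝ) ≤ (i : ℕ) := Nat.cast_nonneg _
      rw [fillerCum, homeStart, ramp_of_le (by linarith) le_rfl,
        ramp_of_le (by linarith) (by linarith)]
      ring
    · rfl

/-- The densities of the construction. -/
theorem GadgetParams.exists_density {f : Bool → ℕ} {g : ℕ} {D : ℝ} {n : ℕ}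
    (E : GadgetParams f g D n) (o : Option Bool) (a : Agent f g) :
    ∃ d : Density, ∀ u v, 0 ≤ u → u ≤ v → v ≤ 1 → value d (Set.Icc u v) =
      ∑ t, (cum f g o t a (sideHi D t u v) - cum f g o t a (sideLo D t u v)) := by
  obtain ⟨d, hd⟩ := representable_cum E.home_le o a
  refine ⟨⟨d, hd.nonneg, hd.eq_zero_outside, hd.piecewiseConstant, ?_⟩, hd.integral_eq⟩
  rw [hd.integral_eq 0 1 le_rfl zero_le_one le_rfl]
  refine lt_of_lt_of_eq (E.total_pos (o := o) a) (Finset.sum_congr rfl fun t _ => ?_)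
  have h1 : sideHi D t 0 1 = 2 * D := by cases t <;> simp [sideHi]
  have h2 : sideLo D t 0 1 = 0 := by cases t <;> simp [sideLo]
  obtain ⟨-, -, h3, -⟩ := E.layout t
  have h4 : (0 : ℝ) ≤ D := by
    have : (0 : ℝ) ≤ f t := Nat.cast_nonneg _
    have : (0 : ℝ) ≤ g := Nat.cast_nonneg g
    linarith
  rw [h1, h2, cum_zero, sub_zero, cum_of_ge (E.home_le t) o a (by linarith : D ≤ 2 * D)]

/-! ### From connected allocations to tilings. -/

theorem IsBundle.isCompact {S : Set ℝ} (h : IsBundle S) : IsCompact S := by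
  obtain ⟨m, a, b, -, rfl⟩ := h
  exact isCompact_iUnion fun t => isCompact_Icc

/-- A connected bundle with a positive value is an interval of positive length. -/
theorem IsBundle.exists_eq_Icc {S : Set ℝ} (h : IsBundle S) (hc : IsPreconnected S) {d : Density}
    (hd : 0 < value d S) : ∃ p q, 0 ≤ p ∧ p < q ∧ q ≤ 1 ∧ S = Set.Icc p q := by
  have hne : S.Nonempty := by
    by_contra hne
    rw [Set.not_nonempty_iff_eq_empty] at hne
    rw [hne, value, setIntegral_empty] at hd
    exact lt_irrefl _ hd
  have hS := eq_Icc_of_connected_compact ⟨hne, hc⟩ h.isCompact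
  have hlt : sInf S < sSup S := by
    by_contra hcon
    rw [hS, value, setIntegral_measure_zero _ (by
      rw [Real.volume_Icc, ENNReal.ofReal_eq_zero]; linarith)] at hd
    exact lt_irrefl _ hd
  refine ⟨sInf S, sSup S, ?_, hlt, ?_, hS⟩
  · exact (h.subset (h.isCompact.sInf_mem hne)).1
  · exact (h.subset (h.isCompact.sSup_mem hne)).2

theorem value_Icc_add (d : Density) {u v w : ℝ} (huv : u ≤ v) (hvw : v ≤ w) (hu : 0 ≤ u)
    (hw : w ≤ 1) : value d (Set.Icc u w) = value d (Set.Icc u v) + value d (Set.Icc v w) := by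
  unfold value
  rw [integral_Icc_eq_integral_Ioc (x := v), ← Set.Icc_union_Ioc_eq_Icc huv hvw]
  refine setIntegral_union ?_ measurableSet_Ioc ?_ ?_
  · exact Set.disjoint_left.2 fun x hx hx' => not_lt.2 hx.2 hx'.1
  · exact d.integrableOn.mono_set (Set.Icc_subset_Icc hu (hvw.trans hw))
  · exact d.integrableOn.mono_set ((Set.Ioc_subset_Icc_self).trans
      (Set.Icc_subset_Icc (hu.trans huv) hw))

/-- A gap between the pieces of an allocation has no value. -/
theorem IsAllocation.value_gap {n : ℕ} {F : Profile n} {A : Fin n → Set ℝ} (hA : IsAllocation F A)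
    {u v : ℝ} (hu : 0 ≤ u) (hv : v ≤ 1) (hgap : ∀ j, Disjoint (Set.Ioo u v) (A j)) (i : Fin n) :
    value (F i) (Set.Icc u v) = 0 := by
  refine le_antisymm ?_ (value_nonneg _ _)
  rw [← hA.exhaustive i]
  unfold value
  rw [integral_Icc_eq_integral_Ioo]
  refine setIntegral_mono_set ((F i).integrableOn.mono_set Set.sdiff_subset)
    (Filter.Eventually.of_forall (F i).nonneg) (Filter.Eventually.of_forall fun x hx => ?_)
  refine ⟨⟨hu.trans hx.1.le, hx.2.le.trans hv⟩, fun hx' => ?_⟩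
  obtain ⟨j, hj⟩ := Set.mem_iUnion.1 hx'
  exact Set.disjoint_left.1 (hgap j) hx hj

/-- The pieces of an allocation into connected pieces can be extended to a tiling of the cake by
parts that are worthless for all. -/
theorem IsAllocation.exists_tiling {n : ℕ} (hn : 0 < n) {F : Profile n} {A : Fin n → Set ℝ}
    (hA : IsAllocation F A) (hc : ∀ j, IsPreconnected (A j))
    (hpos : ∀ j, 0 < value (F j) (A j)) :
    ∃ p q L R : Fin n → ℝ, (∀ j, A j = Set.Icc (p j) (q j)) ∧
      (∀ j, 0 ≤ L j ∧ L j ≤ p j ∧ p j < q j ∧ q j ≤ R j ∧ R j ≤ 1) ∧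
      (∀ i j, i ≠ j → R i ≤ L j ∨ R j ≤ L i) ∧
      (∀ y, 0 ≤ y → y < 1 → ∃ j, L j ≤ y ∧ y < R j) ∧
      ∀ i j, value (F i) (Set.Icc (L j) (R j)) = value (F i) (A j) := by
  classical
  choose p q hp hpq hq hApq using fun j => (hA.bundle j).exists_eq_Icc (hc j) (hpos j)
  have hdisj : ∀ i j, i ≠ j → q i ≤ p j ∨ q j ≤ p i := by
    intro i j hij
    have h := hA.overlap_null i j hij
    rw [hApq, hApq, Set.Icc_inter_Icc, Real.volume_Icc, ENNReal.ofReal_eq_zero] at h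
    by_contra hcon
    push Not at hcon
    have h1 : max (p i) (p j) < min (q i) (q j) :=
      max_lt (lt_min (hpq i) hcon.2) (lt_min hcon.1 (hpq j))
    linarith
  have hne : ∀ i, (insert (0 : ℝ) ((Finset.univ.filter fun j => q j ≤ p i).image q)).Nonempty :=
    fun i => Finset.insert_nonempty _ _
  -- Each piece absorbs the gap to its left, back to the last earlier end or to `0`; only the last
  -- piece also grows to the right.
  set L : Fin n → ℝ := fun i =>
    (insert (0 : ℝ) ((Finset.univ.filter fun j => q j ≤ p i).image q)).max' (hne i) with hL
  set R : Fin n → ℝ := fun i => if ∃ j, q i ≤ p j then q i else 1 with hR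
  have hL0 : ∀ i, 0 ≤ L i := fun i => Finset.le_max' _ _ (Finset.mem_insert_self _ _)
  have hLp : ∀ i, L i ≤ p i := by
    intro i
    refine Finset.max'_le _ _ _ fun y hy => ?_
    rcases Finset.mem_insert.1 hy with rfl | hy
    · exact hp i
    · obtain ⟨j, hj, rfl⟩ := Finset.mem_image.1 hy
      exact (Finset.mem_filter.1 hj).2
  have hqL : ∀ i j, q j ≤ p i → q j ≤ L i := fun i j h => Finset.le_max' _ _
    (Finset.mem_insert_of_mem (Finset.mem_image_of_mem q
      (Finset.mem_filter.2 ⟨Finset.mem_univ j, h⟩)))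
  have hqR : ∀ i, q i ≤ R i := by
    intro i
    simp only [hR]
    split_ifs
    exacts [le_rfl, hq i]
  have hR1 : ∀ i, R i ≤ 1 := by
    intro i
    simp only [hR]
    split_ifs
    exacts [hq i, le_rfl]
  have hRq : ∀ i j, q i ≤ p j → R i = q i := fun i j h => if_pos ⟨j, h⟩
  refine ⟨p, q, L, R, hApq, fun j => ⟨hL0 j, hLp j, hpq j, hqR j, hR1 j⟩, fun i j hij => ?_, ?_, ?_⟩
  · rcases hdisj i j hij with h | h
    · left
      rw [hRq i j h]
      exact hqL j i h
    · right
      rw [hRq j i h]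
      exact hqL i j h
  · intro y hy0 hy1
    by_cases hex : ∃ j, y < R j
    -- Among the tiles ending after `y`, the one ending first contains `y`.
    · obtain ⟨j, hj, hmin⟩ := Finset.exists_min_image (Finset.univ.filter fun j => y < R j) R
        (by obtain ⟨j, hj⟩ := hex; exact ⟨j, Finset.mem_filter.2 ⟨Finset.mem_univ _, hj⟩⟩)
      refine ⟨j, ?_, (Finset.mem_filter.1 hj).2⟩
      refine Finset.max'_le _ _ _ fun z hz => ?_
      rcases Finset.mem_insert.1 hz with rfl | hz
      · exact hy0
      · obtain ⟨k, hk, rfl⟩ := Finset.mem_image.1 hz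
        have hk := (Finset.mem_filter.1 hk).2
        by_contra hcon
        have h1 := hmin k (Finset.mem_filter.2 ⟨Finset.mem_univ _, by
          rw [hRq k j hk]; exact not_le.1 hcon⟩)
        rw [hRq k j hk] at h1
        linarith [hqR j, hpq j]
    · exfalso
      push Not at hex
      obtain ⟨j, -, hmax⟩ := Finset.exists_max_image Finset.univ q ⟨⟨0, hn⟩, Finset.mem_univ _⟩
      have h1 : R j = 1 := if_neg (by
        rintro ⟨k, hk⟩
        linarith [hmax k (Finset.mem_univ _), hpq k])
      linarith [hex j]
  · intro i j
    have h1 : value (F i) (Set.Icc (L j) (p j)) = 0 := by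
      refine hA.value_gap (hL0 j) ((hpq j).le.trans (hq j)) (fun k => ?_) i
      rw [hApq, Set.disjoint_left]
      rintro x ⟨h1, h2⟩ ⟨h3, h4⟩
      by_cases hkj : k = j
      · subst hkj; linarith
      rcases hdisj k j hkj with h5 | h5
      · linarith [hqL j k h5]
      · linarith [hpq j]
    have h2 : value (F i) (Set.Icc (q j) (R j)) = 0 := by
      refine hA.value_gap ((hp j).trans (hpq j).le) (hR1 j) (fun k => ?_) i
      rw [hApq, Set.disjoint_left]
      rintro x ⟨h1, h2⟩ ⟨h3, h4⟩
      by_cases hkj : k = j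
      · subst hkj; linarith
      rcases hdisj k j hkj with h5 | h5
      · linarith [hpq j]
      · rw [hRq j k h5] at h2
        linarith
    rw [hApq j, value_Icc_add _ (hLp j) ((hpq j).le.trans (hqR j)) (hL0 j) (hR1 j),
      value_Icc_add _ (hpq j).le (hqR j) (hp j) (hR1 j), h1, h2]
    ring

/-- A tiling covers the cake also by intervals which are open to the left. -/
theorem exists_mem_Ioc_of_tiling {ι : Type*} [Fintype ι] {L R : ι → ℝ} (hlt : ∀ j, L j < R j)
    (hdisj : ∀ i j, i ≠ j → R i ≤ L j ∨ R j ≤ L i)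
    (hcover : ∀ y, 0 ≤ y → y < 1 → ∃ j, L j ≤ y ∧ y < R j) (hnonneg : ∀ j, 0 ≤ L j) {x : ℝ}
    (hx0 : 0 < x) (hx1 : x ≤ 1) : ∃ j, L j < x ∧ x ≤ R j := by
  classical
  obtain ⟨i, hi, -⟩ := hcover 0 le_rfl zero_lt_one
  obtain ⟨j, hj, hmax⟩ := Finset.exists_max_image (Finset.univ.filter fun j => L j < x) L
    ⟨i, Finset.mem_filter.2 ⟨Finset.mem_univ _, hi.trans_lt hx0⟩⟩
  have hj := (Finset.mem_filter.1 hj).2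
  refine ⟨j, hj, ?_⟩
  by_contra hcon
  have hcon := not_le.1 hcon
  obtain ⟨k, hk1, hk2⟩ := hcover (R j) ((hnonneg j).trans (hlt j).le) (hcon.trans_le hx1)
  have h1 := hmax k (Finset.mem_filter.2 ⟨Finset.mem_univ _, hk1.trans_lt hcon⟩)
  have hne : j ≠ k := by rintro rfl; exact lt_irrefl _ hk2
  rcases hdisj j k hne with h | h <;> linarith [hlt j]

/-- An envy-free allocation of connected pieces among the agents of the construction, as a
division. -/
theorem exists_gadgetDivision {f : Bool → ℕ} {g n : ℕ} {o : Option Bool} {D : ℝ}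
    (G : GadgetParams f g D n) (e : Agent f g ≃ Fin n) {F : Profile n}
    (hF : ∀ a u v, 0 ≤ u → u ≤ v → v ≤ 1 → value (F (e a)) (Set.Icc u v) =
      ∑ t, (cum f g o t a (sideHi D t u v) - cum f g o t a (sideLo D t u v)))
    {A : Fin n → Set ℝ} (hA : IsAllocation F A) (hE : IsEnvyFreeAllocation F A)
    (hc : ∀ j, IsPreconnected (A j)) :
    ∃ (E : GadgetDivision f g o D n) (p q : Agent f g → ℝ), ∀ a,
      A (e a) = Set.Icc (p a) (q a) ∧ 0 ≤ p a ∧ p a ≤ q a ∧ q a ≤ 1 ∧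
      (∀ t, E.lo t a ≤ sideLo D t (p a) (q a) ∧ sideHi D t (p a) (q a) ≤ E.hi t a) ∧
      E.own a = value (F (e a)) (A (e a)) := by
  have hn : 0 < n := (e (.liar false)).pos
  have hD : 0 < 2 * D := by
    obtain ⟨h1, h2, h3, -⟩ := G.layout false
    have : (0 : ℝ) ≤ f false := Nat.cast_nonneg _
    linarith
  obtain ⟨p, q, L, R, hApq, hLR, hdisj, hcover, hval⟩ := hA.exists_tiling hn hc
    (fun j => pos_of_mul_pos_right (lt_of_lt_of_le (F j).total_pos (hE.total_le hA j))
      (Nat.cast_nonneg n))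
  have hL1 : ∀ j, L j < R j := fun j => by linarith [hLR j]
  have hsum : ∀ a b, ∑ t, (cum f g o t a (sideHi D t (L (e b)) (R (e b))) -
      cum f g o t a (sideLo D t (L (e b)) (R (e b)))) = value (F (e a)) (A (e b)) := by
    intro a b
    rw [← hF a _ _ (hLR _).1 (hL1 _).le (hLR _).2.2.2.2, hval]
  let E : GadgetDivision f g o D n :=
    { toGadgetParams := G
      lo := fun t a => sideLo D t (L (e a)) (R (e a))
      hi := fun t a => sideHi D t (L (e a)) (R (e a))
      lo_not := fun s j => by 
        cases s <;> simp only [sideLo, sideHi, Bool.not_true, Bool.not_false] <;> ring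
      lt := fun s j => by
        have := hL1 (e j)
        cases s <;> simp only [sideLo, sideHi] <;> gcongr
      nonneg := fun s j => by
        have := (hLR (e j)).1
        have := (hLR (e j)).2.2.2.2
        cases s <;> simp only [sideLo] <;> apply mul_nonneg hD.le <;> linarith
      disj := fun s i j hij => by
        have := hdisj _ _ (e.injective.ne hij)
        cases s <;> simp only [sideLo, sideHi, mul_le_mul_iff_right₀ hD, sub_le_sub_iff_left]
        · exact this
        · exact this.symm
      cover := fun s y h0 h1 => by
        have hy0 : 0 ≤ y / (2 * D) := div_nonneg h0 hD.le
        have hy1 : y / (2 * D) < 1 := (div_lt_one hD).2 h1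
        have hy : y = 2 * D * (y / (2 * D)) := (mul_div_cancel₀ _ hD.ne').symm
        cases s
        · obtain ⟨j, hj1, hj2⟩ := hcover _ hy0 hy1
          refine ⟨e.symm j, ?_⟩
          rw [e.apply_symm_apply, hy]
          exact ⟨mul_le_mul_of_nonneg_left hj1 hD.le, mul_lt_mul_of_pos_left hj2 hD⟩
        -- Reflection turns tiles closed on the left into tiles closed on the right.
        · obtain ⟨j, hj1, hj2⟩ := exists_mem_Ioc_of_tiling hL1 hdisj hcover (fun j => (hLR j).1)
            (sub_pos.2 hy1) (by linarith)
          refine ⟨e.symm j, ?_⟩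
          rw [e.apply_symm_apply, hy]
          exact ⟨mul_le_mul_of_nonneg_left (by linarith) hD.le,
            mul_lt_mul_of_pos_left (by linarith) hD⟩
      envyFree := fun i j => by
        rw [hsum, hsum]
        exact hE _ _
      total_le := fun a => by
        have h1 := hE.total_le hA (e a)
        rw [← hsum a a, hF a 0 1 le_rfl zero_le_one le_rfl] at h1
        refine le_trans (le_of_eq (Finset.sum_congr rfl fun t _ => ?_)) h1
        have h2 : sideHi D t 0 1 = 2 * D := by cases t <;> simp [sideHi]
        have h3 : sideLo D t 0 1 = 0 := by cases t <;> simp [sideLo]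
        rw [h2, h3, cum_zero, sub_zero, cum_of_ge (G.home_le t) o a (by linarith : D ≤ 2 * D)] }
  refine ⟨E, fun a => p (e a), fun a => q (e a), fun a => ?_⟩
  obtain ⟨h1, h2, h3, h4, h5⟩ := hLR (e a)
  refine ⟨hApq _, by linarith, h3.le, by linarith, fun t => ?_, hsum a a⟩
  cases t <;> simp only [E, sideLo, sideHi] <;> constructor <;> gcongr

/-! ### The bad profile and the choice of parameters. -/

theorem lieCum_lt_one {f g : ℕ} {y : ℝ} (hy : y < f + 4) : lieCum f g y < 1 := by
  have hg : (0 : ℝ) ≤ g := Nat.cast_nonneg g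
  rw [lieCum, ramp_of_le (a := f + 5 + 2 * g) (by linarith) (by linarith)]
  rcases le_total y (f + 3) with h | h
  · rw [ramp_of_le (by linarith) h]; norm_num
  · rw [ramp_of_mem (by linarith) h hy.le, mul_zero, add_zero, div_lt_one (by linarith)]
    linarith

theorem one_lt_lieCum {f g : ℕ} {y : ℝ} (hy : f + 5 + 2 * g < y) : 1 < lieCum f g y := by
  have hg : (0 : ℝ) ≤ g := Nat.cast_nonneg g
  rw [lieCum, ramp_of_ge (a := f + 3) (by linarith) (by linarith)]
  have : 0 < ramp (f + 5 + 2 * g) (f + 6 + 2 * g) y := by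
    rcases le_total y (f + 6 + 2 * g) with h | h
    · rw [ramp_of_mem (by linarith) hy.le h]
      exact div_pos (by linarith) (by linarith)
    · rw [ramp_of_ge (by linarith) h]; norm_num
  linarith

theorem one_le_lieCum {f g : ℕ} {y : ℝ} (hy : (f : ℝ) + 4 ≤ y) : 1 ≤ lieCum f g y := by
  rw [lieCum, ramp_of_ge (a := f + 3) (by linarith) hy]
  linarith [ramp_nonneg (f + 5 + 2 * g) (f + 6 + 2 * g) y]

theorem lieCum_le_one {f g : ℕ} {y : ℝ} (hy : y ≤ f + 5 + 2 * g) : lieCum f g y ≤ 1 := by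
  rw [lieCum, ramp_of_le (a := f + 5 + 2 * g) (by linarith) hy]
  linarith [ramp_le_one (f + 3) (f + 4) y]

/-- A profile in which some agent always gets little, but can get `g + 1` by misreporting. -/
theorem GadgetParams.exists_profile {f : Bool → ℕ} {g n : ℕ} {D : ℝ} (G : GadgetParams f g D n)
    (hn : 2 + 2 * g + f false + f true = n) :
    ∃ F : Profile n, ∀ M : Mechanism n, M.EnvyFree → M.HasConnectedPieces →
      ∃ (i : Fin n) (d : Density), M.truthfulUtility F i ≤ 21 / 20 ∧
        (g : ℝ) + 1 ≤ M.utilityOfReport F i d := by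
  classical
  choose dens hdens using fun o a => G.exists_density o a
  let e : Agent f g ≃ Fin n := Fintype.equivFinOfCardEq ((Agent.card_eq f g).trans hn)
  refine ⟨fun i => dens none (e.symm i), fun M hM hc => ?_⟩
  set F : Profile n := fun i => dens none (e.symm i) with hF
  have hFe : ∀ a, F (e a) = dens none a := fun a => by simp [hF]
  obtain ⟨E, p, q, hE⟩ := exists_gadgetDivision (o := none) G e (F := F)
    (fun a => by rw [hFe]; exact hdens none a) (M.isAllocation F) (hM F) (hc F)
  obtain ⟨s, hs⟩ := E.exists_own_le
  refine ⟨e (.liar s), dens (some s) (.liar s), ?_, ?_⟩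
  · rw [(hE _).2.2.2.2.2] at hs
    exact hs
  set F' : Profile n := Function.update F (e (.liar s)) (dens (some s) (.liar s)) with hF'
  have hFe' : ∀ a u v, 0 ≤ u → u ≤ v → v ≤ 1 → value (F' (e a)) (Set.Icc u v) =
      ∑ t, (cum f g (some s) t a (sideHi D t u v) - cum f g (some s) t a (sideLo D t u v)) := by
    intro a u v h0 h1 h2
    by_cases ha : a = .liar s
    · subst ha
      rw [hF', Function.update_self]
      exact hdens _ _ u v h0 h1 h2
    · rw [hF', Function.update_of_ne (e.injective.ne ha), hFe, hdens none a u v h0 h1 h2]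
      refine Finset.sum_congr rfl fun t _ => ?_
      have : cum f g none t a = cum f g (some s) t a := by
        cases a with
        | liar s' =>
          have hs' : s ≠ s' := fun h => ha (by rw [h])
          simp [cum, hs']
        | guard s' i => rfl
        | filler s' i => rfl
      rw [this]
  obtain ⟨E', p', q', hE'⟩ := exists_gadgetDivision (o := some s) G e hFe' (M.isAllocation F')
    (hM F') (hc F')
  obtain ⟨h1, h2, h3, h4, h5, h6⟩ := hE' (.liar s)
  obtain ⟨h7, h8⟩ := E'.lie_units
  have hg : (0 : ℝ) ≤ g := Nat.cast_nonneg g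
  -- the parts of the enlarged piece outside the true one are worthless in the report
  rw [h1, hFe' _ _ _ h2 h3 h4] at h6
  have hle : ∀ t, cum f g (some s) t (.liar s) (sideHi D t (p' (.liar s)) (q' (.liar s))) ≤
      cum f g (some s) t (.liar s) (E'.hi t (.liar s)) := fun t => cum_mono _ _ _ _ _ (h5 t).2
  have hge : ∀ t, cum f g (some s) t (.liar s) (E'.lo t (.liar s)) ≤
      cum f g (some s) t (.liar s) (sideLo D t (p' (.liar s)) (q' (.liar s))) :=
    fun t => cum_mono _ _ _ _ _ (h5 t).1
  have key : cum f g (some s) s (.liar s) (sideHi D s (p' (.liar s)) (q' (.liar s))) =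
      cum f g (some s) s (.liar s) (E'.hi s (.liar s)) ∧
      cum f g (some s) s (.liar s) (E'.lo s (.liar s)) =
      cum f g (some s) s (.liar s) (sideLo D s (p' (.liar s)) (q' (.liar s))) := by
    have a1 := hle false
    have a2 := hle true
    have a3 := hge false
    have a4 := hge true
    unfold GadgetDivision.own Division.part at h6
    rw [Fintype.sum_bool, Fintype.sum_bool] at h6
    cases s <;> constructor <;> linarith
  rw [cum_lie] at key
  -- `lieCum` equals `1` exactly on the stretch from `f + 4` to `f + 5 + 2 * g`, which holds all
  -- units. Equal reported values therefore keep the true ends outside its interior.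
  have hlo : sideLo D s (p' (.liar s)) (q' (.liar s)) ≤ f s + 4 := by
    by_contra hcon
    linarith [lieCum_lt_one (g := g) h7, one_le_lieCum (g := g) (not_le.1 hcon).le]
  have hhi : f s + 5 + 2 * g ≤ sideHi D s (p' (.liar s)) (q' (.liar s)) := by
    by_contra hcon
    linarith [one_lt_lieCum h8, lieCum_le_one (not_le.1 hcon).le]
  change (g : ℝ) + 1 ≤ value (F (e (.liar s))) (M.alloc F' (e (.liar s)))
  rw [h1, hFe, hdens none _ _ _ h2 h3 h4]
  refine le_trans ?_ (Finset.single_le_sum (fun t _ => sub_nonneg.2 (cum_mono f g none t _ ?_))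
    (Finset.mem_univ s))
  · rw [cum_liar f g (by simp), liarCum_of_ge hhi, liarCum_of_le hlo]
    linarith [ramp_le_one (3 / 16) (1 / 4) (sideLo D s (p' (.liar s)) (q' (.liar s)))]
  · obtain ⟨-, -, h9, -⟩ := G.layout t
    have : (0 : ℝ) ≤ f t := Nat.cast_nonneg _
    cases t <;> simp only [sideLo, sideHi] <;> gcongr <;> linarith

/-- With `g = k - 1`, the agents other than liars and guards become fillers, split between the sides
as evenly as possible. -/
theorem exists_profile {k n : ℕ} (hk : 2 ≤ k) (h1 : 8 * k ≤ n + 3) (h2 : n ≤ 16 * k) :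
    ∃ F : Profile n, ∀ M : Mechanism n, M.EnvyFree → M.HasConnectedPieces →
      ∃ (i : Fin n) (d : Density), M.truthfulUtility F i ≤ 21 / 20 ∧
        (k : ℝ) ≤ M.utilityOfReport F i d := by
  obtain ⟨g, rfl⟩ : ∃ g, k = g + 1 := ⟨k - 1, by omega⟩
  obtain ⟨b, hb⟩ : ∃ b, b = (n - 2 * (g + 1)) / 2 := ⟨_, rfl⟩
  have hn : ∀ s : Bool, n < 4 * (if s then b else n - 2 * (g + 1) - b) + 4 := by
    intro s
    cases s <;> simp <;> omega
  have G : GadgetParams (fun s => if s then b else n - 2 * (g + 1) - b) g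
      (2 * n + 2 * g + 6) n := by
    refine ⟨fun s => ?_, fun s => ?_, by omega, fun s => ?_, h2⟩
    · unfold homeStart
      have : (if s then b else n - 2 * (g + 1) - b) ≤ n := by cases s <;> simp <;> omega
      have : (((if s then b else n - 2 * (g + 1) - b : ℕ)) : ℝ) ≤ n := by exact_mod_cast this
      linarith
    · cases s <;> simp <;> omega
    · have : (n : ℝ) < 4 * ((if s then b else n - 2 * (g + 1) - b : ℕ) : ℝ) + 4 := by
        exact_mod_cast hn s
      linarith
  obtain ⟨F, hF⟩ := G.exists_profile (by simp; omega)
  exact ⟨F, by push_cast; exact hF⟩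

/-- The density with constant value `c`. -/
noncomputable def Density.const (c : ℝ) (hc : 0 < c) : Density where
  toFun := (Set.Icc 0 1).indicator fun _ => c
  nonneg x := Set.indicator_nonneg (fun _ _ => hc.le) x
  eq_zero_outside x hx := Set.indicator_of_notMem hx _
  piecewiseConstant := isPiecewiseConstant_indicator c le_rfl zero_le_one le_rfl
  total_pos := by
    rw [setIntegral_indicator measurableSet_Icc]
    simpa using hc

theorem Density.value_const (c : ℝ) (hc : 0 < c) :
    value (Density.const c hc) (Set.Icc 0 1) = c := by
  unfold value Density.const
  rw [setIntegral_indicator measurableSet_Icc]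
  simp

theorem Mechanism.one_le_incentiveRatio {n : ℕ} (hn : 1 ≤ n) (M : Mechanism n) (hM : M.EnvyFree) :
    1 ≤ M.incentiveRatio := by
  have h := M.le_incentiveRatio hM (fun _ => Density.const 1 zero_lt_one) ⟨0, hn⟩
    (Density.const 1 zero_lt_one) (r := 1) (by
      rw [one_mul, Mechanism.utilityOfReport, Function.update_eq_self_iff.2 rfl]
      exact le_rfl)
  rwa [ENNReal.ofReal_one] at h

/-- Agents with the same density get the same value. -/
theorem IsEnvyFreeAllocation.mul_value_const {n : ℕ} {d : Density} {A : Fin n → Set ℝ}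
    (hA : IsAllocation (fun _ => d) A) (hE : IsEnvyFreeAllocation (fun _ => d) A) (i : Fin n) :
    n * value d (A i) = value d (Set.Icc 0 1) := by
  rw [← hA.sum_value i, Finset.sum_congr rfl fun j _ => le_antisymm (hE i j) (hE j i)]
  simp

theorem ofReal_div_forty_le_incentiveRatio {n : ℕ} (hn : 1 ≤ n) (M : Mechanism n)
    (hM : M.EnvyFree) (hc : M.HasConnectedPieces) :
    ENNReal.ofReal (1 / 40 * n) ≤ M.incentiveRatio := by
  rcases lt_or_ge n 13 with h | h
  · refine le_trans ?_ (M.one_le_incentiveRatio hn hM)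
    rw [ENNReal.ofReal_le_one]
    have : (n : ℝ) ≤ 13 := by exact_mod_cast h.le
    linarith
  -- From `13` agents on this `k` is at least `2`; for fewer agents the trivial ratio `1` suffices.
  · obtain ⟨k, hk⟩ : ∃ k, k = (n + 3) / 8 := ⟨_, rfl⟩
    obtain ⟨F, hF⟩ := exists_profile (k := k) (n := n) (by omega) (by omega) (by omega)
    obtain ⟨i, d, h1, h2⟩ := hF M hM hc
    refine M.le_incentiveRatio hM F i d (le_trans ?_ h2)
    have h3 : (n : ℝ) ≤ 16 * k := by exact_mod_cast (by omega : n ≤ 16 * k)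
    have h4 : (0 : ℝ) ≤ n := Nat.cast_nonneg n
    calc 1 / 40 * (n : ℝ) * M.truthfulUtility F i ≤ 1 / 40 * n * (21 / 20) := by gcongr
      _ ≤ k := by linarith

theorem exists_bad_profile {k : ℕ} (hk : 1 ≤ k) : ∃ f : Profile (8 * k - 3),
    ∀ M : Mechanism (8 * k - 3), M.EnvyFree → M.HasConnectedPieces →
      ∃ i : Fin (8 * k - 3), M.truthfulUtility f i ≤ 11 / 10 ∧
        ∃ g : Density, (k : ℝ) ≤ M.utilityOfReport f i g := by
  rcases hk.eq_or_lt with rfl | hk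
  -- For `k = 1` the five agents share a uniform cake of value `5`; each gets exactly `1`, and the
  -- truth serves as the report.
  · have h5 : (0 : ℝ) < 5 := by norm_num
    obtain ⟨i⟩ : Nonempty (Fin (8 * 1 - 3)) := ⟨⟨0, by norm_num⟩⟩
    refine ⟨fun _ => Density.const 5 h5, fun M hM _ => ?_⟩
    have h := (hM fun _ => Density.const 5 h5).mul_value_const (M.isAllocation _) i
    rw [Density.value_const] at h
    norm_num at h
    refine ⟨i, ?_, Density.const 5 h5, ?_⟩
    · unfold Mechanism.truthfulUtility
      linarith
    · rw [Mechanism.utilityOfReport, Function.update_eq_self_iff.2 rfl]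
      norm_num
      linarith
  · obtain ⟨F, hF⟩ := exists_profile (k := k) (n := 8 * k - 3) hk (by omega) (by omega)
    refine ⟨F, fun M hM hc => ?_⟩
    obtain ⟨i, d, h1, h2⟩ := hF M hM hc
    exact ⟨i, by linarith, d, h2⟩

end CakeCutting

theorem mainTheorem9 :
    -- upper bound
    (∀ n : ℕ, 1 ≤ n → ∀ M : CakeCutting.Mechanism n, M.EnvyFree → M.HasConnectedPieces →
      M.incentiveRatio ≤ (n : ENNReal)) ∧
    -- lower bound, linear in the number of agents, with an absolute constant
    (∃ c : ℝ, 0 < c ∧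
      ∀ n : ℕ, 1 ≤ n → ∀ M : CakeCutting.Mechanism n, M.EnvyFree → M.HasConnectedPieces →
        ENNReal.ofReal (c * n) ≤ M.incentiveRatio) ∧
    -- a single profile of `8k - 3` agents that is bad for all mechanisms
    (∀ k : ℕ, 1 ≤ k → ∃ f : CakeCutting.Profile (8 * k - 3),
      ∀ M : CakeCutting.Mechanism (8 * k - 3), M.EnvyFree → M.HasConnectedPieces →
        ∃ i : Fin (8 * k - 3),
          M.truthfulUtility f i ≤ 11 / 10 ∧
          ∀ ε : ℝ, 0 < ε → ∃ g : CakeCutting.Density, (k : ℝ) - ε ≤ M.utilityOfReport f i g) := by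
  refine ⟨fun n _ M hM _ => M.incentiveRatio_le hM, ⟨1 / 40, by norm_num,
    fun n hn M hM hc => CakeCutting.ofReal_div_forty_le_incentiveRatio hn M hM hc⟩, fun k hk => ?_⟩
  obtain ⟨F, hF⟩ := CakeCutting.exists_bad_profile hk
  refine ⟨F, fun M hM hc => ?_⟩
  obtain ⟨i, h1, d, h2⟩ := hF M hM hc
  exact ⟨i, h1, fun ε hε => ⟨d, by linarith⟩⟩
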